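/- **Setting.** Let $n\ge 1$, let $M_n$ be the algebra of complex $n\times n$ matrices, and let $\mathfrak U_n=\mathcal U_n/(\mathbb T\cdot I)$ be the unitary group of $M_n$ modulo unimodular scalars. For a complex algebra $\mathcal B$, $\mathfrak U_n$ acts on $M_n(\mathcal B)$ by $u.A=UAU^{-1}$, where $U$ is any unitary matrix representing $u$. An *$n$-space* is a locally compact Hausdorff space $X$ with a continuous free action of $\mathfrak U_n$; $\mathfrak B(X)$ denotes its Borel $\sigma$-algebra. A $C^*$-algebra is *$n$-homogeneous* if each of its nonzero irreducible representations is $n$-dimensional. A system $T=(T_1,\dots,T_k)$ of bounded operators on a complex Hilbert space $\mathcal H$ is *$n$-homogeneous* if the (not necessarily unital) $C^*$-algebra $C^*(T)$ generated by $T_1,\dots,T_k$ is $n$-homogeneous. The *$n$-spectrum* of $T$ is $$\sigma_n(T)=\{(\pi(T_1),\dots,\pi(T_k)) : \pi\colon C^*(T)\to M_n \text{ a nonzero } *\text{-homomorphism}\}\subset (M_n)^k,$$ with the subspace topology and the action $u.(A_1,\dots,A_k)=(u.A_1,\dots,u.A_k)$. Let $X$ be an $n$-space. A *regular operator-valued $n$-measure*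 on $X$ is a function $E=[E_{jk}]\colon\mathfrak B(X)\to M_n(\mathcal B(\mathcal H))$, where $\mathcal B(\mathcal H)$ is the algebra of bounded operators on $\mathcal H$, such that for all $j,k$ and all $h,w\in\mathcal H$ the function $E_{jk}^{(h,w)}(A)=\langle E_{jk}(A)h,w\rangle$ is a regular complex Borel measure, and $E(u.A)=u.E(A)$ for all $u\in\mathfrak U_n$ and $A\in\mathfrak B(X)$. For a bounded Borel function $f=[f_{jk}]\colon X\to M_n$ the bounded operator $\int f\,dE$ is defined by $$\Big\langle\Big(\int f\,dE\Big)h,w\Big\rangle=\sum_{j,k}\int_X f_{jk}\,dE_{kj}^{(h,w)}\qquad(h,w\in\mathcal H).$$ Such an $E$ is a *spectral $n$-measure* if $(\int f\,dE)^*=\int f^*\,dE$ and $\int fg\,dE=\int f\,dE\cdot\int g\,dE$ for all bounded Borel functions $f,g\colon X\to M_n$ with $f(u.x)=u.f(x)$ and $g(u.x)=u.g(x)$ for all $u\in\mathfrak U_n$, $x\in X$ (adjoints and products of functions are pointwise). **Theorem.** Let $n\ge1$ and let $T=(T_1,\dots,T_k)$ be an $n$-homogeneous system of bounded operators on a complex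 Hilbert space $\mathcal H$. Then $\sigma_n(T)$ is an $n$-space, and there exists a unique spectral $n$-measure $E_T\colon\mathfrak B(\sigma_n(T))\to M_n(\mathcal B(\mathcal H))$ such that $$\int p_j\,dE_T=T_j\qquad(j=1,\dots,k),$$ where $p_j\colon\sigma_n(T)\to M_n$ is the coordinate projection $p_j(A_1,\dots,A_k)=A_j$. -/

import Mathlib

open MeasureTheory
open scoped Pointwise InnerProductSpace Matrix

noncomputable section

namespace HomogeneousSystem

universe u

/-! ### The group `U_n / (𝕋 · I)` and its actions on matrices -/

/-- The subgroup `𝕋 · I` of the unitary group of `n × n` complex matrices. -/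
def scalarUnitary (n : ℕ) : Subgroup (Matrix.unitaryGroup (Fin n) ℂ) where
  carrier := {U | ∃ z : Circle, (U : Matrix (Fin n) (Fin n) ℂ) = (z : ℂ) • 1}
  one_mem' := ⟨1, by simp⟩
  mul_mem' := by
    rintro U V ⟨z, hz⟩ ⟨w, hw⟩
    exact ⟨z * w, by simp [hz, hw, smul_smul, mul_comm]⟩
  inv_mem' := by
    rintro U ⟨z, hz⟩
    refine ⟨z⁻¹, ?_⟩
    rw [Matrix.UnitaryGroup.inv_val, hz]
    rw [Circle.coe_inv_eq_conj]
    simp [star_smul]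

instance (n : ℕ) : (scalarUnitary n).Normal where
  conj_mem := by
    rintro U ⟨z, hz⟩ V
    refine ⟨z, ?_⟩
    have h := V.2.2
    rw [Matrix.UnitaryGroup.mul_val, Matrix.UnitaryGroup.mul_val, hz,
      Matrix.UnitaryGroup.inv_val]
    simp [h]

/-- The group `U_n / (𝕋 · I)`. -/
def ProjUnitary (n : ℕ) : Type :=
  Matrix.unitaryGroup (Fin n) ℂ ⧸ scalarUnitary n

instance (n : ℕ) : Group (ProjUnitary n) :=
  inferInstanceAs (Group (Matrix.unitaryGroup (Fin n) ℂ ⧸ scalarUnitary n))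

instance (n : ℕ) : TopologicalSpace (ProjUnitary n) :=
  inferInstanceAs (TopologicalSpace (Matrix.unitaryGroup (Fin n) ℂ ⧸ scalarUnitary n))

/-- The quotient homomorphism `U_n → U_n / (𝕋 · I)`. -/
def ProjUnitary.mk (n : ℕ) : Matrix.unitaryGroup (Fin n) ℂ →* ProjUnitary n :=
  QuotientGroup.mk' (scalarUnitary n)

/-- `U A U⁻¹` for a unitary `U` and a matrix `A` with entries in a complex algebra `B`. -/
def conjMatrix {n : ℕ} {B : Type*} [Ring B] [Algebra ℂ B]
    (U : Matrix.unitaryGroup (Fin n) ℂ) (A : Matrix (Fin n) (Fin n) B) :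
    Matrix (Fin n) (Fin n) B :=
  (U : Matrix (Fin n) (Fin n) ℂ).map (algebraMap ℂ B) * A *
    ((U⁻¹ : Matrix.unitaryGroup (Fin n) ℂ) : Matrix (Fin n) (Fin n) ℂ).map (algebraMap ℂ B)

theorem conjMatrix_one {n : ℕ} {B : Type*} [Ring B] [Algebra ℂ B]
    (A : Matrix (Fin n) (Fin n) B) : conjMatrix 1 A = A := by
  simp [conjMatrix, -Matrix.UnitaryGroup.inv_val]

theorem conjMatrix_mul {n : ℕ} {B : Type*} [Ring B] [Algebra ℂ B]
    (U V : Matrix.unitaryGroup (Fin n) ℂ) (A : Matrix (Fin n) (Fin n) B) :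
    conjMatrix (U * V) A = conjMatrix U (conjMatrix V A) := by
  simp only [conjMatrix, mul_inv_rev, Matrix.UnitaryGroup.mul_val, Matrix.map_mul, mul_assoc]

theorem conjMatrix_of_mem {n : ℕ} {B : Type*} [Ring B] [Algebra ℂ B]
    {U : Matrix.unitaryGroup (Fin n) ℂ} (hU : U ∈ scalarUnitary n)
    (A : Matrix (Fin n) (Fin n) B) : conjMatrix U A = A := by
  obtain ⟨z, hz⟩ := hU
  obtain ⟨w, hw⟩ := (scalarUnitary n).inv_mem (x := U) ⟨z, hz⟩
  have h1 : ∀ c : ℂ, ((c • 1 : Matrix (Fin n) (Fin n) ℂ)).map (algebraMap ℂ B)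
      = c • (1 : Matrix (Fin n) (Fin n) B) := by
    intro c
    ext i j
    by_cases h : i = j <;> simp [h, Algebra.algebraMap_eq_smul_one]
  have h2 : ((z : ℂ) * (w : ℂ)) • (1 : Matrix (Fin n) (Fin n) ℂ) = 1 := by
    have := congrArg (fun W : Matrix.unitaryGroup (Fin n) ℂ =>
      (W : Matrix (Fin n) (Fin n) ℂ)) (mul_inv_cancel U)
    simp only [Matrix.UnitaryGroup.mul_val, hz, hw, Matrix.UnitaryGroup.one_val] at this
    simpa [smul_smul, mul_comm] using this
  have h3 : ((z : ℂ) * (w : ℂ)) • (1 : Matrix (Fin n) (Fin n) B) = 1 := by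
    rw [← h1, h2]; simp
  rw [conjMatrix, hz, hw, h1, h1]
  calc (z : ℂ) • (1 : Matrix (Fin n) (Fin n) B) * A * (w : ℂ) • (1 : Matrix (Fin n) (Fin n) B)
      = (((z : ℂ) * (w : ℂ)) • (1 : Matrix (Fin n) (Fin n) B)) * A := by
        simp [smul_smul, mul_comm]
    _ = A := by rw [h3, one_mul]

/-- The action of `U_n / (𝕋 · I)` on `n × n` matrices over a complex algebra `B`: the class of
`U` sends `A` to `U A U⁻¹`. -/
instance {n : ℕ} {B : Type*} [Ring B] [Algebra ℂ B] :
    MulAction (ProjUnitary n) (Matrix (Fin n) (Fin n) B) where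
  smul u A := Quotient.liftOn' u (fun U => conjMatrix U A) (by
    intro U V h
    have h' : U⁻¹ * V ∈ scalarUnitary n := QuotientGroup.leftRel_apply.mp h
    have : conjMatrix V A = conjMatrix (U * (U⁻¹ * V)) A := by simp
    simp only [this]
    rw [conjMatrix_mul, conjMatrix_of_mem h'])
  one_smul A := conjMatrix_one A
  mul_smul u v A := Quotient.inductionOn₂' u v fun U V => conjMatrix_mul U V A

theorem mk_smul {n : ℕ} {B : Type*} [Ring B] [Algebra ℂ B]
    (U : Matrix.unitaryGroup (Fin n) ℂ) (A : Matrix (Fin n) (Fin n) B) :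
    ProjUnitary.mk n U • A = conjMatrix U A := rfl

theorem mk_surjective (n : ℕ) : Function.Surjective (ProjUnitary.mk n) :=
  QuotientGroup.mk'_surjective _

/-! ### `n`-spaces -/

/-- An `n`-space: a locally compact Hausdorff space with a continuous free action of
`U_n / (𝕋 · I)`. -/
structure IsNSpace (n : ℕ) (X : Type*) [TopologicalSpace X] [MulAction (ProjUnitary n) X] :
    Prop where
  locallyCompact : LocallyCompactSpace X
  t2 : T2Space X
  continuous_smul : Continuous fun p : ProjUnitary n × X => p.1 • p.2
  free : ∀ (u : ProjUnitary n) (x : X), u • x = x → u = 1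

/-- The bounded Borel functions `f : X → M_n` with `f (u . x) = u . f x`. Boundedness and
measurability are expressed through the entries. -/
structure IsBoundedBorelEquivariant {n : ℕ} {X : Type*} [MeasurableSpace X]
    [MulAction (ProjUnitary n) X] (f : X → Matrix (Fin n) (Fin n) ℂ) : Prop where
  measurable : ∀ i j, Measurable fun x => f x i j
  bounded : ∃ C : ℝ, ∀ x i j, ‖f x i j‖ ≤ C
  equivariant : ∀ (u : ProjUnitary n) (x : X), f (u • x) = u • f x

/-! ### Operator-valued measures -/

/-- An operator-valued measure on (the measurable subsets of) `X`: each function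
`A ↦ ⟨E(A) h, w⟩` is countably additive. As for Mathlib's `VectorMeasure`, the value on
non-measurable sets is fixed to be `0`. Mathlib's inner product is linear in the second
variable. -/
@[ext]
structure OperatorMeasure (X : Type*) [MeasurableSpace X] (H : Type*) [NormedAddCommGroup H]
    [InnerProductSpace ℂ H] where
  toFun : Set X → H →L[ℂ] H
  empty : toFun ∅ = 0
  not_measurable : ∀ A, ¬ MeasurableSet A → toFun A = 0
  hasSum_iUnion : ∀ (h w : H) (A : ℕ → Set X), (∀ i, MeasurableSet (A i)) →
    Pairwise (Function.onFun Disjoint A) →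
    HasSum (fun i => ⟪w, toFun (A i) h⟫_ℂ) ⟪w, toFun (⋃ i, A i) h⟫_ℂ

variable {X : Type*} [MeasurableSpace X] {H : Type*} [NormedAddCommGroup H]
  [InnerProductSpace ℂ H]

/-- The complex measure `A ↦ ⟨E(A) h, w⟩`. -/
def OperatorMeasure.scalar (E : OperatorMeasure X H) (h w : H) : ComplexMeasure X where
  measureOf' A := ⟪w, E.toFun A h⟫_ℂ
  empty' := by simp [E.empty]
  not_measurable' A hA := by simp [E.not_measurable A hA]
  m_iUnion' A hA hd := E.hasSum_iUnion h w A hA hd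

/-- The integral of a complex function with respect to a complex measure. -/
def complexIntegral (μ : ComplexMeasure X) (f : X → ℂ) : ℂ :=
  VectorMeasure.integral μ f (ContinuousLinearMap.mul ℝ ℂ)

/-- `T = ∫ f dE`, that is, `⟨T h, w⟩ = ∫ f dE^{(h,w)}` for all `h, w`. -/
def OperatorMeasure.HasIntegral (E : OperatorMeasure X H) (f : X → ℂ) (T : H →L[ℂ] H) : Prop :=
  ∀ h w : H, ⟪w, T h⟫_ℂ = complexIntegral (E.scalar h w) f

theorem isFiniteMeasure_variation (μ : ComplexMeasure X) : IsFiniteMeasure μ.variation := by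
  have h : μ.variation ≤ (ComplexMeasure.re μ).totalVariation
      + (ComplexMeasure.im μ).totalVariation := by
    apply VectorMeasure.variation_le_of_forall_enorm_le
    intro A hA
    have h1 : ‖μ A‖ₑ ≤ ‖(μ A).re‖ₑ + ‖(μ A).im‖ₑ := by
      have := Complex.norm_le_abs_re_add_abs_im (μ A)
      simp only [← ofReal_norm, Real.norm_eq_abs]
      rw [← ENNReal.ofReal_add (abs_nonneg _) (abs_nonneg _)]
      exact ENNReal.ofReal_le_ofReal this
    refine h1.trans ?_
    rw [Measure.add_apply]
    exact add_le_add ((ComplexMeasure.re μ).enorm_le_totalVariation A)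
      ((ComplexMeasure.im μ).enorm_le_totalVariation A)
  exact isFiniteMeasure_of_le _ h

theorem integrable_of_bounded (μ : ComplexMeasure X) {f : X → ℂ} (hf : Measurable f) {C : ℝ}
    (hC : ∀ x, ‖f x‖ ≤ C) : μ.Integrable f :=
  have := isFiniteMeasure_variation μ
  Integrable.of_bound hf.aestronglyMeasurable C (Filter.Eventually.of_forall hC)

theorem complexIntegral_indicator (μ : ComplexMeasure X) {A : Set X} (hA : MeasurableSet A)
    (c : ℂ) : complexIntegral μ (A.indicator fun _ => c) = c * μ A := by
  have := isFiniteMeasure_variation μ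
  unfold complexIntegral
  rw [VectorMeasure.integral_eq_setToFun, setToFun_indicator_const _ hA (measure_ne_top _ _)]
  rfl

theorem OperatorMeasure.exists_hasIntegral_simpleFunc (E : OperatorMeasure X H)
    (s : SimpleFunc X ℂ) : ∃ T, E.HasIntegral s T := by
  induction s using SimpleFunc.induction with
  | const c hA =>
    rename_i A
    refine ⟨c • E.toFun A, fun h w => ?_⟩
    have : ⇑(SimpleFunc.piecewise A hA (SimpleFunc.const X c) (SimpleFunc.const X 0))
        = A.indicator fun _ => c := by
      ext x
      by_cases hx : x ∈ A <;> simp [hx]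
    rw [this, complexIntegral_indicator _ hA]
    simp [scalar]
  | add hd hf hg =>
    rename_i f g
    obtain ⟨T, hT⟩ := hf
    obtain ⟨S, hS⟩ := hg
    have hb : ∀ (μ : ComplexMeasure X) (f : SimpleFunc X ℂ), μ.Integrable f := by
      intro μ f
      obtain ⟨C, hC⟩ := f.exists_forall_norm_le
      exact integrable_of_bounded μ f.measurable hC
    refine ⟨T + S, fun h w => ?_⟩
    unfold HasIntegral complexIntegral at *
    rw [SimpleFunc.coe_add, VectorMeasure.integral_add (hb _ f) (hb _ g), ← hT, ← hS]
    simp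

/-- A sequence of bounded operators that converges weakly has a bounded weak limit. -/
theorem exists_weak_limit [CompleteSpace H] (T : ℕ → H →L[ℂ] H) (L : H → H → ℂ)
    (hL : ∀ h w, Filter.Tendsto (fun m => ⟪w, T m h⟫_ℂ) Filter.atTop (nhds (L h w))) :
    ∃ S : H →L[ℂ] H, ∀ h w, ⟪w, S h⟫_ℂ = L h w := by
  have h1 : ∀ h, ∃ C, ∀ m, ‖T m h‖ ≤ C := by
    intro h
    have : ∀ w, ∃ C, ∀ m, ‖innerSL ℂ (T m h) w‖ ≤ C := by
      intro w
      obtain ⟨C, hC⟩ := (hL h w).norm.bddAbove_range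
      refine ⟨C, fun m => ?_⟩
      rw [innerSL_apply_apply, norm_inner_symm]
      exact hC ⟨m, rfl⟩
    obtain ⟨C, hC⟩ := banach_steinhaus this
    exact ⟨C, fun m => by simpa using hC m⟩
  obtain ⟨C, hC⟩ := banach_steinhaus h1
  have hlin : ∀ h, ∃ v : H, ∀ w, ⟪w, v⟫_ℂ = L h w := by
    intro h
    let φ : H →ₗ[ℂ] ℂ :=
      { toFun := fun w => star (L h w)
        map_add' := fun w w' => by
          rw [← star_add]
          congr 1
          refine tendsto_nhds_unique (hL h (w + w')) ?_
          simpa only [inner_add_left] using (hL h w).add (hL h w')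
        map_smul' := fun c w => by
          have : L h (c • w) = star c * L h w := by
            refine tendsto_nhds_unique (hL h (c • w)) ?_
            simpa only [inner_smul_left, starRingEnd_apply] using (hL h w).const_mul (star c)
          simp [this] }
    have hφ : ∀ w, ‖φ w‖ ≤ (C * ‖h‖) * ‖w‖ := by
      intro w
      have : ‖L h w‖ ≤ (C * ‖h‖) * ‖w‖ := by
        refine le_of_tendsto (hL h w).norm (Filter.Eventually.of_forall fun m => ?_)
        calc ‖⟪w, T m h⟫_ℂ‖ ≤ ‖w‖ * ‖T m h‖ := norm_inner_le_norm _ _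
          _ ≤ ‖w‖ * (C * ‖h‖) := by
            gcongr
            exact (T m).le_of_opNorm_le (hC m) h
          _ = _ := mul_comm _ _
      simpa [φ] using this
    refine ⟨(InnerProductSpace.toDual ℂ H).symm (φ.mkContinuous _ hφ), fun w => ?_⟩
    rw [← inner_conj_symm, InnerProductSpace.toDual_symm_apply]
    simp [φ]
  choose v hv using hlin
  have hbound : ∀ h, ‖v h‖ ≤ C * ‖h‖ := by
    intro h
    have h2 : ‖⟪v h, v h⟫_ℂ‖ ≤ ‖v h‖ * (C * ‖h‖) := by
      rw [hv]
      refine le_of_tendsto (hL h (v h)).norm (Filter.Eventually.of_forall fun m => ?_)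
      exact (norm_inner_le_norm _ _).trans
        (mul_le_mul_of_nonneg_left ((T m).le_of_opNorm_le (hC m) h) (norm_nonneg _))
    rw [inner_self_eq_norm_sq_to_K] at h2
    have h3 : ‖v h‖ * ‖v h‖ ≤ ‖v h‖ * (C * ‖h‖) := by simpa [pow_two] using h2
    rcases (norm_nonneg (v h)).eq_or_lt with h0 | h0
    · rw [← h0]
      exact mul_nonneg ((norm_nonneg _).trans (hC 0)) (norm_nonneg _)
    · exact le_of_mul_le_mul_left h3 h0
  let S : H →ₗ[ℂ] H :=
    { toFun := v
      map_add' := fun a b => by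
        refine ext_inner_left ℂ fun w => ?_
        rw [inner_add_right, hv, hv, hv]
        refine tendsto_nhds_unique (hL (a + b) w) ?_
        simpa only [map_add, inner_add_right] using (hL a w).add (hL b w)
      map_smul' := fun c a => by
        refine ext_inner_left ℂ fun w => ?_
        rw [RingHom.id_apply, inner_smul_right, hv, hv]
        refine tendsto_nhds_unique (hL (c • a) w) ?_
        simpa only [map_smul, inner_smul_right] using (hL a w).const_mul c }
  exact ⟨S.mkContinuous C hbound, fun h w => hv h w⟩

theorem OperatorMeasure.exists_hasIntegral [CompleteSpace H] (E : OperatorMeasure X H)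
    {f : X → ℂ} (hf : Measurable f) {C : ℝ} (hC : ∀ x, ‖f x‖ ≤ C) : ∃ T, E.HasIntegral f T := by
  let s : ℕ → SimpleFunc X ℂ := hf.stronglyMeasurable.approxBounded C
  choose T hT using fun m => E.exists_hasIntegral_simpleFunc (s m)
  refine exists_weak_limit T (fun h w => complexIntegral (E.scalar h w) f) fun h w => ?_
  have := isFiniteMeasure_variation (E.scalar h w)
  simp only [hT _ h w]
  rcases isEmpty_or_nonempty X with hX | ⟨⟨x₀⟩⟩
  · have : ∀ m, (s m : X → ℂ) = f := fun m => funext fun x => hX.elim x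
    simp [this]
  have hC0 : 0 ≤ C := (norm_nonneg _).trans (hC x₀)
  refine VectorMeasure.tendsto_integral_of_dominated_convergence (fun _ => C)
    (fun m => (s m).measurable.aestronglyMeasurable) (integrable_const C)
    (fun m => Filter.Eventually.of_forall fun x =>
      hf.stronglyMeasurable.norm_approxBounded_le hC0 m x)
    (Filter.Eventually.of_forall fun x =>
      hf.stronglyMeasurable.tendsto_approxBounded_of_norm_le (hC x))

open Classical in
/-- The bounded operator `∫ f dE` determined by `⟨(∫ f dE) h, w⟩ = ∫ f dE^{(h,w)}`. It exists for
every bounded measurable `f`, see `OperatorMeasure.hasIntegral_integral`. -/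
def OperatorMeasure.integral (E : OperatorMeasure X H) (f : X → ℂ) : H →L[ℂ] H :=
  if h : ∃ T, E.HasIntegral f T then h.choose else 0

theorem OperatorMeasure.hasIntegral_integral [CompleteSpace H] (E : OperatorMeasure X H)
    {f : X → ℂ} (hf : Measurable f) {C : ℝ} (hC : ∀ x, ‖f x‖ ≤ C) :
    E.HasIntegral f (E.integral f) := by
  have h := E.exists_hasIntegral hf hC
  rw [OperatorMeasure.integral, dif_pos h]
  exact h.choose_spec

/-! ### Operator-valued `n`-measures and spectral `n`-measures -/

/-- An operator-valued `n`-measure on the `n`-space `X`: an `n × n` matrix `E = [E_{jk}]` of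
operator-valued measures on the Borel sets with `E(u . A) = u . E(A)`. -/
@[ext]
structure OperatorNMeasure (n : ℕ) (X : Type*) [MeasurableSpace X] [MulAction (ProjUnitary n) X]
    (H : Type*) [NormedAddCommGroup H] [InnerProductSpace ℂ H] where
  entry : Fin n → Fin n → OperatorMeasure X H
  equivariant : ∀ (u : ProjUnitary n) (A : Set X), MeasurableSet A →
    (Matrix.of fun j k => (entry j k).toFun (u • A)) =
      u • (Matrix.of fun j k => (entry j k).toFun A)

/-- `∫ f dE = ∑_{j,k} ∫ f_{jk} dE_{kj}` for a bounded Borel function `f : X → M_n`. -/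
def OperatorNMeasure.integral {n : ℕ} [MulAction (ProjUnitary n) X] (E : OperatorNMeasure n X H)
    (f : X → Matrix (Fin n) (Fin n) ℂ) : H →L[ℂ] H :=
  ∑ j, ∑ k, (E.entry k j).integral fun x => f x j k

/-- A spectral `n`-measure: a regular operator-valued `n`-measure for which `f ↦ ∫ f dE`
respects adjoints and products of bounded equivariant Borel functions. Regularity of a complex
measure is regularity of its total variation. -/
structure OperatorNMeasure.IsSpectral {n : ℕ} [TopologicalSpace X] [BorelSpace X]
    [MulAction (ProjUnitary n) X] [CompleteSpace H] (E : OperatorNMeasure n X H) : Prop where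
  regular : ∀ (j k : Fin n) (h w : H), ((E.entry j k).scalar h w).variation.Regular
  integral_star : ∀ f : X → Matrix (Fin n) (Fin n) ℂ, IsBoundedBorelEquivariant f →
    ContinuousLinearMap.adjoint (E.integral f) = E.integral fun x => (f x)ᴴ
  integral_mul : ∀ f g : X → Matrix (Fin n) (Fin n) ℂ, IsBoundedBorelEquivariant f →
    IsBoundedBorelEquivariant g →
    E.integral (fun x => f x * g x) = E.integral f * E.integral g

/-! ### Homogeneous systems and the `n`-spectrum -/

/-- A `*`-representation on a Hilbert space `K` is irreducible if `0` and `K` are the only closed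
invariant subspaces. -/
def IsIrreducibleRep {A : Type*} [NonUnitalCStarAlgebra A] {K : Type*} [NormedAddCommGroup K]
    [InnerProductSpace ℂ K] [CompleteSpace K] (π : A →⋆ₙₐ[ℂ] (K →L[ℂ] K)) : Prop :=
  ∀ M : Submodule ℂ K, IsClosed (M : Set K) → (∀ a : A, ∀ v ∈ M, π a v ∈ M) → M = ⊥ ∨ M = ⊤

/-- A `C*`-algebra is `n`-homogeneous if all its nonzero irreducible representations are
`n`-dimensional. Every irreducible representation of `A` is unitarily equivalent to one on
a Hilbert space in the universe of `A`. -/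
def IsHomogeneousCStarAlgebra (n : ℕ) (A : Type u) [NonUnitalCStarAlgebra A] : Prop :=
  ∀ (K : Type u) [NormedAddCommGroup K] [InnerProductSpace ℂ K] [CompleteSpace K]
    (π : A →⋆ₙₐ[ℂ] (K →L[ℂ] K)), π ≠ 0 → IsIrreducibleRep π → Module.rank ℂ K = n

variable {A : Type u} [NonUnitalCStarAlgebra A] {k : ℕ}

/-- The (not necessarily unital) `C*`-subalgebra `C*(x_1, …, x_k)` of `A`. -/
def generatedCStar (x : Fin k → A) : NonUnitalStarSubalgebra ℂ A :=
  (NonUnitalStarAlgebra.adjoin ℂ (Set.range x)).topologicalClosure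

theorem mem_generatedCStar (x : Fin k → A) (j : Fin k) : x j ∈ generatedCStar x :=
  NonUnitalStarSubalgebra.le_topologicalClosure _
    (NonUnitalStarAlgebra.subset_adjoin ℂ _ (Set.mem_range_self j))

instance (x : Fin k → A) : NonUnitalCStarAlgebra (generatedCStar x) :=
  NonUnitalStarSubalgebra.nonUnitalCStarAlgebra _
    (h_closed := NonUnitalStarSubalgebra.isClosed_topologicalClosure _)

/-- The system `(x_1, …, x_k)` is `n`-homogeneous if the `C*`-algebra it generates is. -/
def IsHomogeneousSystem (n : ℕ) (x : Fin k → A) : Prop :=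
  IsHomogeneousCStarAlgebra n (generatedCStar x)

/-- The `n`-spectrum `{(π(x_1), …, π(x_k))}`, where `π` runs through the nonzero representations
`C*(x_1, …, x_k) → M_n`. It carries the subspace topology, its Borel sets and the action
`u . (A_1, …, A_k) = (u . A_1, …, u . A_k)`. -/
def nSpectrum (n : ℕ) (x : Fin k → A) : Set (Fin k → Matrix (Fin n) (Fin n) ℂ) :=
  {a | ∃ π : generatedCStar x →⋆ₙₐ[ℂ] Matrix (Fin n) (Fin n) ℂ, π ≠ 0 ∧
    ∀ j, a j = π ⟨x j, mem_generatedCStar x j⟩}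

theorem smul_mem_nSpectrum {n : ℕ} {x : Fin k → A} (u : ProjUnitary n)
    {a : Fin k → Matrix (Fin n) (Fin n) ℂ} (ha : a ∈ nSpectrum n x) : u • a ∈ nSpectrum n x := by
  obtain ⟨U, rfl⟩ := mk_surjective n u
  obtain ⟨π, hπ, h⟩ := ha
  have hU : ∀ B, Unitary.conjStarAlgAut ℂ (Matrix (Fin n) (Fin n) ℂ) U B = conjMatrix U B := by
    intro B
    simp [conjMatrix, Unitary.conjStarAlgAut_apply]
  let φ : Matrix (Fin n) (Fin n) ℂ →⋆ₙₐ[ℂ] Matrix (Fin n) (Fin n) ℂ :=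
    (Unitary.conjStarAlgAut ℂ (Matrix (Fin n) (Fin n) ℂ) U :
      Matrix (Fin n) (Fin n) ℂ →⋆ₙₐ[ℂ] Matrix (Fin n) (Fin n) ℂ)
  have hφ : ∀ B, φ B = conjMatrix U B := hU
  refine ⟨φ.comp π, ?_, fun j => ?_⟩
  · intro h0
    apply hπ
    ext1 b
    have h1 : φ (π b) = φ 0 := by
      rw [map_zero]
      exact DFunLike.congr_fun h0 b
    exact (Unitary.conjStarAlgAut ℂ (Matrix (Fin n) (Fin n) ℂ) U).injective h1
  · rw [Pi.smul_apply, mk_smul, h j]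
    exact (hφ _).symm

instance (n : ℕ) (x : Fin k → A) : MulAction (ProjUnitary n) (nSpectrum n x) where
  smul u a := ⟨u • a.1, smul_mem_nSpectrum u a.2⟩
  one_smul a := Subtype.ext (one_smul _ a.1)
  mul_smul u v a := Subtype.ext (mul_smul u v a.1)

instance (n : ℕ) (x : Fin k → A) : MeasurableSpace (nSpectrum n x) := borel _

instance (n : ℕ) (x : Fin k → A) : BorelSpace (nSpectrum n x) := ⟨rfl⟩

/-- The coordinate projection `p_j (A_1, …, A_k) = A_j` on the `n`-spectrum. -/
def coordProj (n : ℕ) (x : Fin k → A) (j : Fin k) :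
    nSpectrum n x → Matrix (Fin n) (Fin n) ℂ := fun a => a.1 j

end HomogeneousSystem

end

open HomogeneousSystem

noncomputable section

namespace HomogeneousSystem

universe u

open Filter Topology

/-! ### Bounded measurable functions -/

section BoundedMeasurable

variable {X : Type*} [MeasurableSpace X]

/-! Let A be the C*-algebra generated by T, and R the space of all *-homomorphisms A → M_n, zero
included, with pointwise convergence. R is compact Hausdorff, and evaluation at the generators
identifies σ_n(T) with R minus the zero representation. Functions on the spectrum that extend
continuously to R with value 0 there play the role of C_0-functions.

The core is a noncommutative Gelfand theorem (`RepSpace.exists_transform_eq`): a ↦ (π ↦ π(a)) maps A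
isometrically onto the continuous equivariant functions R → M_n vanishing at 0. Injectivity holds
because irreducible representations separate points (Krein–Milman and GNS,
`exists_isIrreducibleRep_ne_zero`) and homogeneity makes them n-dimensional. Surjectivity is of
Stone–Weierstrass type: homogeneity forces every nonzero point of R to map onto M_n
(`surjective_of_ne_zero`), so two such points lie on one unitary orbit or are separated by A
(`exists_separating_or_equivalent`). Functional calculus and compactness turn this into Urysohn
functions and invariant partitions of unity.

Averaging over the compact group U_n then gives a contractive conditional expectation Φ from the
M_n-valued continuous functions vanishing at 0 onto A (`RepSpace.exists_expectation_properties`).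
The measure E is characterised by ∫ F dE = Φ(F). Existence is the Riesz theorem applied to the
functionals g ↦ ⟨Φ(g e_{lj})h, w⟩, and equivariance of E is the translation invariance of Φ
(`nSpectrum.exists_operatorNMeasure`).

Identities pass from continuous to bounded Borel functions by a monotone class argument
(`IsBoundedlyClosed.of_continuous`). The adjoint rule comes from Φ(F*) = Φ(F)*. For products, Φ(F·a)
= Φ(F)a gives ∫ f·a dE = (∫ f dE)a for every bounded Borel f and a in A. If f is equivariant, F ↦ ∫
fF dE is translation invariant and cannot distinguish F from its average Φ(F), so ∫ fF dE = (∫ f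
dE)Φ(F). Passing from F to a bounded Borel g gives multiplicativity.

For uniqueness, a spectral E with ∫ p_j dE = T_j satisfies ∫ π(a) dE = a on all of A by density,
hence ∫ F dE = Φ(F) by the same averaging argument, and these values determine E. -/

/-- Bounded measurable complex functions. -/
def IsBoundedMeasurable (f : X → ℂ) : Prop := Measurable f ∧ ∃ C : ℝ, ∀ x, ‖f x‖ ≤ C

theorem IsBoundedMeasurable.add {f g : X → ℂ} (hf : IsBoundedMeasurable f)
    (hg : IsBoundedMeasurable g) : IsBoundedMeasurable (f + g) := by
  obtain ⟨hf, C, hC⟩ := hf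
  obtain ⟨hg, D, hD⟩ := hg
  exact ⟨hf.add hg, C + D, fun x => (norm_add_le _ _).trans (add_le_add (hC x) (hD x))⟩

theorem IsBoundedMeasurable.mul {f g : X → ℂ} (hf : IsBoundedMeasurable f)
    (hg : IsBoundedMeasurable g) : IsBoundedMeasurable (f * g) := by
  obtain ⟨hf, C, hC⟩ := hf
  obtain ⟨hg, D, hD⟩ := hg
  refine ⟨hf.mul hg, C * D, fun x => ?_⟩
  rw [Pi.mul_apply, norm_mul]
  exact mul_le_mul (hC x) (hD x) (norm_nonneg _) ((norm_nonneg _).trans (hC x))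

theorem isBoundedMeasurable_const (c : ℂ) : IsBoundedMeasurable (fun _ : X => c) :=
  ⟨measurable_const, ‖c‖, fun _ => le_rfl⟩

theorem IsBoundedMeasurable.const_smul {f : X → ℂ} (hf : IsBoundedMeasurable f) (c : ℂ) :
    IsBoundedMeasurable (c • f) :=
  (isBoundedMeasurable_const c).mul hf

theorem isBoundedMeasurable_zero : IsBoundedMeasurable (0 : X → ℂ) :=
  isBoundedMeasurable_const 0

theorem isBoundedMeasurable_sum {ι : Type*} (s : Finset ι) {f : ι → X → ℂ}
    (hf : ∀ i ∈ s, IsBoundedMeasurable (f i)) : IsBoundedMeasurable (∑ i ∈ s, f i) :=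
  Finset.sum_induction f IsBoundedMeasurable (fun _ _ => .add) isBoundedMeasurable_zero hf

theorem isBoundedMeasurable_indicator {A : Set X} (hA : MeasurableSet A) :
    IsBoundedMeasurable (A.indicator (1 : X → ℂ)) :=
  ⟨measurable_one.indicator hA, 1, fun x => by
    by_cases h : x ∈ A <;> simp [h]⟩

theorem IsBoundedMeasurable.comp {Y : Type*} [MeasurableSpace Y] {f : X → ℂ}
    (hf : IsBoundedMeasurable f) {g : Y → X} (hg : Measurable g) :
    IsBoundedMeasurable (f ∘ g) :=
  ⟨hf.1.comp hg, hf.2.imp fun _ h y => h (g y)⟩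

theorem IsBoundedMeasurable.star {f : X → ℂ} (hf : IsBoundedMeasurable f) :
    IsBoundedMeasurable (fun x => star (f x)) :=
  ⟨continuous_star.measurable.comp hf.1, hf.2.imp fun _ h x => by simpa using h x⟩

/-- A class of complex functions that is stable under linear combinations and under limits of
uniformly bounded, pointwise convergent sequences of measurable functions. -/
structure IsBoundedlyClosed (P : (X → ℂ) → Prop) : Prop where
  add : ∀ f g, IsBoundedMeasurable f → IsBoundedMeasurable g → P f → P g → P (f + g)
  smul : ∀ (c : ℂ) f, IsBoundedMeasurable f → P f → P (c • f)
  lim : ∀ (F : ℕ → X → ℂ) (f : X → ℂ) (C : ℝ), (∀ m, Measurable (F m)) →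
    (∀ m x, ‖F m x‖ ≤ C) → (∀ m, P (F m)) →
    (∀ x, Tendsto (fun m => F m x) atTop (𝓝 (f x))) → P f

variable {P : (X → ℂ) → Prop}

/-- Simple functions are linear combinations of indicators, and a bounded measurable function is a
pointwise limit of uniformly bounded simple functions. -/
theorem IsBoundedlyClosed.of_indicator (hP : IsBoundedlyClosed P)
    (h : ∀ A, MeasurableSet A → P (A.indicator 1)) {f : X → ℂ} (hf : IsBoundedMeasurable f) :
    P f := by
  have hs : ∀ s : SimpleFunc X ℂ, P s := by
    intro s
    induction s using SimpleFunc.induction with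
    | const c hA =>
      rename_i A
      have : ⇑(SimpleFunc.piecewise A hA (SimpleFunc.const X c) (SimpleFunc.const X 0))
          = c • A.indicator (1 : X → ℂ) := by
        ext x
        by_cases hx : x ∈ A <;> simp [hx]
      rw [this]
      exact hP.smul _ _ (isBoundedMeasurable_indicator hA) (h A hA)
    | add hd hf hg =>
      rename_i f g
      have hb : ∀ f : SimpleFunc X ℂ, IsBoundedMeasurable f :=
        fun f => ⟨f.measurable, f.exists_forall_norm_le⟩
      exact hP.add _ _ (hb f) (hb g) hf hg
  obtain ⟨hf, C, hC⟩ := hf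
  -- The bound `C` may be negative when `X` is empty, while the approximation below needs `0 ≤ C`.
  rcases isEmpty_or_nonempty X with hX | ⟨⟨x₀⟩⟩
  · have : f = (0 : SimpleFunc X ℂ) := funext fun x => hX.elim x
    exact this ▸ hs _
  have hC0 : 0 ≤ C := (norm_nonneg _).trans (hC x₀)
  exact hP.lim (fun m => hf.stronglyMeasurable.approxBounded C m) f C
    (fun m => (hf.stronglyMeasurable.approxBounded C m).measurable)
    (fun m x => hf.stronglyMeasurable.norm_approxBounded_le hC0 m x) (fun m => hs _)
    (fun x => hf.stronglyMeasurable.tendsto_approxBounded_of_norm_le (hC x))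

/-- A π-λ argument: closed sets are a π-system generating the Borel sets, complements come from
subtraction from 1, and disjoint unions are bounded limits of finite partial unions. -/
theorem IsBoundedlyClosed.indicator_of_isClosed [TopologicalSpace X] [BorelSpace X]
    (hP : IsBoundedlyClosed P) (h : ∀ A : Set X, IsClosed A → P (A.indicator 1))
    {A : Set X} (hA : MeasurableSet A) : P (A.indicator 1) := by
  have huniv : P 1 := by simpa using h Set.univ isClosed_univ
  have hone : IsBoundedMeasurable (1 : X → ℂ) := isBoundedMeasurable_const 1
  have hsub : ∀ f g, IsBoundedMeasurable f → IsBoundedMeasurable g → P f → P g → P (f - g) := by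
    intro f g hf hg pf pg
    rw [sub_eq_add_neg, ← neg_one_smul ℂ g]
    exact hP.add _ _ hf (hg.const_smul _) pf (hP.smul _ _ hg pg)
  refine MeasurableSpace.induction_on_inter (C := fun A _ => P (A.indicator 1))
    (borel_eq_generateFrom_isClosed (α := X) ▸ BorelSpace.measurable_eq) isPiSystem_isClosed
    ?_ (fun A hA => h A hA) ?_ ?_ A hA
  · simpa using h ∅ isClosed_empty
  · intro A hA pA
    rw [Set.indicator_compl]
    exact hsub _ _ hone (isBoundedMeasurable_indicator hA) huniv pA
  · intro F hd hF pF
    have hun : ∀ m, P ((⋃ i ∈ Finset.range m, F i).indicator (1 : X → ℂ)) := by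
      intro m
      induction m with
      | zero => simpa using h ∅ isClosed_empty
      | succ m ih =>
        have : (⋃ i ∈ Finset.range (m + 1), F i).indicator (1 : X → ℂ)
            = (⋃ i ∈ Finset.range m, F i).indicator 1 + (F m).indicator 1 := by
          rw [Finset.range_add_one, Finset.set_biUnion_insert, Set.union_comm]
          refine Set.indicator_union_of_disjoint ?_ _
          simp only [Set.disjoint_iUnion_left, Finset.mem_range]
          exact fun i hi => hd hi.ne
        rw [this]
        exact hP.add _ _ (isBoundedMeasurable_indicator
          (Finset.measurableSet_biUnion _ fun i _ => hF i))
          (isBoundedMeasurable_indicator (hF m)) ih (pF m)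
    refine hP.lim (fun m => (⋃ i ∈ Finset.range m, F i).indicator 1) _ 1 (fun m => ?_) ?_ hun ?_
    · exact (isBoundedMeasurable_indicator (Finset.measurableSet_biUnion _ fun i _ => hF i)).1
    · intro m x
      by_cases hx : x ∈ ⋃ i ∈ Finset.range m, F i
      · rw [Set.indicator_of_mem hx]; simp
      · rw [Set.indicator_of_notMem hx]; simp
    · intro x
      refine tendsto_const_nhds.congr' ?_
      by_cases hx : x ∈ ⋃ i, F i
      · obtain ⟨i, hi⟩ := Set.mem_iUnion.mp hx
        filter_upwards [eventually_gt_atTop i] with m hm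
        rw [Set.indicator_of_mem hx, Set.indicator_of_mem]
        simp only [Set.mem_iUnion, Finset.mem_range]
        exact ⟨i, hm, hi⟩
      · refine Eventually.of_forall fun m => ?_
        beta_reduce
        rw [Set.indicator_of_notMem hx, Set.indicator_of_notMem]
        simp only [Set.mem_iUnion, Finset.mem_range] at hx ⊢
        exact fun ⟨i, _, hi⟩ => hx ⟨i, hi⟩

/-- A boundedly closed class of functions on a subspace `X` of a metric space `E` with a point
`z ∉ X` contains all bounded Borel functions if it contains the restrictions of the continuous
functions on `E` that vanish at `z`. -/
theorem IsBoundedlyClosed.of_continuous [TopologicalSpace X] [BorelSpace X] {E : Type*}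
    [MetricSpace E] {i : X → E} (hi : IsInducing i) {z : E} (hz : ∀ x, i x ≠ z)
    (hP : IsBoundedlyClosed P) (h : ∀ g : C(E, ℂ), g z = 0 → P (g ∘ i)) {f : X → ℂ}
    (hf : IsBoundedMeasurable f) : P f := by
  refine hP.of_indicator (fun A hA => hP.indicator_of_isClosed (fun A hA => ?_) hA) hf
  obtain ⟨K, hK, rfl⟩ := hi.isClosed_iff.mp hA
  have hδ : ∀ m : ℕ, (0 : ℝ) < 1 / ((m : ℝ) + 1) := fun m => Nat.one_div_pos_of_nat
  -- The first factor decreases to the indicator of `K`. The second makes the function vanish at `z`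
  -- and tends to 1 at every other point, in particular on the image of `i`.
  let g : ℕ → C(E, ℂ) := fun m =>
    { toFun := fun y => ((thickenedIndicator (hδ m) K y : NNReal) : ℂ) *
        ((min 1 (m * dist y z) : ℝ) : ℂ)
      continuous_toFun := by
        refine Continuous.mul ?_ ?_
        · exact Complex.continuous_ofReal.comp
            (NNReal.continuous_coe.comp (thickenedIndicator (hδ m) K).continuous)
        · fun_prop }
  have hmin : ∀ (m : ℕ) y, 0 ≤ min 1 (m * dist y z) := fun m y => by positivity
  refine hP.lim (fun m => g m ∘ i) _ 1 (fun m => ?_) (fun m x => ?_) (fun m => h _ ?_)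
    (fun x => ?_)
  · exact ((g m).continuous.comp hi.continuous).measurable
  · have h1 : ((thickenedIndicator (hδ m) K (i x) : NNReal) : ℝ) ≤ 1 :=
      thickenedIndicator_le_one (hδ m) K (i x)
    have h2 : min 1 (m * dist (i x) z) ≤ 1 := min_le_left _ _
    simp only [g, Function.comp_apply, ContinuousMap.coe_mk]
    rw [norm_mul, Complex.norm_real (min 1 _), Real.norm_of_nonneg (hmin m _)]
    have h3 : ‖(((thickenedIndicator (hδ m) K (i x) : NNReal) : ℝ) : ℂ)‖ ≤ 1 := by
      rw [Complex.norm_real, Real.norm_of_nonneg (NNReal.coe_nonneg _)]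
      exact h1
    exact mul_le_one₀ h3 (hmin m _) h2
  · simp [g]
  · have h1 := tendsto_pi_nhds.mp (thickenedIndicator_tendsto_indicator_closure hδ
      tendsto_one_div_add_atTop_nhds_zero_nat K) (i x)
    rw [hK.closure_eq] at h1
    have h2 : Tendsto (fun m : ℕ => min 1 (m * dist (i x) z)) atTop (𝓝 (1 : ℝ)) := by
      refine tendsto_const_nhds.congr' ?_
      have h3 : Tendsto (fun m : ℕ => (m : ℝ) * dist (i x) z) atTop atTop :=
        tendsto_natCast_atTop_atTop.atTop_mul_const (dist_pos.mpr (hz x))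
      filter_upwards [h3.eventually_ge_atTop 1] with m hm
      rw [min_eq_left hm]
    have h3 := ((Complex.continuous_ofReal.comp NNReal.continuous_coe).tendsto _).comp h1
    have h4 := (Complex.continuous_ofReal.tendsto _).comp h2
    have h5 := h3.mul h4
    refine (h5.congr fun m => rfl).trans (le_of_eq ?_)
    congr 1
    by_cases hx : i x ∈ K
    · have : x ∈ i ⁻¹' K := hx
      simp [hx]
    · have : x ∉ i ⁻¹' K := hx
      simp [hx]

end BoundedMeasurable

/-! ### Integrals with respect to complex measures -/

section ComplexIntegral

variable {X : Type*} [MeasurableSpace X]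

theorem IsBoundedMeasurable.integrable {f : X → ℂ} (hf : IsBoundedMeasurable f)
    (μ : ComplexMeasure X) : μ.Integrable f :=
  integrable_of_bounded μ hf.1 hf.2.choose_spec

theorem complexIntegral_add (μ : ComplexMeasure X) {f g : X → ℂ} (hf : IsBoundedMeasurable f)
    (hg : IsBoundedMeasurable g) :
    complexIntegral μ (f + g) = complexIntegral μ f + complexIntegral μ g :=
  VectorMeasure.integral_add (hf.integrable μ) (hg.integrable μ)

theorem complexIntegral_tendsto (μ : ComplexMeasure X) {F : ℕ → X → ℂ} {f : X → ℂ} {C : ℝ}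
    (hF : ∀ m, Measurable (F m)) (hC : ∀ m x, ‖F m x‖ ≤ C)
    (h : ∀ x, Tendsto (fun m => F m x) atTop (𝓝 (f x))) :
    Tendsto (fun m => complexIntegral μ (F m)) atTop (𝓝 (complexIntegral μ f)) := by
  have := isFiniteMeasure_variation μ
  exact VectorMeasure.tendsto_integral_of_dominated_convergence (fun _ => C)
    (fun m => (hF m).aestronglyMeasurable) (integrable_const C)
    (fun m => Eventually.of_forall (hC m)) (Eventually.of_forall h)

/-- The pairing in the integral is only real bilinear, so complex homogeneity is checked on
indicators. The class is quantified over all scalars so that it is itself stable under scaling. -/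
theorem complexIntegral_smul (μ : ComplexMeasure X) (c : ℂ) {f : X → ℂ}
    (hf : IsBoundedMeasurable f) : complexIntegral μ (c • f) = c * complexIntegral μ f := by
  have hP : IsBoundedlyClosed fun f : X → ℂ =>
      ∀ c : ℂ, complexIntegral μ (c • f) = c * complexIntegral μ f := by
    refine ⟨fun f g hf hg pf pg c => ?_, fun d f hf pf c => ?_, fun F f C hF hC pF hl c => ?_⟩
    · rw [smul_add, complexIntegral_add μ (hf.const_smul c) (hg.const_smul c), pf, pg,
        complexIntegral_add μ hf hg, mul_add]
    · rw [smul_smul, pf, pf, mul_assoc]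
    · refine tendsto_nhds_unique (complexIntegral_tendsto μ (C := ‖c‖ * C)
        (fun m => (hF m).const_smul c) (fun m x => ?_) (fun x => (hl x).const_smul c)) ?_
      · rw [Pi.smul_apply, norm_smul]
        gcongr
        exact hC m x
      · exact ((complexIntegral_tendsto μ hF hC hl).const_mul c).congr fun m => (pF m c).symm
  refine hP.of_indicator (fun A hA c => ?_) hf c
  have h1 : c • A.indicator (1 : X → ℂ) = A.indicator fun _ => c := by
    ext x
    by_cases hx : x ∈ A <;> simp [hx]
  have h2 : A.indicator (1 : X → ℂ) = A.indicator fun _ => 1 := rfl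
  rw [h1, h2, complexIntegral_indicator μ hA, complexIntegral_indicator μ hA, one_mul]

theorem norm_complexIntegral_le (μ : ComplexMeasure X) {f : X → ℂ} {C : ℝ}
    (hC : ∀ x, ‖f x‖ ≤ C) :
    ‖complexIntegral μ f‖ ≤ C * (‖ContinuousLinearMap.mul ℝ ℂ‖ * μ.variation.real Set.univ) := by
  have := isFiniteMeasure_variation μ
  rw [← mul_assoc]
  exact VectorMeasure.norm_integral_le_of_norm_le_const (Eventually.of_forall hC)

end ComplexIntegral

/-! ### Boundedly continuous functionals -/

section BoundedlyContinuous

variable {X : Type*} [MeasurableSpace X]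

/-- A linear functional on the bounded measurable functions that is continuous along uniformly
bounded, pointwise convergent sequences. -/
structure IsBoundedlyContinuous (L : (X → ℂ) → ℂ) : Prop where
  add : ∀ f g, IsBoundedMeasurable f → IsBoundedMeasurable g → L (f + g) = L f + L g
  smul : ∀ (c : ℂ) f, IsBoundedMeasurable f → L (c • f) = c * L f
  lim : ∀ (F : ℕ → X → ℂ) (f : X → ℂ) (C : ℝ), (∀ m, Measurable (F m)) →
    (∀ m x, ‖F m x‖ ≤ C) → (∀ x, Tendsto (fun m => F m x) atTop (𝓝 (f x))) →
    Tendsto (fun m => L (F m)) atTop (𝓝 (L f))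

theorem isBoundedlyContinuous_complexIntegral (μ : ComplexMeasure X) :
    IsBoundedlyContinuous (complexIntegral μ) :=
  ⟨fun _ _ => complexIntegral_add μ, fun c _ => complexIntegral_smul μ c,
    fun _ _ _ hF hC hl => complexIntegral_tendsto μ hF hC hl⟩

namespace IsBoundedlyContinuous

variable {L L' : (X → ℂ) → ℂ}

protected theorem zero : IsBoundedlyContinuous fun _ : X → ℂ => 0 :=
  ⟨fun _ _ _ _ => (add_zero 0).symm, fun _ _ _ => (mul_zero _).symm,
    fun _ _ _ _ _ _ => tendsto_const_nhds⟩

protected theorem sum {ι : Type*} (s : Finset ι) {L : ι → (X → ℂ) → ℂ}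
    (h : ∀ i ∈ s, IsBoundedlyContinuous (L i)) :
    IsBoundedlyContinuous fun f => ∑ i ∈ s, L i f := by
  refine ⟨fun f g hf hg => ?_, fun c f hf => ?_, fun F f C hF hC hl => ?_⟩
  · rw [← Finset.sum_add_distrib]
    exact Finset.sum_congr rfl fun i hi => (h i hi).add f g hf hg
  · rw [Finset.mul_sum]
    exact Finset.sum_congr rfl fun i hi => (h i hi).smul c f hf
  · exact tendsto_finsetSum s fun i hi => (h i hi).lim F f C hF hC hl

theorem map_sum {ι : Type*} (h : IsBoundedlyContinuous L) (s : Finset ι) {f : ι → X → ℂ}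
    (hf : ∀ i ∈ s, IsBoundedMeasurable (f i)) : L (∑ i ∈ s, f i) = ∑ i ∈ s, L (f i) := by
  classical
  induction s using Finset.induction_on with
  | empty =>
    rw [Finset.sum_empty, Finset.sum_empty]
    simpa using h.smul 0 0 isBoundedMeasurable_zero
  | insert i s hi ih =>
    have h1 := fun j hj => hf j (Finset.mem_insert_of_mem hj)
    rw [Finset.sum_insert hi, Finset.sum_insert hi, h.add _ _ (hf i (Finset.mem_insert_self i s))
      (isBoundedMeasurable_sum s h1), ih h1]

theorem const_mul (h : IsBoundedlyContinuous L) (c : ℂ) :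
    IsBoundedlyContinuous fun f => c * L f :=
  ⟨fun f g hf hg => by rw [h.add f g hf hg, mul_add],
    fun d f hf => by rw [h.smul d f hf, mul_left_comm],
    fun F f C hF hC hl => (h.lim F f C hF hC hl).const_mul c⟩

theorem comp_mul (h : IsBoundedlyContinuous L) {g : X → ℂ} (hg : IsBoundedMeasurable g) :
    IsBoundedlyContinuous fun f => L (f * g) := by
  refine ⟨fun f f' hf hf' => ?_, fun c f hf => ?_, fun F f C hF hC hl => ?_⟩
  · rw [add_mul, h.add _ _ (hf.mul hg) (hf'.mul hg)]
  · rw [smul_mul_assoc, h.smul _ _ (hf.mul hg)]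
  · obtain ⟨hg, D, hD⟩ := hg
    refine h.lim _ _ (C * D) (fun m => (hF m).mul hg) (fun m x => ?_)
      fun x => (hl x).mul_const _
    rw [Pi.mul_apply, norm_mul]
    exact mul_le_mul (hC m x) (hD x) (norm_nonneg _) ((norm_nonneg _).trans (hC m x))

theorem comp_measurable (h : IsBoundedlyContinuous L) {φ : X → X} (hφ : Measurable φ) :
    IsBoundedlyContinuous fun f => L (f ∘ φ) :=
  ⟨fun _ _ hf hg => h.add _ _ (hf.comp hφ) (hg.comp hφ),
    fun c _ hf => h.smul c _ (hf.comp hφ),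
    fun _ _ C hF hC hl => h.lim _ _ C (fun m => (hF m).comp hφ) (fun m _ => hC m _)
      fun _ => hl _⟩

protected theorem star (h : IsBoundedlyContinuous L) :
    IsBoundedlyContinuous fun f => star (L fun x => star (f x)) := by
  refine ⟨fun f g hf hg => ?_, fun c f hf => ?_, fun F f C hF hC hl => ?_⟩
  · rw [← star_add, ← h.add _ _ hf.star hg.star]
    congr 2
    ext x
    simp
  · have : (fun x => star ((c • f) x)) = star c • fun x => star (f x) := by
      ext x
      simp
    rw [this, h.smul _ _ hf.star, star_mul', star_star]
  · exact (h.lim _ _ C (fun m => continuous_star.measurable.comp (hF m))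
      (fun m x => by simpa using hC m x) fun x => (hl x).star).star

theorem isBoundedlyClosed (h : IsBoundedlyContinuous L) (h' : IsBoundedlyContinuous L') :
    IsBoundedlyClosed fun f => L f = L' f :=
  ⟨fun f g hf hg pf pg => by rw [h.add f g hf hg, h'.add f g hf hg, pf, pg],
    fun c f hf pf => by rw [h.smul c f hf, h'.smul c f hf, pf],
    fun F f C hF hC pF hl => tendsto_nhds_unique (h.lim F f C hF hC hl)
      ((h'.lim F f C hF hC hl).congr fun m => (pF m).symm)⟩

/-- Two boundedly continuous functionals on matrix valued functions are equal if they agree on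
the continuous functions. -/
theorem matrix_ext [TopologicalSpace X] [BorelSpace X] {n : ℕ} {E : Type*} [MetricSpace E]
    {i : X → E} (hi : IsInducing i) {z : E} (hz : ∀ x, i x ≠ z)
    {L L' : Fin n → Fin n → (X → ℂ) → ℂ} (hL : ∀ j k, IsBoundedlyContinuous (L j k))
    (hL' : ∀ j k, IsBoundedlyContinuous (L' j k))
    (h : ∀ F : C(E, Matrix (Fin n) (Fin n) ℂ), F z = 0 →
      ∑ j, ∑ k, L j k (fun x => F (i x) j k) = ∑ j, ∑ k, L' j k (fun x => F (i x) j k))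
    (j k : Fin n) {f : X → ℂ} (hf : IsBoundedMeasurable f) : L j k f = L' j k f := by
  refine ((hL j k).isBoundedlyClosed (hL' j k)).of_continuous hi hz (fun g hg => ?_) hf
  have hzero : ∀ {L : (X → ℂ) → ℂ}, IsBoundedlyContinuous L → L (fun _ => 0) = 0 := by
    intro L hL
    have := hL.smul 0 (fun _ => 0) isBoundedMeasurable_zero
    rw [zero_mul] at this
    rwa [zero_smul] at this
  have key : ∀ {L : Fin n → Fin n → (X → ℂ) → ℂ}, (∀ j k, IsBoundedlyContinuous (L j k)) →
      ∑ a, ∑ b, L a b (fun x => Matrix.single j k (g (i x)) a b) = L j k (g ∘ i) := by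
    intro L hL
    rw [Finset.sum_eq_single j, Finset.sum_eq_single k]
    · congr 1
      ext x
      simp
    · intro b _ hb
      simp only [Matrix.single_apply, hb.symm, and_false, if_false]
      exact hzero (hL _ _)
    · simp
    · intro a _ ha
      refine Finset.sum_eq_zero fun b _ => ?_
      simp only [Matrix.single_apply, ha.symm, false_and, if_false]
      exact hzero (hL _ _)
    · simp
  -- The test function `g` times a matrix unit isolates the functional with indices `j`, `k` in the
  -- double sum.
  have := h ⟨fun y => Matrix.single j k (g y), ?_⟩ ?_
  · exact (key hL).symm.trans (this.trans (key hL'))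
  · refine continuous_matrix fun a b => ?_
    by_cases hab : j = a ∧ k = b
    · simpa [Matrix.single_apply, hab] using g.continuous
    · simpa [Matrix.single_apply, hab] using continuous_const
  · simp [hg]

end IsBoundedlyContinuous

end BoundedlyContinuous

/-! ### Integrals with respect to operator measures -/

section OperatorMeasure

variable {X : Type*} [MeasurableSpace X] {H : Type*} [NormedAddCommGroup H]
  [InnerProductSpace ℂ H]

theorem OperatorMeasure.inner_integral [CompleteSpace H] (E : OperatorMeasure X H) {f : X → ℂ}
    (hf : IsBoundedMeasurable f) (h w : H) :
    ⟪w, E.integral f h⟫_ℂ = complexIntegral (E.scalar h w) f :=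
  E.hasIntegral_integral hf.1 hf.2.choose_spec h w

theorem OperatorMeasure.integral_eq_of_hasIntegral [CompleteSpace H] (E : OperatorMeasure X H)
    {f : X → ℂ} (hf : IsBoundedMeasurable f) {T : H →L[ℂ] H} (hT : E.HasIntegral f T) :
    E.integral f = T := by
  ext h
  refine ext_inner_left ℂ fun w => ?_
  rw [E.inner_integral hf, hT]

theorem OperatorMeasure.integral_indicator [CompleteSpace H] (E : OperatorMeasure X H)
    {A : Set X} (hA : MeasurableSet A) : E.integral (A.indicator 1) = E.toFun A := by
  refine E.integral_eq_of_hasIntegral (isBoundedMeasurable_indicator hA) fun h w => ?_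
  have := complexIntegral_indicator (E.scalar h w) hA 1
  rw [one_mul] at this
  exact this.symm

theorem OperatorMeasure.integral_add [CompleteSpace H] (E : OperatorMeasure X H) {f g : X → ℂ}
    (hf : IsBoundedMeasurable f) (hg : IsBoundedMeasurable g) :
    E.integral (f + g) = E.integral f + E.integral g := by
  refine E.integral_eq_of_hasIntegral (hf.add hg) fun h w => ?_
  rw [complexIntegral_add _ hf hg, ← E.inner_integral hf, ← E.inner_integral hg,
    add_apply, inner_add_right]

theorem OperatorMeasure.integral_smul [CompleteSpace H] (E : OperatorMeasure X H) (c : ℂ)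
    {f : X → ℂ} (hf : IsBoundedMeasurable f) : E.integral (c • f) = c • E.integral f := by
  refine E.integral_eq_of_hasIntegral (hf.const_smul c) fun h w => ?_
  rw [complexIntegral_smul _ c hf, ← E.inner_integral hf, smul_apply,
    inner_smul_right]

theorem OperatorMeasure.ext_of_integral [CompleteSpace H] {E E' : OperatorMeasure X H}
    (h : ∀ f, IsBoundedMeasurable f → E.integral f = E'.integral f) : E = E' := by
  ext A : 2
  by_cases hA : MeasurableSet A
  · rw [← E.integral_indicator hA, ← E'.integral_indicator hA,
      h _ (isBoundedMeasurable_indicator hA)]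
  · rw [E.not_measurable A hA, E'.not_measurable A hA]

/-- A family of complex measures is given by an operator measure if integration of each bounded
measurable function gives a bounded sesquilinear form. -/
theorem exists_operatorMeasure [CompleteSpace H] (μ : H → H → ComplexMeasure X)
    (hμ : ∀ A, MeasurableSet A → ∃ T : H →L[ℂ] H, ∀ h w, ⟪w, T h⟫_ℂ = μ h w A) :
    ∃ E : OperatorMeasure X H, ∀ h w, E.scalar h w = μ h w := by
  classical
  choose T hT using hμ
  have key : ∀ (A : Set X) (h w : H),
      ⟪w, (if hA : MeasurableSet A then T A hA else 0) h⟫_ℂ = μ h w A := by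
    intro A h w
    by_cases hA : MeasurableSet A
    · rw [dif_pos hA, hT]
    · rw [dif_neg hA, (μ h w).not_measurable hA]
      simp
  refine ⟨⟨fun A => if hA : MeasurableSet A then T A hA else 0, ?_, fun A hA => dif_neg hA, ?_⟩,
    fun h w => ?_⟩
  · ext h
    refine ext_inner_left ℂ fun w => ?_
    rw [key]
    simp
  · intro h w A hA hd
    simp only [key]
    exact (μ h w).m_iUnion hA hd
  · ext A hA
    exact key A h w

/-- Stability under limits is the uniform boundedness principle, through `exists_weak_limit`. Thus
operators representing the integrals of continuous functions yield operators for all bounded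
measurable ones. -/
theorem isBoundedlyClosed_exists_hasIntegral [CompleteSpace H] (μ : H → H → ComplexMeasure X) :
    IsBoundedlyClosed fun f =>
      ∃ T : H →L[ℂ] H, ∀ h w, ⟪w, T h⟫_ℂ = complexIntegral (μ h w) f := by
  refine ⟨?_, ?_, ?_⟩
  · rintro f g hf hg ⟨S, hS⟩ ⟨T, hT⟩
    refine ⟨S + T, fun h w => ?_⟩
    rw [complexIntegral_add _ hf hg, ← hS, ← hT, add_apply, inner_add_right]
  · rintro c f hf ⟨T, hT⟩
    refine ⟨c • T, fun h w => ?_⟩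
    rw [complexIntegral_smul _ c hf, ← hT, smul_apply, inner_smul_right]
  · intro F f C hF hC pF hl
    choose T hT using pF
    refine exists_weak_limit T _ fun h w => ?_
    simp only [hT]
    exact complexIntegral_tendsto _ hF hC hl

end OperatorMeasure

/-! ### Integrals with respect to operator-valued `n`-measures -/

section OperatorNMeasure

variable {n : ℕ} {X : Type*} [MeasurableSpace X] {H : Type*} [NormedAddCommGroup H]
  [InnerProductSpace ℂ H] [CompleteSpace H]

/-- Bounded measurable functions with values in the `n × n` matrices. -/
def IsBoundedMeasurableMatrix (f : X → Matrix (Fin n) (Fin n) ℂ) : Prop :=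
  ∀ j k, IsBoundedMeasurable fun x => f x j k

theorem IsBoundedMeasurableMatrix.mul {f g : X → Matrix (Fin n) (Fin n) ℂ}
    (hf : IsBoundedMeasurableMatrix f) (hg : IsBoundedMeasurableMatrix g) :
    IsBoundedMeasurableMatrix fun x => f x * g x := by
  intro j k
  have : (fun x => (f x * g x) j k) = ∑ l, (fun x => f x j l) * (fun x => g x l k) := by
    ext x
    simp [Matrix.mul_apply]
  rw [this]
  exact isBoundedMeasurable_sum _ fun l _ => (hf j l).mul (hg l k)

theorem IsBoundedMeasurableMatrix.conjTranspose {f : X → Matrix (Fin n) (Fin n) ℂ}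
    (hf : IsBoundedMeasurableMatrix f) : IsBoundedMeasurableMatrix fun x => (f x)ᴴ :=
  fun j k => (hf k j).star

variable [MulAction (ProjUnitary n) X]

theorem IsBoundedBorelEquivariant.isBoundedMeasurableMatrix
    {f : X → Matrix (Fin n) (Fin n) ℂ} (hf : IsBoundedBorelEquivariant f) :
    IsBoundedMeasurableMatrix f :=
  fun j k => ⟨hf.measurable j k, hf.bounded.imp fun _ h x => h x j k⟩

theorem OperatorNMeasure.inner_integral (E : OperatorNMeasure n X H)
    {f : X → Matrix (Fin n) (Fin n) ℂ} (hf : IsBoundedMeasurableMatrix f) (h w : H) :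
    ⟪w, E.integral f h⟫_ℂ =
      ∑ j, ∑ k, complexIntegral ((E.entry k j).scalar h w) fun x => f x j k := by
  simp only [OperatorNMeasure.integral, sum_apply, inner_sum]
  exact Finset.sum_congr rfl fun j _ => Finset.sum_congr rfl fun k _ =>
    (E.entry k j).inner_integral (hf j k) h w

theorem OperatorNMeasure.integral_add (E : OperatorNMeasure n X H)
    {f g : X → Matrix (Fin n) (Fin n) ℂ} (hf : IsBoundedMeasurableMatrix f)
    (hg : IsBoundedMeasurableMatrix g) :
    E.integral (fun x => f x + g x) = E.integral f + E.integral g := by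
  simp only [OperatorNMeasure.integral, ← Finset.sum_add_distrib]
  exact Finset.sum_congr rfl fun j _ => Finset.sum_congr rfl fun k _ =>
    (E.entry k j).integral_add (hf j k) (hg j k)

theorem OperatorNMeasure.integral_smul (E : OperatorNMeasure n X H) (c : ℂ)
    {f : X → Matrix (Fin n) (Fin n) ℂ} (hf : IsBoundedMeasurableMatrix f) :
    E.integral (fun x => c • f x) = c • E.integral f := by
  simp only [OperatorNMeasure.integral, Finset.smul_sum]
  exact Finset.sum_congr rfl fun j _ => Finset.sum_congr rfl fun k _ =>
    (E.entry k j).integral_smul c (hf j k)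

end OperatorNMeasure

/-! ### The Riesz representation theorem for bounded functionals -/

section Riesz

variable {Y : Type*} [TopologicalSpace Y]

/-- The Riesz decomposition property of the lattice of continuous functions. It is what makes
`positivePart` additive. -/
theorem continuousMap_Icc_add {f g : C(Y, ℝ)} (hf : 0 ≤ f) (hg : 0 ≤ g) :
    Set.Icc 0 (f + g) = Set.Icc 0 f + Set.Icc 0 g := by
  refine Set.Subset.antisymm ?_ ?_
  · rintro k ⟨h0, h1⟩
    refine Set.mem_add.mpr ⟨k ⊓ f, ⟨le_inf h0 hf, inf_le_right⟩, k - k ⊓ f,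
      ⟨sub_nonneg.mpr inf_le_left, ?_⟩, by abel⟩
    intro x
    have h1 : k x ≤ f x + g x := h1 x
    have hg : 0 ≤ g x := hg x
    change k x - min (k x) (f x) ≤ g x
    rcases min_cases (k x) (f x) with ⟨h, _⟩ | ⟨h, _⟩ <;> rw [h] <;> linarith
  · rintro _ ⟨a, ha, b, hb, rfl⟩
    exact ⟨add_nonneg ha.1 hb.1, add_le_add ha.2 hb.2⟩

/-- The supremum of the values of `L` on `[0, f]`. -/
def positivePart (L : C(Y, ℝ) →L[ℝ] ℝ) (f : C(Y, ℝ)) : ℝ := sSup (L '' Set.Icc 0 f)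

theorem positivePart_smul (L : C(Y, ℝ) →L[ℝ] ℝ) {c : ℝ} (hc : 0 ≤ c) (f : C(Y, ℝ)) :
    positivePart L (c • f) = c * positivePart L f := by
  rcases hc.eq_or_lt with rfl | hc'
  · simp [positivePart]
  have h : L '' Set.Icc 0 (c • f) = c • (L '' Set.Icc 0 f) := by
    rw [← Set.image_smul_comm L c _ fun g => map_smul L c g]
    congr 1
    ext g
    rw [Set.mem_smul_set_iff_inv_smul_mem₀ hc'.ne']
    refine and_congr ?_ ?_
    · rw [le_inv_smul_iff_of_pos hc', smul_zero]
    · rw [inv_smul_le_iff_of_pos hc']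
  rw [positivePart, positivePart, ← smul_eq_mul, ← Real.sSup_smul_of_nonneg hc, h]

variable [CompactSpace Y]

theorem bddAbove_image_Icc (L : C(Y, ℝ) →L[ℝ] ℝ) (f : C(Y, ℝ)) :
    BddAbove (L '' Set.Icc 0 f) := by
  refine ⟨‖L‖ * ‖f‖, ?_⟩
  rintro _ ⟨g, ⟨h0, h1⟩, rfl⟩
  refine (le_abs_self _).trans ((L.le_opNorm g).trans ?_)
  gcongr
  refine (ContinuousMap.norm_le _ (norm_nonneg _)).mpr fun x => ?_
  have h0 : 0 ≤ g x := h0 x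
  have h1 : g x ≤ f x := h1 x
  rw [Real.norm_of_nonneg h0]
  exact h1.trans ((le_abs_self _).trans (f.norm_coe_le_norm x))

theorem positivePart_nonneg (L : C(Y, ℝ) →L[ℝ] ℝ) {f : C(Y, ℝ)} (hf : 0 ≤ f) :
    0 ≤ positivePart L f :=
  le_csSup (bddAbove_image_Icc L f) ⟨0, ⟨le_rfl, hf⟩, map_zero L⟩

theorem le_positivePart (L : C(Y, ℝ) →L[ℝ] ℝ) {f : C(Y, ℝ)} (hf : 0 ≤ f) :
    L f ≤ positivePart L f :=
  le_csSup (bddAbove_image_Icc L f) ⟨f, ⟨hf, le_rfl⟩, rfl⟩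

theorem positivePart_add (L : C(Y, ℝ) →L[ℝ] ℝ) {f g : C(Y, ℝ)} (hf : 0 ≤ f) (hg : 0 ≤ g) :
    positivePart L (f + g) = positivePart L f + positivePart L g := by
  rw [positivePart, continuousMap_Icc_add hf hg, Set.image_add, csSup_add]
  · rfl
  · exact (Set.nonempty_Icc.mpr hf).image _
  · exact bddAbove_image_Icc L f
  · exact (Set.nonempty_Icc.mpr hg).image _
  · exact bddAbove_image_Icc L g

/-- Jordan decomposition: with Λ the positive part of `L`, both Λ and Λ - `L` are positive
functionals, and each is a measure by Riesz–Markov–Kakutani. On a compact space every continuous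
function has compact support. -/
theorem exists_measure_sub_of_continuousLinearMap [T2Space Y] [MeasurableSpace Y] [BorelSpace Y]
    (L : C(Y, ℝ) →L[ℝ] ℝ) : ∃ p q : Measure Y, IsFiniteMeasure p ∧ IsFiniteMeasure q ∧
      ∀ f : C(Y, ℝ), L f = ∫ y, f y ∂p - ∫ y, f y ∂q := by
  let ι : CompactlySupportedContinuousMap Y ℝ → C(Y, ℝ) := fun f => f.toContinuousMap
  let Λ₀ : CompactlySupportedContinuousMap Y NNReal →ₗ[NNReal] NNReal :=
    { toFun := fun f => ⟨positivePart L (ι f.toReal), positivePart_nonneg L fun x => by simp [ι]⟩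
      map_add' := fun f g => NNReal.eq (by
        have : ι (f + g).toReal = ι f.toReal + ι g.toReal := by ext x; simp [ι]
        change positivePart L _ = positivePart L _ + positivePart L _
        rw [this]
        exact positivePart_add L (fun x => by simp [ι]) (fun x => by simp [ι]))
      map_smul' := fun c f => NNReal.eq (by
        have : ι (c • f).toReal = (c : ℝ) • ι f.toReal := by
          ext x
          simp [ι, NNReal.smul_def]
        change positivePart L _ = (c : ℝ) * positivePart L _
        rw [this]
        exact positivePart_smul L c.2 _) }
  -- The supremum formula is additive only on the positive cone; this is its linear extension to all
  -- real functions.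
  let Λ := CompactlySupportedContinuousMap.toRealPositiveLinear Λ₀
  have hΛ : ∀ f : CompactlySupportedContinuousMap Y ℝ, 0 ≤ f → Λ f = positivePart L (ι f) := by
    intro f hf
    have h1 : ι f.nnrealPart.toReal = ι f := by
      ext x
      have : 0 ≤ f x := hf x
      simp [ι, this]
    simp only [Λ, CompactlySupportedContinuousMap.toRealPositiveLinear_apply,
      CompactlySupportedContinuousMap.nnrealPart_neg_eq_zero_of_nonneg hf, map_zero, NNReal.coe_zero,
      sub_zero]
    exact congrArg (positivePart L) h1
  let M₀ : CompactlySupportedContinuousMap Y ℝ →ₗ[ℝ] ℝ :=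
    { toFun := fun f => Λ f - L (ι f)
      map_add' := fun f g => by
        have : ι (f + g) = ι f + ι g := rfl
        rw [this, map_add, map_add]
        ring
      map_smul' := fun c f => by
        have : ι (c • f) = c • ι f := rfl
        rw [this, map_smul, map_smul, RingHom.id_apply, smul_eq_mul, smul_eq_mul, smul_eq_mul]
        ring }
  let M : CompactlySupportedContinuousMap Y ℝ →ₚ[ℝ] ℝ := PositiveLinearMap.mk₀ M₀ (fun f hf => by
    change 0 ≤ Λ f - L (ι f)
    rw [hΛ f hf, sub_nonneg]
    exact le_positivePart L hf)
  refine ⟨RealRMK.rieszMeasure Λ, RealRMK.rieszMeasure M, inferInstance, inferInstance,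
    fun f => ?_⟩
  let f' := CompactlySupportedContinuousMap.continuousMapEquiv f
  have h1 := RealRMK.integral_rieszMeasure Λ f'
  have h2 := RealRMK.integral_rieszMeasure M f'
  change _ = Λ f' - L f at h2
  change ∫ x, f x ∂_ = _ at h1 h2
  rw [h1, h2]
  ring

/-- The complex measure `p - q + i (r - s)`. -/
def complexOfMeasures {X : Type*} [MeasurableSpace X] (p q r s : Measure X) [IsFiniteMeasure p]
    [IsFiniteMeasure q] [IsFiniteMeasure r] [IsFiniteMeasure s] : ComplexMeasure X :=
  (p.toSignedMeasure - q.toSignedMeasure).toComplexMeasure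
    (r.toSignedMeasure - s.toSignedMeasure)

theorem isBoundedlyContinuous_integral {X : Type*} [MeasurableSpace X] (p : Measure X)
    [IsFiniteMeasure p] : IsBoundedlyContinuous fun f => ∫ x, f x ∂p := by
  have hi : ∀ {f : X → ℂ}, IsBoundedMeasurable f → Integrable f p := fun hf =>
    Integrable.of_bound hf.1.aestronglyMeasurable hf.2.choose
      (Eventually.of_forall hf.2.choose_spec)
  refine ⟨fun f g hf hg => integral_add (hi hf) (hi hg), fun c f _ => integral_const_mul c f,
    fun F f C hF hC hl => ?_⟩
  exact tendsto_integral_of_dominated_convergence (fun _ => C)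
    (fun m => (hF m).aestronglyMeasurable) (integrable_const C)
    (fun m => Eventually.of_forall (hC m)) (Eventually.of_forall hl)

/-- Both sides are boundedly continuous in `f` and agree on indicators. -/
theorem complexIntegral_complexOfMeasures {X : Type*} [MeasurableSpace X] (p q r s : Measure X)
    [IsFiniteMeasure p] [IsFiniteMeasure q] [IsFiniteMeasure r] [IsFiniteMeasure s] {f : X → ℂ}
    (hf : IsBoundedMeasurable f) :
    complexIntegral (complexOfMeasures p q r s) f =
      (∫ x, f x ∂p - ∫ x, f x ∂q) + Complex.I * (∫ x, f x ∂r - ∫ x, f x ∂s) := by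
  let m : Fin 4 → Measure X := ![p, q, r, s]
  have hm : ∀ i, IsFiniteMeasure (m i) := by
    intro i
    fin_cases i <;> simpa [m]
  let c : Fin 4 → ℂ := ![1, -1, Complex.I, -Complex.I]
  have h1 : IsBoundedlyContinuous fun f : X → ℂ => ∑ i, c i * ∫ x, f x ∂(m i) :=
    IsBoundedlyContinuous.sum _ fun i _ =>
      have := hm i
      (isBoundedlyContinuous_integral (m i)).const_mul (c i)
  have h2 := ((isBoundedlyContinuous_complexIntegral (complexOfMeasures p q r s)).isBoundedlyClosed
    h1).of_indicator (fun A hA => ?_) hf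
  · rw [h2]
    simp [Fin.sum_univ_four, m, c]
    ring
  · have h3 := complexIntegral_indicator (complexOfMeasures p q r s) hA 1
    rw [one_mul] at h3
    refine h3.trans ?_
    have h4 : ∀ p : Measure X, ∫ x, A.indicator (1 : X → ℂ) x ∂p = ((p.real A : ℝ) : ℂ) := by
      intro p
      refine (integral_indicator_const (1 : ℂ) hA).trans ?_
      simp
    simp only [h4]
    apply Complex.ext <;>
    simp [Fin.sum_univ_four, m, c, complexOfMeasures, SignedMeasure.toComplexMeasure_apply,
      Measure.toSignedMeasure_apply_measurable hA, sub_eq_add_neg]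

/-- A bounded functional on the continuous functions vanishing at a point is given by a complex
measure on the complement of that point. -/
theorem exists_complexMeasure_of_functional [T2Space Y] {X : Type*} [TopologicalSpace X]
    [MeasurableSpace X] [BorelSpace X] {i : X → Y} (hi : IsOpenEmbedding i) {z : Y}
    (hz : Set.range i = {z}ᶜ) (L : C(Y, ℂ) →L[ℂ] ℂ) :
    ∃ μ : ComplexMeasure X, ∀ g : C(Y, ℂ), g z = 0 → complexIntegral μ (g ∘ i) = L g := by
  let _ : MeasurableSpace Y := borel Y
  have : BorelSpace Y := ⟨rfl⟩
  let ι : C(Y, ℝ) →L[ℝ] C(Y, ℂ) := Complex.ofRealCLM.compLeftContinuous ℝ Y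
  obtain ⟨p, q, _, _, hpq⟩ := exists_measure_sub_of_continuousLinearMap
    (Complex.reCLM.comp ((L.restrictScalars ℝ).comp ι))
  obtain ⟨r, s, _, _, hrs⟩ := exists_measure_sub_of_continuousLinearMap
    (Complex.imCLM.comp ((L.restrictScalars ℝ).comp ι))
  have hme : MeasurableEmbedding i := hi.measurableEmbedding
  have hfin : ∀ p : Measure Y, IsFiniteMeasure p → IsFiniteMeasure (p.comap i) := by
    intro p _
    constructor
    rw [hme.comap_apply]
    exact measure_lt_top p _
  have := hfin p inferInstance
  have := hfin q inferInstance
  have := hfin r inferInstance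
  have := hfin s inferInstance
  have hint : ∀ (p : Measure Y) (g : C(Y, ℂ)), g z = 0 →
      ∫ x, (g ∘ i) x ∂(p.comap i) = ∫ y, g y ∂p := by
    intro p g hg
    have h1 := hme.integral_map (μ := p.comap i) g
    rw [hme.map_comap] at h1
    refine h1.symm.trans (setIntegral_eq_integral_of_forall_compl_eq_zero fun y hy => ?_)
    rw [hz, Set.mem_compl_iff, not_not] at hy
    rw [Set.mem_singleton_iff.mp hy, hg]
  have hL : ∀ g : C(Y, ℝ), L (ι g) =
      ((∫ y, g y ∂p - ∫ y, g y ∂q : ℝ) : ℂ) + Complex.I * ((∫ y, g y ∂r - ∫ y, g y ∂s : ℝ) : ℂ) := by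
    intro g
    rw [← hpq, ← hrs, mul_comm]
    exact (Complex.re_add_im _).symm
  refine ⟨complexOfMeasures (p.comap i) (q.comap i) (r.comap i) (s.comap i), fun g hg => ?_⟩
  have hb : IsBoundedMeasurable (g ∘ i) :=
    ⟨(g.continuous.comp hi.continuous).measurable, ‖g‖, fun x => g.norm_coe_le_norm _⟩
  rw [complexIntegral_complexOfMeasures _ _ _ _ hb, hint p g hg, hint q g hg, hint r g hg,
    hint s g hg]
  let g₁ : C(Y, ℝ) := ⟨fun y => (g y).re, Complex.continuous_re.comp g.continuous⟩
  let g₂ : C(Y, ℝ) := ⟨fun y => (g y).im, Complex.continuous_im.comp g.continuous⟩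
  have hg12 : g = ι g₁ + Complex.I • ι g₂ := by
    ext y
    change g y = ((g y).re : ℂ) + Complex.I * ((g y).im : ℂ)
    rw [mul_comm, Complex.re_add_im]
  have hi2 : ∀ (p : Measure Y) [IsFiniteMeasure p], ∫ y, g y ∂p =
      ((∫ y, g₁ y ∂p : ℝ) : ℂ) + Complex.I * ((∫ y, g₂ y ∂p : ℝ) : ℂ) := by
    intro p _
    have hgi : Integrable g p := Integrable.of_bound g.continuous.measurable.aestronglyMeasurable
      ‖g‖ (Eventually.of_forall fun y => g.norm_coe_le_norm y)
    rw [mul_comm]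
    exact (integral_re_add_im hgi).symm
  conv_rhs => rw [hg12, map_add, map_smul, hL, hL]
  rw [hi2 p, hi2 q, hi2 r, hi2 s, smul_eq_mul]
  push_cast
  ring

end Riesz

/-! ### Irreducible representations -/

section Irreducible

variable {A : Type u} [NonUnitalCStarAlgebra A]

/-- The linear functionals that satisfy the inequalities of vector functionals
`a ↦ ⟨v, π(a) v⟩` with `‖v‖ ≤ 1`. -/
structure IsQuasiState (φ : A → ℂ) : Prop where
  add : ∀ a b, φ (a + b) = φ a + φ b
  smul : ∀ (c : ℂ) a, φ (c • a) = c * φ a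
  norm_le : ∀ a, ‖φ a‖ ≤ ‖a‖
  im_eq : ∀ a, (φ (star a * a)).im = 0
  norm_sq_le : ∀ a, ‖φ a‖ ^ 2 ≤ (φ (star a * a)).re

/-- As in Banach–Alaoglu: closed conditions inside a product of discs, compact by Tychonoff.
Bounding the norm by 1, instead of fixing it, keeps the set closed although `A` need not have a
unit. -/
theorem isCompact_setOf_isQuasiState : IsCompact {φ : A → ℂ | IsQuasiState φ} := by
  have h1 : IsCompact (Set.pi Set.univ fun a : A => Metric.closedBall (0 : ℂ) ‖a‖) :=
    isCompact_univ_pi fun a => isCompact_closedBall _ _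
  refine h1.of_isClosed_subset ?_ ?_
  · have : {φ : A → ℂ | IsQuasiState φ} =
        (⋂ (a) (b), {φ | φ (a + b) = φ a + φ b}) ∩ (⋂ (c : ℂ) (a), {φ | φ (c • a) = c * φ a}) ∩
        (⋂ a, {φ | ‖φ a‖ ≤ ‖a‖}) ∩ (⋂ a, {φ | (φ (star a * a)).im = 0}) ∩
        (⋂ a, {φ | ‖φ a‖ ^ 2 ≤ (φ (star a * a)).re}) := by
      ext φ
      simp only [Set.mem_ofPred_eq, Set.mem_inter_iff, Set.mem_iInter]
      exact ⟨fun h => ⟨⟨⟨⟨h.1, h.2⟩, h.3⟩, h.4⟩, h.5⟩,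
        fun ⟨⟨⟨⟨h1, h2⟩, h3⟩, h4⟩, h5⟩ => ⟨h1, h2, h3, h4, h5⟩⟩
    rw [this]
    refine IsClosed.inter (IsClosed.inter (IsClosed.inter (IsClosed.inter ?_ ?_) ?_) ?_) ?_
    · exact isClosed_iInter fun a => isClosed_iInter fun b => isClosed_eq (by fun_prop) (by fun_prop)
    · exact isClosed_iInter fun a => isClosed_iInter fun b => isClosed_eq (by fun_prop) (by fun_prop)
    · exact isClosed_iInter fun a => isClosed_le (by fun_prop) (by fun_prop)
    · exact isClosed_iInter fun a => isClosed_eq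
        (Complex.continuous_im.comp (continuous_apply _)) continuous_const
    · exact isClosed_iInter fun a => isClosed_le (by fun_prop)
        (Complex.continuous_re.comp (continuous_apply _))
  · intro φ hφ a _
    simpa using hφ.norm_le a

section VectorFunctional

variable {K : Type*} [NormedAddCommGroup K] [InnerProductSpace ℂ K] [CompleteSpace K]

/-- All the inequalities come from ⟨v, π(a*a)v⟩ = ‖π(a)v‖² and the Cauchy–Schwarz inequality. -/
theorem isQuasiState_inner (π : A →⋆ₙₐ[ℂ] (K →L[ℂ] K)) {v : K} (hv : ‖v‖ ≤ 1) :
    IsQuasiState fun a => ⟪v, π a v⟫_ℂ := by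
  have h1 : ∀ a, ⟪v, π (star a * a) v⟫_ℂ = (‖π a v‖ ^ 2 : ℝ) := by
    intro a
    rw [map_mul, map_star, ContinuousLinearMap.star_eq_adjoint]
    change ⟪v, ContinuousLinearMap.adjoint (π a) (π a v)⟫_ℂ = _
    rw [ContinuousLinearMap.adjoint_inner_right, inner_self_eq_norm_sq_to_K]
    simp
  have h2 : ∀ a, ‖⟪v, π a v⟫_ℂ‖ ≤ ‖π a v‖ := fun a =>
    (norm_inner_le_norm _ _).trans (mul_le_of_le_one_left (norm_nonneg _) hv)
  refine ⟨fun a b => ?_, fun c a => ?_, fun a => ?_, fun a => ?_, fun a => ?_⟩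
  · rw [map_add, add_apply, inner_add_right]
  · rw [map_smul, smul_apply, inner_smul_right]
  · calc _ ≤ ‖π a v‖ := h2 a
      _ ≤ ‖π a‖ * ‖v‖ := (π a).le_opNorm v
      _ ≤ ‖π a‖ := mul_le_of_le_one_right (norm_nonneg _) hv
      _ ≤ ‖a‖ := NonUnitalStarAlgHom.norm_apply_le π a
  · rw [h1, Complex.ofReal_im]
  · rw [h1, Complex.ofReal_re]
    exact pow_le_pow_left₀ (norm_nonneg _) (h2 a) 2

/-- A representation with a cyclic vector whose functional is an extreme quasi-state is
irreducible. -/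
theorem isIrreducibleRep_of_extreme (π : A →⋆ₙₐ[ℂ] (K →L[ℂ] K)) {ξ : K} (hξ : ‖ξ‖ ≤ 1)
    (hd : Dense (Set.range fun a => π a ξ))
    (hext : (fun a => ⟪ξ, π a ξ⟫_ℂ) ∈ Set.extremePoints ℝ {φ : A → ℂ | IsQuasiState φ}) :
    IsIrreducibleRep π := by
  intro M hM hinv
  have : CompleteSpace M := hM.completeSpace_coe
  set ξ₁ : K := M.starProjection ξ with hξ₁
  set ξ₂ : K := ξ - ξ₁ with hξ₂
  have h1M : ξ₁ ∈ M := M.starProjection_apply_mem ξ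
  have h2M : ξ₂ ∈ Mᗮ := M.sub_starProjection_mem_orthogonal ξ
  have hinv' : ∀ a, ∀ v ∈ Mᗮ, π a v ∈ Mᗮ := by
    intro a v hv
    rw [Submodule.mem_orthogonal] at hv ⊢
    intro u hu
    have : ⟪u, π a v⟫_ℂ = ⟪π (star a) u, v⟫_ℂ := by
      rw [map_star, ContinuousLinearMap.star_eq_adjoint, ContinuousLinearMap.adjoint_inner_left]
    rw [this]
    exact hv _ (hinv _ u hu)
  have hadd : ξ = ξ₁ + ξ₂ := by rw [hξ₂]; abel
  have horth : ∀ u ∈ M, ∀ v ∈ Mᗮ, ⟪u, v⟫_ℂ = 0 := fun u hu v hv =>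
    (Submodule.mem_orthogonal M v).mp hv u hu
  have horth' : ∀ u ∈ M, ∀ v ∈ Mᗮ, ⟪v, u⟫_ℂ = 0 := fun u hu v hv =>
    (Submodule.mem_orthogonal' M v).mp hv u hu
  have hzero : ∀ v, (∀ a, ⟪v, π a ξ⟫_ℂ = 0) → v = 0 := by
    intro v hv
    have : (fun w => ⟪v, w⟫_ℂ) = fun _ => 0 := by
      refine Continuous.ext_on hd (by fun_prop) continuous_const ?_
      rintro _ ⟨a, rfl⟩
      exact hv a
    exact inner_self_eq_zero.mp (congrFun this v)
  have hnorm : ‖ξ‖ ^ 2 = ‖ξ₁‖ ^ 2 + ‖ξ₂‖ ^ 2 := by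
    have := norm_add_sq (𝕜 := ℂ) ξ₁ ξ₂
    rw [horth _ h1M _ h2M, ← hadd] at this
    simpa using this
  by_cases h1 : ξ₁ = 0
  · left
    refine (Submodule.eq_bot_iff M).mpr fun v hv => hzero v fun a => ?_
    have : ξ = ξ₂ := by rw [hadd, h1, zero_add]
    rw [this]
    exact horth v hv _ (hinv' a _ h2M)
  by_cases h2 : ξ₂ = 0
  · right
    refine (Submodule.orthogonal_eq_bot_iff).mp
      ((Submodule.eq_bot_iff _).mpr fun v hv => hzero v fun a => ?_)
    have : ξ = ξ₁ := by rw [hadd, h2, add_zero]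
    rw [this]
    exact horth' _ (hinv a _ h1M) v hv
  -- If both components of ξ are nonzero, the functional is a proper convex combination of the
  -- vector functionals of ξ₁/√t and ξ₂/√(1 - t), with t = ‖ξ₁‖². The second weight is 1 - t, not
  -- ‖ξ₂‖², because only ‖ξ‖ ≤ 1 is known; the rescaled ξ₂ still has norm at most 1.
  exfalso
  have h1p : 0 < ‖ξ₁‖ := norm_pos_iff.mpr h1
  have h2p : 0 < ‖ξ₂‖ := norm_pos_iff.mpr h2
  set t : ℝ := ‖ξ₁‖ ^ 2 with ht
  have ht0 : 0 < t := by positivity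
  have hle : t + ‖ξ₂‖ ^ 2 ≤ 1 := by
    rw [← hnorm]
    exact pow_le_one₀ (norm_nonneg _) hξ
  have ht1 : 0 < 1 - t := by nlinarith [sq_pos_of_pos h2p]
  have hs : 0 < √(1 - t) := Real.sqrt_pos.mpr ht1
  have hscale : ∀ (r : ℝ) (v : K) (a : A),
      ⟪((r⁻¹ : ℝ) : ℂ) • v, π a (((r⁻¹ : ℝ) : ℂ) • v)⟫_ℂ = ((r ^ 2 : ℝ) : ℂ)⁻¹ * ⟪v, π a v⟫_ℂ := by
    intro r v a
    rw [map_smul, inner_smul_left, inner_smul_right, Complex.conj_ofReal, ← mul_assoc]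
    push_cast
    congr 1
    rw [← mul_inv, pow_two]
  have hn : ∀ (r : ℝ) (v : K), 0 < r → ‖v‖ ≤ r → ‖((r⁻¹ : ℝ) : ℂ) • v‖ ≤ 1 := by
    intro r v hr hv
    rw [norm_smul, Complex.norm_real, Real.norm_of_nonneg (inv_nonneg.mpr hr.le), inv_mul_le_iff₀ hr,
      mul_one]
    exact hv
  have q1 := isQuasiState_inner π (hn ‖ξ₁‖ ξ₁ h1p le_rfl)
  have q2 := isQuasiState_inner π (hn (√(1 - t)) ξ₂ hs
    (Real.le_sqrt_of_sq_le (by linarith)))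
  have hsplit : ∀ a, ⟪ξ, π a ξ⟫_ℂ = ⟪ξ₁, π a ξ₁⟫_ℂ + ⟪ξ₂, π a ξ₂⟫_ℂ := by
    intro a
    conv_lhs => rw [hadd, map_add, inner_add_left, inner_add_right, inner_add_right,
      horth _ h1M _ (hinv' a _ h2M), horth' _ (hinv a _ h1M) _ h2M]
    ring
  have heq := hext.2 q1 q2 ⟨t, 1 - t, ht0, ht1, by ring, by
    ext a
    simp only [Pi.add_apply, Pi.smul_apply, hscale, Real.sq_sqrt ht1.le, ← ht, hsplit,
      Complex.real_smul]
    have e1 : (t : ℂ) ≠ 0 := by exact_mod_cast ht0.ne'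
    have e2 : ((1 - t : ℝ) : ℂ) ≠ 0 := by exact_mod_cast ht1.ne'
    rw [mul_inv_cancel_left₀ e1, mul_inv_cancel_left₀ e2]⟩
  -- Extremality says ⟨ξ₁, π(a)ξ₁⟩ = t⟨ξ, π(a)ξ⟩. As ξ is cyclic this forces ξ₁ = tξ, which
  -- contradicts ξ₂ ⊥ ξ₁.
  have hvec : ξ₁ - (t : ℂ) • ξ = 0 := by
    refine hzero _ fun a => ?_
    have h3 := congrFun heq a
    simp only [hscale, ← ht] at h3
    have e1 : (t : ℂ) ≠ 0 := by exact_mod_cast ht0.ne'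
    rw [inv_mul_eq_iff_eq_mul₀ e1] at h3
    have h4 : ⟪ξ₁, π a ξ⟫_ℂ = ⟪ξ₁, π a ξ₁⟫_ℂ := by
      conv_lhs => rw [hadd, map_add, inner_add_right, horth _ h1M _ (hinv' a _ h2M), add_zero]
    rw [inner_sub_left, inner_smul_left, Complex.conj_ofReal, h4, h3, sub_self]
  have h5 : ⟪ξ₂, ξ₁⟫_ℂ = 0 := horth' _ h1M _ h2M
  rw [sub_eq_zero.mp hvec, inner_smul_right, hadd, inner_add_right, horth' _ h1M _ h2M,
    zero_add] at h5
  rcases mul_eq_zero.mp h5 with h6 | h6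
  · exact ht0.ne' (by exact_mod_cast h6)
  · exact h2 (inner_self_eq_zero.mp h6)

end VectorFunctional

open scoped ComplexOrder in
/-- Irreducible representations separate the points of an algebra of operators. -/
theorem exists_isIrreducibleRep_ne_zero {H : Type*} [NormedAddCommGroup H] [InnerProductSpace ℂ H]
    [CompleteSpace H] (ι : A →⋆ₙₐ[ℂ] (H →L[ℂ] H)) {a : A} (ha : ι a ≠ 0) :
    ∃ (K : Type u) (_ : NormedAddCommGroup K) (_ : InnerProductSpace ℂ K) (_ : CompleteSpace K)
      (π : A →⋆ₙₐ[ℂ] (K →L[ℂ] K)), IsIrreducibleRep π ∧ π a ≠ 0 := by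
  set b := star a * a with hb
  let ev : StrongDual ℝ (A → ℂ) :=
    Complex.reCLM.comp (ContinuousLinearMap.proj (R := ℝ) (φ := fun _ : A => ℂ) b)
  obtain ⟨h₀, hh₀⟩ : ∃ h, ι a h ≠ 0 := by
    by_contra! hcon
    exact ha (ContinuousLinearMap.ext hcon)
  have hh₀' : h₀ ≠ 0 := fun h => hh₀ (by rw [h, map_zero])
  set v : H := ((‖h₀‖⁻¹ : ℝ) : ℂ) • h₀ with hv
  have hv1 : ‖v‖ ≤ 1 := by
    rw [hv, norm_smul, Complex.norm_real, Real.norm_of_nonneg (by positivity),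
      inv_mul_cancel₀ (norm_ne_zero_iff.mpr hh₀')]
  have hav : ι a v ≠ 0 := by
    rw [hv, map_smul]
    refine smul_ne_zero ?_ hh₀
    exact_mod_cast inv_ne_zero (norm_ne_zero_iff.mpr hh₀')
  have hω := isQuasiState_inner ι hv1
  have hωb : 0 < ev fun a => ⟪v, ι a v⟫_ℂ := by
    change 0 < (⟪v, ι (star a * a) v⟫_ℂ).re
    rw [map_mul, map_star, ContinuousLinearMap.star_eq_adjoint]
    change 0 < (⟪v, ContinuousLinearMap.adjoint (ι a) (ι a v)⟫_ℂ).re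
    rw [ContinuousLinearMap.adjoint_inner_right, inner_self_eq_norm_sq_to_K]
    have : 0 < ‖ι a v‖ := norm_pos_iff.mpr hav
    exact_mod_cast pow_pos this 2
  set Q : Set (A → ℂ) := {φ | IsQuasiState φ} with hQ
  have hQc : IsCompact Q := isCompact_setOf_isQuasiState
  -- An extreme point of the face on which Re φ(a*a) is maximal is extreme among all quasi-states.
  -- The maximum is positive because a vector functional of `ι` is positive at a*a.
  have hexp : IsExposed ℝ Q (ev.toExposed Q) := ContinuousLinearMap.toExposed.isExposed
  obtain ⟨φ₀, hφ₀, hmax⟩ := hQc.exists_isMaxOn ⟨_, hω⟩ ev.continuous.continuousOn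
  obtain ⟨φ, hφ⟩ := (hexp.isCompact hQc).extremePoints_nonempty ⟨φ₀, hφ₀, fun ψ hψ => hmax hψ⟩
  have hφQ : φ ∈ Set.extremePoints ℝ Q := hexp.isExtreme.extremePoints_subset_extremePoints hφ
  have hφb : 0 < (φ b).re := hωb.trans_le (hφ.1.2 _ hω)
  have hφs : IsQuasiState φ := hφQ.1
  let _ : PartialOrder A := CStarAlgebra.spectralOrder A
  have _ : StarOrderedRing A := CStarAlgebra.spectralOrderedRing A
  let φl : A →ₗ[ℂ] ℂ :=
    { toFun := φ, map_add' := hφs.add, map_smul' := hφs.smul }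
  let f : A →ₚ[ℂ] ℂ := PositiveLinearMap.mk₀ φl (fun x hx => by
    obtain ⟨y, rfl⟩ := CStarAlgebra.nonneg_iff_eq_star_mul_self.mp hx
    rw [Complex.nonneg_iff]
    exact ⟨(sq_nonneg _).trans (hφs.norm_sq_le y), (hφs.im_eq y).symm⟩)
  have hf : ∀ x, f x = φ x := fun x => rfl
  have hfn : ∀ x : f.PreGNS, ‖x‖ ^ 2 = (φ (star (f.ofPreGNS x) * f.ofPreGNS x)).re := by
    intro x
    have := congrArg Complex.re (f.preGNS_norm_sq x)
    rw [hf] at this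
    exact_mod_cast this
  -- Without a unit the cyclic vector is not the class of 1. The inequality |φ(x)|² ≤ φ(x*x) makes φ
  -- bounded for the GNS norm, and the Riesz representation theorem supplies ξ with ⟨ξ, [x]⟩ = φ(x).
  let φc : f.PreGNS →L[ℂ] ℂ := (φl.comp f.ofPreGNS.toLinearMap).mkContinuous 1 (fun x => by
    rw [one_mul]
    refine le_of_sq_le_sq ?_ (norm_nonneg _)
    rw [hfn]
    exact hφs.norm_sq_le _)
  let Φ : f.GNS →L[ℂ] ℂ := φc.extend (UniformSpace.Completion.toComplL (𝕜 := ℂ))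
  have hΦ : ∀ x : f.PreGNS, Φ x = φ (f.ofPreGNS x) := fun x =>
    φc.extend_eq (UniformSpace.Completion.denseRange_coe)
      (UniformSpace.Completion.isUniformInducing_coe _) x
  let ξ : f.GNS := (InnerProductSpace.toDual ℂ f.GNS).symm Φ
  have hξ : ∀ y : f.GNS, ⟪ξ, y⟫_ℂ = Φ y := fun y => InnerProductSpace.toDual_symm_apply
  let π := f.gnsNonUnitalStarAlgHom
  have hπ : ∀ x c, π x (f.toPreGNS c : f.GNS) = (f.toPreGNS (x * c) : f.GNS) := fun x c => by
    simp [π]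
  -- Tested against a class [c], both sides give φ(x*c). It shows that ξ is cyclic and that its
  -- vector functional is φ.
  have hπξ : ∀ x, π x ξ = (f.toPreGNS x : f.GNS) := by
    intro x
    refine ext_inner_right ℂ fun y => ?_
    induction y using UniformSpace.Completion.induction_on with
    | hp => exact isClosed_eq (by fun_prop) (by fun_prop)
    | ih c =>
      have h1 : ⟪π x ξ, (c : f.GNS)⟫_ℂ = ⟪ξ, π (star x) (c : f.GNS)⟫_ℂ := by
        rw [map_star, ContinuousLinearMap.star_eq_adjoint, ContinuousLinearMap.adjoint_inner_right]
      have h2 : π (star x) (c : f.GNS) = (f.toPreGNS (star x * f.ofPreGNS c) : f.GNS) :=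
        hπ (star x) (f.ofPreGNS c)
      rw [h1, h2, hξ, hΦ, UniformSpace.Completion.inner_coe, f.preGNS_inner_def]
      rfl
  have hξφ : ∀ x, ⟪ξ, π x ξ⟫_ℂ = φ x := fun x => by
    rw [hπξ, hξ, hΦ]
    rfl
  have hξ1 : ‖ξ‖ ≤ 1 := by
    rw [LinearIsometryEquiv.norm_map]
    refine ContinuousLinearMap.opNorm_le_bound _ zero_le_one fun y => ?_
    induction y using UniformSpace.Completion.induction_on with
    | hp => exact isClosed_le (by fun_prop) (by fun_prop)
    | ih c =>
      rw [one_mul, hΦ, UniformSpace.Completion.norm_coe]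
      refine le_of_sq_le_sq ?_ (norm_nonneg _)
      rw [hfn]
      exact hφs.norm_sq_le _
  refine ⟨f.GNS, inferInstance, inferInstance, inferInstance, π,
    isIrreducibleRep_of_extreme π hξ1 ?_ ?_, ?_⟩
  · have : (fun x => π x ξ) = (fun x : f.PreGNS => (x : f.GNS)) ∘ f.toPreGNS := funext hπξ
    rw [this]
    exact UniformSpace.Completion.denseRange_coe.comp f.toPreGNS.surjective.denseRange
      (UniformSpace.Completion.continuous_coe _)
  · have : (fun x => ⟪ξ, π x ξ⟫_ℂ) = φ := funext hξφ
    rw [this]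
    exact hφQ
  · intro h
    have h1 : φ b = 0 := by
      rw [← hξφ, hb, map_mul, h, mul_zero, zero_apply, inner_zero_right]
    rw [h1] at hφb
    exact lt_irrefl _ hφb

end Irreducible

/-! ### Representations on matrices -/

section MatrixRepresentations

/-- Burnside's theorem on irreducible algebras of operators. -/
theorem subalgebra_eq_top_of_irreducible {V : Type*} [AddCommGroup V] [Module ℂ V]
    [FiniteDimensional ℂ V] [Nontrivial V] (S : Subalgebra ℂ (Module.End ℂ V))
    (h : ∀ W : Submodule ℂ V, (∀ s ∈ S, ∀ v ∈ W, s v ∈ W) → W = ⊥ ∨ W = ⊤) : S = ⊤ := by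
  have hsimple : IsSimpleModule S V := by
    refine (isSimpleModule_iff S V).mpr { eq_bot_or_eq_top := fun W => ?_ }
    rcases h (W.restrictScalars ℂ) (fun s hs v hv => W.smul_mem ⟨s, hs⟩ hv) with h | h
    · exact Or.inl ((Submodule.restrictScalars_eq_bot_iff ℂ S V).mp h)
    · exact Or.inr ((Submodule.restrictScalars_eq_top_iff ℂ S V).mp h)
  have hend := IsSimpleModule.algebraMap_end_bijective_of_isAlgClosed (A := S) (V := V) ℂ
  refine eq_top_iff.mpr fun f _ => ?_
  -- By Schur's lemma the commutant of `S` consists of scalars, so every linear map lies in the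
  -- bicommutant. Jacobson density then matches `f` with an element of `S` on a basis.
  let F : Module.End (Module.End S V) V :=
    { toFun := f
      map_add' := map_add f
      map_smul' := fun g v => by
        obtain ⟨c, rfl⟩ := hend.2 g
        exact map_smul f c v }
  let b := Module.finBasis ℂ V
  classical
  obtain ⟨r, hr⟩ := jacobson_density F (Finset.univ.image b)
  have : f = r.1 := b.ext fun i => hr (b i) (Finset.mem_image_of_mem b (Finset.mem_univ i))
  rw [this]
  exact r.2

/-- Matrix units move a nonzero entry of a member of the ideal to any position, and scale it freely.
-/
theorem eq_top_of_isIdeal {n : ℕ} (I : Submodule ℂ (Matrix (Fin n) (Fin n) ℂ))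
    (hl : ∀ B, ∀ X ∈ I, B * X ∈ I) (hr : ∀ B, ∀ X ∈ I, X * B ∈ I) (h : I ≠ ⊥) : I = ⊤ := by
  obtain ⟨X, hX, hX0⟩ := I.exists_mem_ne_zero_of_ne_bot h
  obtain ⟨p, q, hpq⟩ : ∃ p q, X p q ≠ 0 := by
    by_contra! hcon
    exact hX0 (Matrix.ext hcon)
  refine eq_top_iff.mpr fun Y _ => ?_
  rw [Matrix.matrix_eq_sum_single Y]
  refine I.sum_mem fun i _ => I.sum_mem fun j _ => ?_
  have h1 := hr (Matrix.single q j (Y i j)) _ (hl (Matrix.single i p (X p q)⁻¹) X hX)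
  rwa [Matrix.single_mul_mul_single, inv_mul_cancel₀ hpq, one_mul] at h1

variable {A : Type u} [NonUnitalCStarAlgebra A] {n : ℕ}

/-- The restriction of a representation to an invariant subspace. -/
def restrictRep {V : Type*} [NormedAddCommGroup V] [InnerProductSpace ℂ V] [CompleteSpace V]
    (ρ : A →⋆ₙₐ[ℂ] (V →L[ℂ] V)) (W : Submodule ℂ V) [CompleteSpace W]
    (hW : ∀ a, ∀ v ∈ W, ρ a v ∈ W) : A →⋆ₙₐ[ℂ] (W →L[ℂ] W) where
  toFun a := ((ρ a).comp W.subtypeL).codRestrict W fun v => hW a v v.2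
  map_smul' c a := by ext v; simp; rfl
  map_zero' := by ext v; simp
  map_add' a b := by ext v; simp; rfl
  map_mul' a b := by ext v; simp; rfl
  map_star' a := by
    rw [ContinuousLinearMap.star_eq_adjoint, ContinuousLinearMap.eq_adjoint_iff]
    intro x y
    change ⟪ρ (star a) x, (y : V)⟫_ℂ = ⟪(x : V), ρ a y⟫_ℂ
    rw [map_star, ContinuousLinearMap.star_eq_adjoint, ContinuousLinearMap.adjoint_inner_left]

/-- Induction on the dimension of `W`. If `A` acts irreducibly on `W`, homogeneity gives dimension
exactly `n`. Otherwise `W` contains a proper nonzero invariant subspace, and `A` acts nontrivially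
either on it or on its orthogonal complement in `W`. -/
theorem le_finrank_of_invariant (hA : IsHomogeneousCStarAlgebra n A) {V : Type*}
    [NormedAddCommGroup V] [InnerProductSpace ℂ V] [FiniteDimensional ℂ V] [CompleteSpace V]
    (ρ : A →⋆ₙₐ[ℂ] (V →L[ℂ] V)) (m : ℕ) : ∀ (W : Submodule ℂ V),
      (∀ a, ∀ v ∈ W, ρ a v ∈ W) → (∃ a, ∃ v ∈ W, ρ a v ≠ 0) → Module.finrank ℂ W = m → n ≤ m := by
  induction m using Nat.strong_induction_on with
  | _ m ih =>
  intro W hW hne hm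
  -- Homogeneity speaks only of Hilbert spaces in the universe of `A`, so `W` is replaced by a
  -- lifted copy of ℂ^m.
  let b := (stdOrthonormalBasis ℂ W).reindex (Equiv.ulift.{u} (α := Fin (Module.finrank ℂ W))).symm
  let K := EuclideanSpace ℂ (ULift.{u} (Fin (Module.finrank ℂ W)))
  let e : W ≃ₗᵢ[ℂ] K := b.repr
  let π : A →⋆ₙₐ[ℂ] (K →L[ℂ] K) :=
    (e.conjStarAlgEquiv : (W →L[ℂ] W) →⋆ₙₐ[ℂ] (K →L[ℂ] K)).comp (restrictRep ρ W hW)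
  let J : K →ₗ[ℂ] V := W.subtype.comp e.symm.toLinearEquiv.toLinearMap
  have hJ : ∀ a x, J (π a x) = ρ a (J x) := by
    intro a x
    change ((e.symm (e (restrictRep ρ W hW a (e.symm x))) : W) : V) = _
    rw [e.symm_apply_apply]
    rfl
  have hJinj : Function.Injective J := Subtype.val_injective.comp e.symm.injective
  have hJW : ∀ x, J x ∈ W := fun x => (e.symm x).2
  have hJe : ∀ w : W, J (e w) = w := fun w => congrArg Subtype.val (e.symm_apply_apply w)
  obtain ⟨a, v, hv, hav⟩ := hne
  have hπ : π ≠ 0 := by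
    intro h0
    have h1 := hJ a (e ⟨v, hv⟩)
    rw [h0, hJe] at h1
    exact hav (h1.symm.trans (map_zero J))
  by_cases hirr : IsIrreducibleRep π
  · have h1 := Module.finrank_eq_of_rank_eq (hA K π hπ hirr)
    exact (h1.symm.trans (e.toLinearEquiv.finrank_eq.symm.trans hm)).le
  rw [IsIrreducibleRep] at hirr
  push Not at hirr
  obtain ⟨M, -, hMinv, hM⟩ := hirr
  have hMW : M.map J ≤ W := by
    rintro _ ⟨x, -, rfl⟩
    exact hJW x
  have hWinv : ∀ a, ∀ v ∈ M.map J, ρ a v ∈ M.map J := by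
    rintro a _ ⟨x, hx, rfl⟩
    exact ⟨π a x, hMinv a x hx, hJ a x⟩
  have hbot : M.map J ≠ ⊥ := fun h => hM.1 ((Submodule.eq_bot_iff M).mpr fun x hx =>
    hJinj (((Submodule.eq_bot_iff _).mp h _ ⟨x, hx, rfl⟩).trans (map_zero J).symm))
  have htop : M.map J ≠ W := by
    intro h
    refine hM.2 (eq_top_iff.mpr fun x _ => ?_)
    have : J x ∈ M.map J := h.symm ▸ hJW x
    obtain ⟨y, hy, hxy⟩ := this
    exact hJinj hxy ▸ hy
  by_cases hz : ∃ a, ∃ v ∈ M.map J, ρ a v ≠ 0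
  · have hlt := Submodule.finrank_lt_finrank_of_lt (lt_of_le_of_ne hMW htop)
    replace hlt := hlt.trans_eq hm
    exact (ih _ hlt _ hWinv hz rfl).trans hlt.le
  -- Here `A` kills the image of `M`, so subtracting from `v` its projection onto that image does
  -- not change `ρ a v`, and the action on the complement is nonzero.
  · push Not at hz
    have hlt : (M.map J)ᗮ ⊓ W < W := by
      refine lt_of_le_of_ne inf_le_right fun h => hbot ?_
      have h1 : M.map J ≤ (M.map J)ᗮ := hMW.trans (inf_eq_right.mp h)
      have h2 := (M.map J).inf_orthogonal_eq_bot
      rwa [inf_eq_left.mpr h1] at h2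
    have hlt' := Submodule.finrank_lt_finrank_of_lt hlt
    replace hlt' := hlt'.trans_eq hm
    refine (ih _ hlt' _ ?_ ⟨a, v - (M.map J).starProjection v, Submodule.mem_inf.mpr ⟨?_, ?_⟩, ?_⟩
      rfl).trans hlt'.le
    · rintro a v ⟨hv1, hv2⟩
      refine ⟨(Submodule.mem_orthogonal _ _).mpr fun u hu => ?_, hW a v hv2⟩
      have : ⟪u, ρ a v⟫_ℂ = ⟪ρ (star a) u, v⟫_ℂ := by
        rw [map_star, ContinuousLinearMap.star_eq_adjoint, ContinuousLinearMap.adjoint_inner_left]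
      rw [this]
      exact (Submodule.mem_orthogonal _ _).mp hv1 _ (hWinv _ u hu)
    · exact (M.map J).sub_starProjection_mem_orthogonal v
    · exact W.sub_mem hv (hMW ((M.map J).starProjection_apply_mem v))
    · rw [map_sub, hz a _ ((M.map J).starProjection_apply_mem v), sub_zero]
      exact hav

/-- A representation on `n × n` matrices, as a representation on `ℂ^n`. -/
def euclideanRep (π : A →⋆ₙₐ[ℂ] Matrix (Fin n) (Fin n) ℂ) :
    A →⋆ₙₐ[ℂ] (EuclideanSpace ℂ (Fin n) →L[ℂ] EuclideanSpace ℂ (Fin n)) :=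
  ((Matrix.toEuclideanCLM (n := Fin n) (𝕜 := ℂ) : Matrix (Fin n) (Fin n) ℂ ≃⋆ₐ[ℂ] _) :
    Matrix (Fin n) (Fin n) ℂ →⋆ₙₐ[ℂ] _).comp π

/-- Nonzero representations of an `n`-homogeneous algebra on `n × n` matrices are surjective. -/
theorem surjective_of_ne_zero (hA : IsHomogeneousCStarAlgebra n A)
    (π : A →⋆ₙₐ[ℂ] Matrix (Fin n) (Fin n) ℂ) (hπ : π ≠ 0) : Function.Surjective π := by
  set V := EuclideanSpace ℂ (Fin n)
  let ρ : A →⋆ₙₐ[ℂ] (V →L[ℂ] V) := euclideanRep π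
  have hρ : ∀ a, ρ a = 0 ↔ π a = 0 := fun a => by
    rw [← map_zero (Matrix.toEuclideanCLM (n := Fin n) (𝕜 := ℂ))]
    exact (Matrix.toEuclideanCLM (n := Fin n) (𝕜 := ℂ)).injective.eq_iff
  obtain ⟨a₀, ha₀⟩ : ∃ a, π a ≠ 0 := by
    by_contra! hcon
    exact hπ (NonUnitalStarAlgHom.ext hcon)
  obtain ⟨v₀, hv₀⟩ : ∃ v, ρ a₀ v ≠ 0 := by
    by_contra! hcon
    exact ha₀ ((hρ a₀).mp (ContinuousLinearMap.ext hcon))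
  have hv0 : v₀ ≠ 0 := fun h => hv₀ (by rw [h, map_zero])
  have hnt : Nontrivial V := ⟨v₀, 0, hv0⟩
  -- An invariant subspace with nonzero action has dimension at least `n`, the dimension of `V`. For
  -- irreducibility, an invariant subspace with zero action has a complement to which this applies.
  have htop : ∀ W : Submodule ℂ V, (∀ a, ∀ v ∈ W, ρ a v ∈ W) → (∃ a, ∃ v ∈ W, ρ a v ≠ 0) →
      W = ⊤ := by
    intro W hW hne
    have h1 := le_finrank_of_invariant hA ρ _ W hW hne rfl
    refine Submodule.eq_top_of_finrank_eq (le_antisymm W.finrank_le ?_)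
    rwa [finrank_euclideanSpace_fin]
  have hirr : ∀ W : Submodule ℂ V, (∀ a, ∀ v ∈ W, ρ a v ∈ W) → W = ⊥ ∨ W = ⊤ := by
    intro W hW
    by_cases hz : ∃ a, ∃ v ∈ W, ρ a v ≠ 0
    · exact Or.inr (htop W hW hz)
    left
    push Not at hz
    have hW' : Wᗮ = ⊤ := by
      refine htop _ (fun a v hv => (Submodule.mem_orthogonal _ _).mpr fun u hu => ?_)
        ⟨a₀, v₀ - W.starProjection v₀, W.sub_starProjection_mem_orthogonal v₀, ?_⟩
      · have : ⟪u, ρ a v⟫_ℂ = ⟪ρ (star a) u, v⟫_ℂ := by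
          rw [map_star, ContinuousLinearMap.star_eq_adjoint,
            ContinuousLinearMap.adjoint_inner_left]
        rw [this]
        exact (Submodule.mem_orthogonal _ _).mp hv _ (hW _ u hu)
      · rw [map_sub, hz a₀ _ (W.starProjection_apply_mem v₀), sub_zero]
        exact hv₀
    exact (Submodule.orthogonal_eq_top_iff W).mp hW'
  let op : Matrix (Fin n) (Fin n) ℂ ≃ₐ[ℂ] Module.End ℂ V :=
    (Matrix.toLinAlgEquiv (EuclideanSpace.basisFun (Fin n) ℂ).toBasis)
  have hop : ∀ a v, op (π a) v = ρ a v := by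
    intro a v
    change _ = (Matrix.toEuclideanCLM (n := Fin n) (𝕜 := ℂ) (π a) : V →ₗ[ℂ] V) v
    rw [Matrix.coe_toEuclideanCLM_eq_toEuclideanLin, Matrix.toEuclideanLin_eq_toLin_orthonormal]
    rfl
  let S : Subalgebra ℂ (Module.End ℂ V) := Algebra.adjoin ℂ (Set.range fun a => op (π a))
  have hS : S = ⊤ := by
    refine subalgebra_eq_top_of_irreducible S fun W hW => hirr W fun a v hv => ?_
    rw [← hop]
    exact hW _ (Algebra.subset_adjoin ⟨a, rfl⟩) v hv
  let I : Submodule ℂ (Matrix (Fin n) (Fin n) ℂ) :=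
    { carrier := Set.range π
      zero_mem' := ⟨0, map_zero π⟩
      add_mem' := by
        rintro _ _ ⟨a, rfl⟩ ⟨b, rfl⟩
        exact ⟨a + b, map_add π a b⟩
      smul_mem' := by
        rintro c _ ⟨a, rfl⟩
        exact ⟨c • a, map_smul π c a⟩ }
  have hmem : ∀ B, op B ∈ S := fun B => hS ▸ Algebra.mem_top
  -- The range of `π` is not known to contain 1, so Burnside's theorem is applied to the unital
  -- algebra `S` it generates. The range is an ideal of `S`, hence of all matrices, and the matrix
  -- algebra is simple.
  have key : ∀ T ∈ S, ∀ X ∈ I, op.symm T * X ∈ I ∧ X * op.symm T ∈ I := by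
    intro T hT
    induction hT using Algebra.adjoin_induction with
    | mem T hT =>
      obtain ⟨a, rfl⟩ := hT
      rintro _ ⟨b, rfl⟩
      simp only [AlgEquiv.symm_apply_apply]
      exact ⟨⟨a * b, map_mul π a b⟩, ⟨b * a, map_mul π b a⟩⟩
    | algebraMap c =>
      intro X hX
      rw [AlgEquiv.commutes, Algebra.algebraMap_eq_smul_one, smul_mul_assoc, one_mul,
        mul_smul_comm, mul_one]
      exact ⟨I.smul_mem c hX, I.smul_mem c hX⟩
    | add S T _ _ hS hT =>
      intro X hX
      rw [map_add, add_mul, mul_add]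
      exact ⟨I.add_mem (hS X hX).1 (hT X hX).1, I.add_mem (hS X hX).2 (hT X hX).2⟩
    | mul S T _ _ hS hT =>
      intro X hX
      rw [map_mul, mul_assoc, ← mul_assoc X]
      exact ⟨(hS _ (hT X hX).1).1, (hT _ (hS X hX).2).2⟩
  have hI : I = ⊤ := by
    refine eq_top_of_isIdeal I (fun B X hX => ?_) (fun B X hX => ?_) ?_
    · simpa using (key _ (hmem B) X hX).1
    · simpa using (key _ (hmem B) X hX).2
    · exact fun h => ha₀ ((Submodule.eq_bot_iff I).mp h (π a₀) ⟨a₀, rfl⟩)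
  intro B
  have : B ∈ I := hI ▸ Submodule.mem_top
  exact this

/-- Representations on `n × n` matrices separate the points of an `n`-homogeneous algebra of
operators. -/
theorem exists_matrixRep_ne_zero (hA : IsHomogeneousCStarAlgebra n A) {H : Type*}
    [NormedAddCommGroup H] [InnerProductSpace ℂ H] [CompleteSpace H] (ι : A →⋆ₙₐ[ℂ] (H →L[ℂ] H))
    {a : A} (ha : ι a ≠ 0) : ∃ π : A →⋆ₙₐ[ℂ] Matrix (Fin n) (Fin n) ℂ, π a ≠ 0 := by
  obtain ⟨K, _, _, _, π, hirr, hπa⟩ := exists_isIrreducibleRep_ne_zero ι ha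
  have hπ : π ≠ 0 := fun h => hπa (by rw [h]; rfl)
  have hrank := hA K π hπ hirr
  have : FiniteDimensional ℂ K := by
    refine Module.rank_lt_aleph0_iff.mp ?_
    rw [hrank]
    exact Cardinal.natCast_lt_aleph0
  let e : K ≃ₗᵢ[ℂ] EuclideanSpace ℂ (Fin n) :=
    ((stdOrthonormalBasis ℂ K).reindex (finCongr (Module.finrank_eq_of_rank_eq hrank))).repr
  let φ : (K →L[ℂ] K) ≃⋆ₐ[ℂ] Matrix (Fin n) (Fin n) ℂ :=
    e.conjStarAlgEquiv.trans (Matrix.toEuclideanCLM (n := Fin n) (𝕜 := ℂ)).symm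
  refine ⟨(φ : (K →L[ℂ] K) →⋆ₙₐ[ℂ] Matrix (Fin n) (Fin n) ℂ).comp π, fun h => hπa ?_⟩
  exact φ.injective (h.trans (map_zero φ).symm)

/-- Every `*`-automorphism of the `n × n` matrices is inner. -/
theorem exists_unitary_of_starAlgEquiv
    (θ : Matrix (Fin n) (Fin n) ℂ ≃⋆ₐ[ℂ] Matrix (Fin n) (Fin n) ℂ) :
    ∃ U : Matrix.unitaryGroup (Fin n) ℂ, ∀ B, θ B = U * B * star (U : Matrix (Fin n) (Fin n) ℂ) := by
  let τ := Matrix.toEuclideanCLM (n := Fin n) (𝕜 := ℂ)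
  let f := (τ.symm.trans θ).trans τ
  obtain ⟨U, hU⟩ := f.eq_linearIsometryEquivConjStarAlgEquiv
    (LinearMap.continuous_of_finiteDimensional f.toAlgEquiv.toLinearMap)
  let u := Unitary.linearIsometryEquiv.symm U
  have hu : ∀ x, f x = u.1 * x * star u.1 := by
    intro x
    rw [hU, ← Unitary.conjStarAlgAut_symm_unitaryLinearIsometryEquiv]
    rfl
  have hs : τ (star (τ.symm u.1)) = star u.1 := by rw [map_star τ, τ.apply_symm_apply]
  have hmem : τ.symm u.1 ∈ Matrix.unitaryGroup (Fin n) ℂ := by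
    rw [Matrix.mem_unitaryGroup_iff]
    refine (EquivLike.injective τ) ?_
    rw [map_mul, hs, τ.apply_symm_apply, Unitary.mul_star_self_of_mem u.2, map_one]
  refine ⟨⟨τ.symm u.1, hmem⟩, fun B => ?_⟩
  refine (EquivLike.injective τ) ?_
  have h1 := hu (τ B)
  simp only [f, StarAlgEquiv.trans_apply, StarAlgEquiv.symm_apply_apply] at h1
  change τ (θ B) = τ (τ.symm u.1 * B * star (τ.symm u.1))
  rw [h1, map_mul, map_mul, hs, τ.apply_symm_apply]

/-- Two nonzero representations on `n × n` matrices are unitarily equivalent or can be separated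
by an element of the algebra. -/
theorem exists_separating_or_equivalent {π ρ : A →⋆ₙₐ[ℂ] Matrix (Fin n) (Fin n) ℂ}
    (hπ : Function.Surjective π) (hρ : Function.Surjective ρ) :
    (∃ a, π a = 1 ∧ ρ a = 0) ∨ ∃ U : Matrix.unitaryGroup (Fin n) ℂ, ∀ a,
      π a = U * ρ a * star (U : Matrix (Fin n) (Fin n) ℂ) := by
  by_cases hker : ∀ a, ρ a = 0 → π a = 0
  -- Since ker ρ ⊆ ker π, π factors as θ ∘ ρ with θ a surjective *-endomorphism of the matrices. By
  -- dimension θ is an automorphism, hence inner.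
  · right
    have hwd : ∀ a b, ρ a = ρ b → π a = π b := fun a b h => by
      rw [← sub_eq_zero, ← map_sub]
      exact hker _ (by rw [map_sub, h, sub_self])
    choose s hs using hρ
    let θ : Matrix (Fin n) (Fin n) ℂ →⋆ₙₐ[ℂ] Matrix (Fin n) (Fin n) ℂ :=
      { toFun := fun B => π (s B)
        map_smul' := fun c B => by
          rw [MonoidHom.id_apply, ← map_smul]
          exact hwd _ _ (by rw [map_smul, hs, hs])
        map_zero' := hker _ (hs 0)
        map_add' := fun B C => by
          rw [← map_add]
          exact hwd _ _ (by rw [map_add, hs, hs, hs])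
        map_mul' := fun B C => by
          rw [← map_mul]
          exact hwd _ _ (by rw [map_mul, hs, hs, hs])
        map_star' := fun B => by
          rw [← map_star]
          exact hwd _ _ (by rw [map_star, hs, hs]) }
    have hθ : ∀ a, θ (ρ a) = π a := fun a => hwd _ _ (hs _)
    have hsurj : Function.Surjective θ := fun B => by
      obtain ⟨a, rfl⟩ := hπ B
      exact ⟨ρ a, hθ a⟩
    let θl : Matrix (Fin n) (Fin n) ℂ →ₗ[ℂ] Matrix (Fin n) (Fin n) ℂ :=
      { toFun := θ, map_add' := map_add θ, map_smul' := map_smul θ }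
    have hinj : Function.Injective θ := (LinearMap.injective_iff_surjective (f := θl)).mpr hsurj
    obtain ⟨U, hU⟩ := exists_unitary_of_starAlgEquiv (StarAlgEquiv.ofBijective θ ⟨hinj, hsurj⟩)
    exact ⟨U, fun a => (hθ a).symm.trans (hU _)⟩
  · left
    push Not at hker
    obtain ⟨a₀, h1, h2⟩ := hker
    -- The image of ker ρ under the surjection π is a nonzero ideal, so it contains 1.
    let I : Submodule ℂ (Matrix (Fin n) (Fin n) ℂ) :=
      { carrier := {X | ∃ a, ρ a = 0 ∧ π a = X}
        zero_mem' := ⟨0, map_zero ρ, map_zero π⟩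
        add_mem' := by
          rintro _ _ ⟨a, ha, rfl⟩ ⟨b, hb, rfl⟩
          exact ⟨a + b, by rw [map_add, ha, hb, add_zero], map_add π a b⟩
        smul_mem' := by
          rintro c _ ⟨a, ha, rfl⟩
          exact ⟨c • a, by rw [map_smul, ha, smul_zero], map_smul π c a⟩ }
    have hI : I = ⊤ := by
      refine eq_top_of_isIdeal I ?_ ?_ fun h =>
        h2 ((Submodule.eq_bot_iff I).mp h _ ⟨a₀, h1, rfl⟩)
      · rintro B _ ⟨a, ha, rfl⟩
        obtain ⟨b, rfl⟩ := hπ B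
        exact ⟨b * a, by rw [map_mul, ha, mul_zero], map_mul π b a⟩
      · rintro B _ ⟨a, ha, rfl⟩
        obtain ⟨b, rfl⟩ := hπ B
        exact ⟨a * b, by rw [map_mul, ha, zero_mul], map_mul π a b⟩
    have : (1 : Matrix (Fin n) (Fin n) ℂ) ∈ I := hI ▸ Submodule.mem_top
    obtain ⟨a, ha, ha'⟩ := this
    exact ⟨a, ha', ha⟩

end MatrixRepresentations

open scoped Matrix.Norms.L2Operator

/-! ### The space of representations on matrices -/

section RepSpace

/-- The space of representations on `n × n` matrices, with the topology of pointwise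
convergence. -/
def RepSpace (n : ℕ) (A : Type*) [NonUnitalCStarAlgebra A] : Type _ :=
  A →⋆ₙₐ[ℂ] Matrix (Fin n) (Fin n) ℂ

variable {n : ℕ} {A : Type*} [NonUnitalCStarAlgebra A]

namespace RepSpace

instance : FunLike (RepSpace n A) A (Matrix (Fin n) (Fin n) ℂ) :=
  inferInstanceAs (FunLike (A →⋆ₙₐ[ℂ] Matrix (Fin n) (Fin n) ℂ) A (Matrix (Fin n) (Fin n) ℂ))

instance : NonUnitalAlgHomClass (RepSpace n A) ℂ A (Matrix (Fin n) (Fin n) ℂ) :=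
  inferInstanceAs (NonUnitalAlgHomClass (A →⋆ₙₐ[ℂ] Matrix (Fin n) (Fin n) ℂ) ℂ A
    (Matrix (Fin n) (Fin n) ℂ))

instance : StarHomClass (RepSpace n A) A (Matrix (Fin n) (Fin n) ℂ) :=
  inferInstanceAs (StarHomClass (A →⋆ₙₐ[ℂ] Matrix (Fin n) (Fin n) ℂ) A
    (Matrix (Fin n) (Fin n) ℂ))

instance : Zero (RepSpace n A) :=
  inferInstanceAs (Zero (A →⋆ₙₐ[ℂ] Matrix (Fin n) (Fin n) ℂ))

instance : TopologicalSpace (RepSpace n A) :=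
  TopologicalSpace.induced (fun (π : RepSpace n A) (a : A) => π a) inferInstance

@[simp]
theorem zero_apply (a : A) : (0 : RepSpace n A) a = 0 := rfl

theorem isInducing_coe : IsInducing fun (π : RepSpace n A) (a : A) => π a := ⟨rfl⟩

theorem isEmbedding_coe : IsEmbedding fun (π : RepSpace n A) (a : A) => π a :=
  ⟨isInducing_coe, DFunLike.coe_injective⟩

theorem continuous_eval (a : A) : Continuous fun π : RepSpace n A => π a :=
  (continuous_apply a).comp isInducing_coe.continuous

instance : T2Space (RepSpace n A) := isEmbedding_coe.t2Space

theorem norm_apply_le (π : RepSpace n A) (a : A) : ‖π a‖ ≤ ‖a‖ :=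
  NonUnitalStarAlgHom.norm_apply_le (F := RepSpace n A) π a

/-- *-homomorphisms are contractive, so they form a closed subset of a product of compact balls.
Including the zero homomorphism is what makes the subset closed. -/
instance : CompactSpace (RepSpace n A) := by
  have hK : IsCompact (Set.univ.pi fun a : A =>
      Metric.closedBall (0 : Matrix (Fin n) (Fin n) ℂ) ‖a‖) :=
    isCompact_univ_pi fun a => isCompact_closedBall _ _
  have hcl : IsClosed (Set.range fun (π : RepSpace n A) (a : A) => π a) := by
    have : (Set.range fun (π : RepSpace n A) (a : A) => π a) =
        {f | (∀ a b, f (a + b) = f a + f b) ∧ (∀ a b, f (a * b) = f a * f b) ∧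
          (∀ (c : ℂ) a, f (c • a) = c • f a) ∧ ∀ a, f (star a) = star (f a)} := by
      ext f
      refine ⟨?_, fun ⟨h1, h2, h3, h4⟩ => ⟨({ 
        toFun := f
        map_smul' := h3
        map_zero' := by simpa using h3 0 0
        map_add' := h1
        map_mul' := h2
        map_star' := h4 } : A →⋆ₙₐ[ℂ] Matrix (Fin n) (Fin n) ℂ), rfl⟩⟩
      rintro ⟨π, rfl⟩
      exact ⟨map_add π, map_mul π, fun c a => map_smul π c a, map_star π⟩
    rw [this]
    have hc : ∀ a : A, Continuous fun f : A → Matrix (Fin n) (Fin n) ℂ => f a := continuous_apply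
    simp only [Set.ofPred_and, Set.ofPred_forall]
    refine IsClosed.inter ?_ (IsClosed.inter ?_ (IsClosed.inter ?_ ?_))
    · exact isClosed_iInter fun a => isClosed_iInter fun b =>
        isClosed_eq (hc _) ((hc a).add (hc b))
    · exact isClosed_iInter fun a => isClosed_iInter fun b =>
        isClosed_eq (hc _) ((hc a).mul (hc b))
    · exact isClosed_iInter fun c => isClosed_iInter fun a =>
        isClosed_eq (hc _) ((hc a).const_smul c)
    · exact isClosed_iInter fun a => isClosed_eq (hc _) (hc a).star
  refine isCompact_univ_iff.mp (isEmbedding_coe.isCompact_iff.mpr ?_)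
  rw [Set.image_univ]
  refine hK.of_isClosed_subset hcl ?_
  rintro _ ⟨π, rfl⟩ a -
  simpa using norm_apply_le π a

instance : SMul (Matrix.unitaryGroup (Fin n) ℂ) (RepSpace n A) where
  smul U π := (((Unitary.conjStarAlgAut ℂ (Matrix (Fin n) (Fin n) ℂ) U :
    Matrix (Fin n) (Fin n) ℂ →⋆ₙₐ[ℂ] Matrix (Fin n) (Fin n) ℂ)).comp
      (π : A →⋆ₙₐ[ℂ] Matrix (Fin n) (Fin n) ℂ) : A →⋆ₙₐ[ℂ] Matrix (Fin n) (Fin n) ℂ)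

theorem smul_apply (U : Matrix.unitaryGroup (Fin n) ℂ) (π : RepSpace n A) (a : A) :
    (U • π) a = U * π a * star (U : Matrix (Fin n) (Fin n) ℂ) :=
  Unitary.conjStarAlgAut_apply (S := ℂ) U (π a)

instance : MulAction (Matrix.unitaryGroup (Fin n) ℂ) (RepSpace n A) where
  one_smul π := DFunLike.ext _ _ fun a => by simp [smul_apply]
  mul_smul U V π := DFunLike.ext _ _ fun a => by simp [smul_apply, mul_assoc]

instance : ContinuousSMul (Matrix.unitaryGroup (Fin n) ℂ) (RepSpace n A) where
  continuous_smul := by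
    refine isInducing_coe.continuous_iff.mpr (continuous_pi fun a => ?_)
    simp only [Function.comp_def, smul_apply]
    have h1 : Continuous fun p : Matrix.unitaryGroup (Fin n) ℂ × RepSpace n A =>
      (p.1 : Matrix (Fin n) (Fin n) ℂ) := continuous_subtype_val.comp continuous_fst
    exact (h1.mul ((continuous_eval a).comp continuous_snd)).mul h1.star

theorem smul_zero (U : Matrix.unitaryGroup (Fin n) ℂ) : U • (0 : RepSpace n A) = 0 :=
  DFunLike.ext _ _ fun a => by simp [smul_apply]

variable (n A) in
/-- The transform of an element of `A` to a matrix-valued function of representations. -/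
def transform : A →⋆ₙₐ[ℂ] C(RepSpace n A, Matrix (Fin n) (Fin n) ℂ) where
  toFun a := ⟨fun π => π a, continuous_eval a⟩
  map_smul' c a := by ext1 π; exact map_smul π c a
  map_zero' := by ext1 π; exact map_zero π
  map_add' a b := by ext1 π; exact map_add π a b
  map_mul' a b := by ext1 π; exact map_mul π a b
  map_star' a := by ext1 π; exact map_star π a

/-- Injective *-homomorphisms of C*-algebras are isometric; in particular the range is closed, so
density suffices to compute it. -/
theorem isometry_transform (h : ∀ a : A, a ≠ 0 → ∃ π : RepSpace n A, π a ≠ 0) :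
    Isometry (transform n A) := by
  refine NonUnitalStarAlgHom.isometry _ ((injective_iff_map_eq_zero _).mpr fun a ha => ?_)
  by_contra hne
  obtain ⟨π, hπ⟩ := h a hne
  exact hπ (DFunLike.congr_fun ha π)

theorem isClosed_range_transform (h : ∀ a : A, a ≠ 0 → ∃ π : RepSpace n A, π a ≠ 0) :
    IsClosed (Set.range (transform n A)) :=
  (isometry_transform h).isClosedEmbedding.isClosed_range

end RepSpace

theorem norm_conj_unitary {B : Type*} [CStarAlgebra B] (U : unitary B) (b : B) :
    ‖(U * b * star (U : B) : B)‖ = ‖b‖ := by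
  have h := CStarRing.norm_mul_coe_unitary (U * b : B) (star U)
  rw [Unitary.coe_star] at h
  rw [h, CStarRing.norm_coe_unitary_mul]

end RepSpace

/-! ### Urysohn functions and a Stone–Weierstrass theorem for homogeneous algebras -/

theorem cfcₙ_eq_zero_of_norm_le {n : ℕ} {x : Matrix (Fin n) (Fin n) ℂ} (hx : IsSelfAdjoint x)
    {f : ℝ → ℝ} {r : ℝ} (hr : ‖x‖ ≤ r) (hf : ∀ t, |t| ≤ r → f t = 0) : cfcₙ f x = 0 := by
  have : (quasispectrum ℝ x).EqOn f (fun _ => 0) := fun t ht =>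
    hf t ((NonUnitalIsometricContinuousFunctionalCalculus.norm_quasispectrum_le x ht hx).trans hr)
  rw [cfcₙ_congr this]
  exact cfcₙ_const_zero ℝ x

theorem cfcₙ_eq_one_of_norm_sub_le {n : ℕ} {x : Matrix (Fin n) (Fin n) ℂ} (hx : IsSelfAdjoint x)
    {f : ℝ → ℝ} (hf0 : f 0 = 0) (hfc : Continuous f) {r : ℝ} (hr : ‖x - 1‖ ≤ r)
    (hf : ∀ t, |t - 1| ≤ r → f t = 1) : cfcₙ f x = 1 := by
  rw [cfcₙ_eq_cfc (hf := hfc.continuousOn) (hf0 := hf0)]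
  have : (spectrum ℝ x).EqOn f (fun _ => 1) := fun t ht => by
    have h1 : t - 1 ∈ spectrum ℝ (x - 1) := by
      have h2 := spectrum.sub_singleton_eq x (1 : ℝ)
      rw [map_one] at h2
      rw [← h2]
      exact Set.sub_mem_sub ht rfl
    exact hf t ((IsometricContinuousFunctionalCalculus.norm_spectrum_le (x - 1) h1
      (hx.sub (.one _))).trans hr)
  rw [cfc_congr this]
  exact cfc_const_one ℝ x

section Separation

variable {n : ℕ} {A : Type u} [NonUnitalCStarAlgebra A]

theorem RepSpace.surjective (hA : IsHomogeneousCStarAlgebra n A) {π : RepSpace n A}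
    (hπ : π ≠ 0) (B : Matrix (Fin n) (Fin n) ℂ) : ∃ a : A, π a = B :=
  surjective_of_ne_zero hA π hπ B

/-- Functional calculus turns approximate values into exact ones: the cutoff is 0 for t ≤ 1/2 and 1
for t ≥ 3/4, takes values in [0, 1], and commutes with every representation. It vanishes at 0, so
the result stays in the possibly nonunital algebra. -/
theorem RepSpace.exists_truncation (a : A) : ∃ b : A, (∀ π : RepSpace n A, ‖π b‖ ≤ 1) ∧
    (∀ π : RepSpace n A, ‖π (star a * a)‖ ≤ 1 / 2 → π b = 0) ∧
    ∀ π : RepSpace n A, ‖π (star a * a) - 1‖ ≤ 1 / 4 → π b = 1 := by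
  let f : ℝ → ℝ := fun t => min 1 (max 0 (4 * t - 2))
  have hf0 : f 0 = 0 := by norm_num [f]
  have hfc : Continuous f := by fun_prop
  have hx : IsSelfAdjoint (star a * a) := IsSelfAdjoint.star_mul_self a
  have hπx : ∀ π : RepSpace n A, IsSelfAdjoint (π (star a * a)) := fun π => hx.map π
  have h : ∀ π : RepSpace n A, π (cfcₙ f (star a * a)) = cfcₙ f (π (star a * a)) := fun π =>
    NonUnitalStarAlgHomClass.map_cfcₙ (S := ℂ) π f (star a * a) hfc.continuousOn hf0
      (AddMonoidHomClass.continuous_of_bound π 1 fun a => by simpa using norm_apply_le π a)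
      hx (hπx π)
  refine ⟨cfcₙ f (star a * a), fun π => ?_, fun π hπ => ?_, fun π hπ => ?_⟩
  · rw [h]
    refine norm_cfcₙ_le fun t _ => ?_
    rw [Real.norm_eq_abs, abs_le]
    exact ⟨by linarith [le_min (zero_le_one (α := ℝ)) (le_max_left 0 (4 * t - 2))],
      min_le_left _ _⟩
  · rw [h]
    refine cfcₙ_eq_zero_of_norm_le (hπx π) hπ fun t ht => ?_
    have := (abs_le.mp ht).2
    simp only [f]
    rw [max_eq_left (by linarith), min_eq_right zero_le_one]
  · rw [h]
    refine cfcₙ_eq_one_of_norm_sub_le (hπx π) hf0 hfc hπ fun t ht => ?_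
    have := (abs_le.mp ht).1
    exact min_eq_left (le_max_of_le_right (by linarith))

/-- Each ρ in `G` can be separated from `π`, since it is zero or lies on another orbit. Truncation
makes the separating element vanish near ρ, and a product over a finite cover of the compact set `G`
vanishes on all of `G`. -/
theorem RepSpace.exists_eq_one_eq_zero (hA : IsHomogeneousCStarAlgebra n A) {π : RepSpace n A}
    (hπ : π ≠ 0) {G : Set (RepSpace n A)} (hG : IsClosed G)
    (h : ∀ U : Matrix.unitaryGroup (Fin n) ℂ, U • π ∉ G) :
    ∃ a, π a = 1 ∧ ∀ ρ ∈ G, ρ a = 0 := by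
  have hs := surjective_of_ne_zero hA π hπ
  refine hG.isCompact.induction_on (p := fun s => ∃ a, π a = 1 ∧ ∀ ρ ∈ s, ρ a = 0) ?_ ?_ ?_ ?_
  · obtain ⟨a, ha⟩ := hs 1
    exact ⟨a, ha, fun ρ hρ => hρ.elim⟩
  · rintro s t hst ⟨a, ha, hat⟩
    exact ⟨a, ha, fun ρ hρ => hat ρ (hst hρ)⟩
  · rintro s t ⟨a, ha, has⟩ ⟨b, hb, hbt⟩
    refine ⟨a * b, by rw [map_mul, ha, hb, one_mul], fun ρ hρ => ?_⟩
    rw [map_mul]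
    rcases hρ with hρ | hρ
    · rw [has ρ hρ, zero_mul]
    · rw [hbt ρ hρ, mul_zero]
  · intro ρ hρ
    obtain ⟨a, ha, hρa⟩ : ∃ a, π a = 1 ∧ ρ a = 0 := by
      by_cases hρ0 : ρ = 0
      · obtain ⟨a, ha⟩ := hs 1
        exact ⟨a, ha, by rw [hρ0]; rfl⟩
      · rcases exists_separating_or_equivalent (surjective_of_ne_zero hA ρ hρ0) hs with h1 | ⟨U, hU⟩
        · rcases exists_separating_or_equivalent hs (surjective_of_ne_zero hA ρ hρ0) with
            h2 | ⟨U, hU⟩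
          · exact h2
          · refine (h U⁻¹ ?_).elim
            have : π = U • ρ := DFunLike.ext _ _ fun a => (hU a).trans (smul_apply U ρ a).symm
            rwa [this, inv_smul_smul]
        · refine (h U ?_).elim
          have : ρ = U • π := DFunLike.ext _ _ fun a => (hU a).trans (smul_apply U π a).symm
          rwa [← this]
    obtain ⟨b, -, hb0, hb1⟩ := exists_truncation (n := n) a
    refine ⟨{σ | ‖σ (star a * a)‖ < 1 / 2}, mem_nhdsWithin_of_mem_nhds ?_, b,
      hb1 π (by rw [map_mul, map_star, ha]; simp), fun σ hσ => hb0 σ (le_of_lt hσ)⟩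
    refine (isOpen_lt (continuous_eval _).norm continuous_const).mem_nhds ?_
    rw [Set.mem_ofPred_eq, map_mul, hρa]
    simp

/-- Compactness is now used on `K`: truncation makes an element equal to 1 near a given point of
`K`, and finitely many such elements are combined. The disjointness hypothesis concerns whole orbits
because every transform is equivariant. -/
theorem RepSpace.exists_urysohn (hA : IsHomogeneousCStarAlgebra n A)
    {K G : Set (RepSpace n A)} (hK : IsClosed K) (hG : IsClosed G) (hK0 : (0 : RepSpace n A) ∉ K)
    (h : ∀ (U : Matrix.unitaryGroup (Fin n) ℂ), ∀ π ∈ K, U • π ∉ G) :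
    ∃ a : A, (∀ π ∈ K, π a = 1) ∧ (∀ π ∈ G, π a = 0) ∧ ∀ π : RepSpace n A, ‖π a‖ ≤ 1 := by
  have key : ∀ c : A, (∀ π ∈ G, π c = 0) → ∃ a : A, (∀ π ∈ G, π a = 0) ∧
      (∀ π : RepSpace n A, ‖π a‖ ≤ 1) ∧
      ∀ π : RepSpace n A, ‖π (star c * c) - 1‖ ≤ 1 / 4 → π a = 1 := by
    intro c hc
    obtain ⟨b, hb, hb0, hb1⟩ := exists_truncation (n := n) c
    refine ⟨b, fun π hπ => hb0 π ?_, hb, hb1⟩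
    rw [map_mul, hc π hπ]
    simp
  refine hK.isCompact.induction_on (p := fun s => ∃ a : A, (∀ π ∈ s, π a = 1) ∧
    (∀ π ∈ G, π a = 0) ∧ ∀ π : RepSpace n A, ‖π a‖ ≤ 1) ?_ ?_ ?_ ?_
  · exact ⟨0, fun π hπ => hπ.elim, fun π _ => map_zero π, fun π => by simp⟩
  · rintro s t hst ⟨a, ha, ha'⟩
    exact ⟨a, fun π hπ => ha π (hst hπ), ha'⟩
  · rintro s t ⟨a, ha, ha0, -⟩ ⟨b, hb, hb0, -⟩
    -- By 1 - (a + b - ab) = (1 - a)(1 - b), this element is 1 where `a` or `b` is 1 and vanishes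
    -- where both do. Truncation restores the norm bound.
    obtain ⟨c, hc0, hc, hc1⟩ := key (a + b - a * b) fun π hπ => by
      rw [map_sub, map_add, map_mul, ha0 π hπ, hb0 π hπ]
      simp
    refine ⟨c, fun π hπ => hc1 π ?_, hc0, hc⟩
    have : π (a + b - a * b) = 1 := by
      rw [map_sub, map_add, map_mul]
      rcases hπ with hπ | hπ
      · rw [ha π hπ, one_mul, add_sub_cancel_right]
      · rw [hb π hπ, mul_one, add_sub_cancel_left]
    rw [map_mul, map_star, this]
    simp
  · intro π hπ
    obtain ⟨a, ha, ha0⟩ := exists_eq_one_eq_zero hA (ne_of_mem_of_not_mem hπ hK0) hG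
      fun U => h U π hπ
    obtain ⟨b, hb0, hb, hb1⟩ := key a ha0
    refine ⟨{σ | ‖σ (star a * a) - 1‖ < 1 / 4}, mem_nhdsWithin_of_mem_nhds ?_, b,
      fun σ hσ => hb1 σ (le_of_lt hσ), hb0, hb⟩
    refine (isOpen_lt ((continuous_eval _).sub continuous_const).norm continuous_const).mem_nhds ?_
    change ‖π (star a * a) - 1‖ < 1 / 4
    rw [map_mul, map_star, ha]
    simp

/-- Invariant scalar functions vanishing at the zero representation are transforms. -/
theorem RepSpace.exists_eq_smul_one (hA : IsHomogeneousCStarAlgebra n A)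
    (hsep : ∀ a : A, a ≠ 0 → ∃ π : RepSpace n A, π a ≠ 0) (z : C(RepSpace n A, ℝ))
    (hz0 : z 0 = 0) (hnonneg : ∀ π, 0 ≤ z π) (hle : ∀ π, z π ≤ 1)
    (hinv : ∀ (U : Matrix.unitaryGroup (Fin n) ℂ) π, z (U • π) = z π) :
    ∃ a : A, ∀ π : RepSpace n A, π a = (z π : ℂ) • 1 := by
  let F : C(RepSpace n A, Matrix (Fin n) (Fin n) ℂ) :=
    ⟨fun π => (z π : ℂ) • 1, (Complex.continuous_ofReal.comp z.continuous).smul continuous_const⟩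
  suffices hF : F ∈ Set.range (transform n A) by
    obtain ⟨a, ha⟩ := hF
    exact ⟨a, fun π => DFunLike.congr_fun ha π⟩
  rw [← (isClosed_range_transform hsep).closure_eq, Metric.mem_closure_iff]
  intro ε hε
  obtain ⟨m, hm⟩ := exists_nat_gt (2 / ε)
  have hm0 : (0 : ℝ) < m := lt_trans (by positivity) hm
  -- The function z is sliced into layers of height 1/m. Invariance of z keeps the two level sets of
  -- each layer on disjoint orbits, and z(0) = 0 keeps the upper one away from the zero
  -- representation.
  have hu : ∀ i : ℕ, ∃ a : A, (∀ π ∈ {π : RepSpace n A | (i + 1 : ℝ) ≤ m * z π}, π a = 1) ∧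
      (∀ π ∈ {π : RepSpace n A | m * z π ≤ i}, π a = 0) ∧ ∀ π : RepSpace n A, ‖π a‖ ≤ 1 := by
    intro i
    refine exists_urysohn hA (isClosed_le continuous_const (by fun_prop))
      (isClosed_le (by fun_prop) continuous_const) ?_ ?_
    · rw [Set.mem_ofPred_eq, hz0]
      push Not
      rw [mul_zero]
      positivity
    · intro U π hπ hπ'
      rw [Set.mem_ofPred_eq] at hπ hπ'
      rw [hinv] at hπ'
      linarith
  choose e he1 he0 he using hu
  have hone : ‖(1 : Matrix (Fin n) (Fin n) ℂ)‖ ≤ 1 := by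
    rcases subsingleton_or_nontrivial (Matrix (Fin n) (Fin n) ℂ) with h | h
    · simp [Subsingleton.elim (1 : Matrix (Fin n) (Fin n) ℂ) 0]
    · exact CStarRing.norm_one.le
  refine ⟨transform n A ((m : ℂ)⁻¹ • ∑ i ∈ Finset.range m, e i), ⟨_, rfl⟩, ?_⟩
  rw [dist_eq_norm]
  refine lt_of_le_of_lt ((ContinuousMap.norm_le _ (by positivity)).mpr fun π => ?_)
    (show 2 / m < ε by rwa [div_lt_comm₀ hm0 hε])
  -- The exact share of layer `i` in m·z(π); these sum to m·z(π). The element `e i` takes this value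
  -- except possibly at the one index ⌊m z(π)⌋, where the error is at most 2. This explains the
  -- choice m > 2/ε.
  let c : ℕ → ℝ := fun i => min (m * z π) (i + 1) - min (m * z π) i
  have hc : ∑ i ∈ Finset.range m, c i = m * z π := by
    have := Finset.sum_range_sub (fun i : ℕ => min (m * z π) (i : ℝ)) m
    push_cast at this
    rw [this, min_eq_left (mul_le_of_le_one_right hm0.le (hle π)),
      min_eq_right (mul_nonneg hm0.le (hnonneg π)), sub_zero]
  have hterm : ∀ i : ℕ, ‖(c i : ℂ) • (1 : Matrix (Fin n) (Fin n) ℂ) - π (e i)‖ ≤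
      if ⌊m * z π⌋₊ = i then 2 else 0 := by
    intro i
    rcases le_or_gt (m * z π) i with h1 | h1
    · have : c i = 0 := by
        simp only [c]
        rw [min_eq_left h1, min_eq_left (by linarith), sub_self]
      rw [this, he0 i π h1]
      simp only [Complex.ofReal_zero, zero_smul, sub_zero, norm_zero]
      split_ifs <;> norm_num
    rcases le_or_gt (i + 1 : ℝ) (m * z π) with h2 | h2
    · have : c i = 1 := by
        simp only [c]
        rw [min_eq_right h1.le, min_eq_right h2, add_sub_cancel_left]
      rw [this, he1 i π h2]
      simp only [Complex.ofReal_one, one_smul, sub_self, norm_zero]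
      split_ifs <;> norm_num
    · rw [if_pos ((Nat.floor_eq_iff (mul_nonneg hm0.le (hnonneg π))).mpr ⟨h1.le, h2⟩)]
      refine (norm_sub_le _ _).trans ?_
      have h3 : |c i| ≤ 1 := by
        simp only [c]
        rw [min_eq_right h1.le, min_eq_left h2.le, abs_le]
        constructor <;> linarith
      have h4 : ‖(c i : ℂ) • (1 : Matrix (Fin n) (Fin n) ℂ)‖ ≤ 1 := by
        rw [norm_smul, Complex.norm_real]
        exact mul_le_one₀ h3 (norm_nonneg _) hone
      linarith [he i π]
  have hsum : F π - π ((m : ℂ)⁻¹ • ∑ i ∈ Finset.range m, e i) =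
      (m : ℂ)⁻¹ • ∑ i ∈ Finset.range m, ((c i : ℂ) • (1 : Matrix (Fin n) (Fin n) ℂ) - π (e i)) := by
    rw [Finset.sum_sub_distrib, ← Finset.sum_smul, ← Complex.ofReal_sum, hc, map_smul, map_sum,
      smul_sub, smul_smul, Complex.ofReal_mul, Complex.ofReal_natCast,
      inv_mul_cancel_left₀ (by exact_mod_cast hm0.ne')]
    rfl
  change ‖F π - π ((m : ℂ)⁻¹ • ∑ i ∈ Finset.range m, e i)‖ ≤ _
  rw [hsum, norm_smul, norm_inv, Complex.norm_natCast, div_eq_inv_mul]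
  gcongr
  refine (norm_sum_le_of_le _ fun i _ => hterm i).trans ?_
  rw [Finset.sum_ite_eq]
  split_ifs <;> norm_num

/-- The transforms of the elements of an `n`-homogeneous algebra are the equivariant continuous
functions that vanish at the zero representation. -/
theorem RepSpace.exists_transform_eq (hA : IsHomogeneousCStarAlgebra n A)
    (hsep : ∀ a : A, a ≠ 0 → ∃ π : RepSpace n A, π a ≠ 0)
    (F : C(RepSpace n A, Matrix (Fin n) (Fin n) ℂ)) (hF0 : F 0 = 0)
    (hF : ∀ (U : Matrix.unitaryGroup (Fin n) ℂ) π,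
      F (U • π) = U * F π * star (U : Matrix (Fin n) (Fin n) ℂ)) :
    ∃ a : A, transform n A a = F := by
  suffices hF : F ∈ Set.range (transform n A) from hF
  rw [← (isClosed_range_transform hsep).closure_eq, Metric.mem_closure_iff]
  intro δ hδ
  obtain ⟨ε, hε, hεδ⟩ : ∃ ε > 0, 2 * ε < δ := ⟨δ / 4, by positivity, by linarith⟩
  let D : A → RepSpace n A → ℝ := fun a π => ‖π a - F π‖
  have hDc : ∀ a, Continuous (D a) := fun a => ((continuous_eval a).sub F.continuous).norm
  have hFinv : ∀ (U : Matrix.unitaryGroup (Fin n) ℂ) π, ‖F (U • π)‖ = ‖F π‖ := fun U π => by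
    rw [hF, norm_conj_unitary]
  have hDinv : ∀ a (U : Matrix.unitaryGroup (Fin n) ℂ) π, D a (U • π) = D a π := fun a U π => by
    simp only [D]
    rw [hF, smul_apply, ← sub_mul, ← mul_sub, norm_conj_unitary]
  -- This compact set avoids the zero representation, so at each of its points surjectivity supplies
  -- an element of `A` matching `F` there.
  have hK : IsCompact {π : RepSpace n A | 2 * ε ≤ ‖F π‖} :=
    (isClosed_le continuous_const F.continuous.norm).isCompact
  obtain ⟨t, ht⟩ := hK.elim_finite_subcover (fun a : A => {π | D a π < ε})
    (fun a => isOpen_lt (hDc a) continuous_const) fun π hπ => by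
      have hπ0 : π ≠ 0 := by
        rintro rfl
        rw [Set.mem_ofPred_eq, hF0, norm_zero] at hπ
        linarith
      obtain ⟨a, ha⟩ := RepSpace.surjective hA hπ0 (F π)
      refine Set.mem_iUnion.mpr ⟨a, ?_⟩
      simp only [Set.mem_ofPred_eq, D]
      rwa [ha, sub_self, norm_zero]
  -- An invariant partition of unity with weights z_a/s. The factor ‖F‖ makes z_a vanish at the zero
  -- representation, as needed for a transform; y covers the region where `F` is small and is paired
  -- with the approximant 0.
  let z : A → RepSpace n A → ℝ := fun a π => max (ε - D a π) 0 * ‖F π‖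
  let y : RepSpace n A → ℝ := fun π => max (2 * ε - ‖F π‖) 0
  let s : RepSpace n A → ℝ := fun π => ∑ a ∈ t, z a π + y π
  have hz : ∀ a π, 0 ≤ z a π := fun a π => mul_nonneg (le_max_right _ _) (norm_nonneg _)
  have hy : ∀ π, 0 ≤ y π := fun π => le_max_right _ _
  have hzs : ∀ a ∈ t, ∀ π, z a π ≤ s π := fun a ha π =>
    (Finset.single_le_sum (f := fun a => z a π) (fun a _ => hz a π) ha).trans
      (le_add_of_nonneg_right (hy π))
  have hs : ∀ π, 0 < s π := by
    intro π
    rcases lt_or_ge ‖F π‖ (2 * ε) with h | h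
    · exact add_pos_of_nonneg_of_pos (Finset.sum_nonneg fun a _ => hz a π)
        (lt_max_of_lt_left (by linarith))
    · obtain ⟨a, ha, haπ⟩ := Set.mem_iUnion₂.mp (ht h)
      rw [Set.mem_ofPred_eq] at haπ
      exact lt_of_lt_of_le (mul_pos (lt_max_of_lt_left (by linarith)) (by linarith)) (hzs a ha π)
  have hzc : ∀ a, Continuous (z a) := fun a =>
    ((continuous_const.sub (hDc a)).max continuous_const).mul F.continuous.norm
  have hyc : Continuous y := (continuous_const.sub F.continuous.norm).max continuous_const
  have hsc : Continuous s := (continuous_finsetSum _ fun a _ => hzc a).add hyc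
  have hw : ∀ a ∈ t, ∃ c : A, ∀ π : RepSpace n A, π c = ((z a π / s π : ℝ) : ℂ) • 1 := by
    intro a ha
    refine exists_eq_smul_one hA hsep ⟨fun π => z a π / s π, (hzc a).div hsc fun π => (hs π).ne'⟩
      ?_ (fun π => div_nonneg (hz a π) (hs π).le) (fun π => (div_le_one (hs π)).mpr (hzs a ha π))
      fun U π => ?_
    · simp [z, hF0]
    · simp only [ContinuousMap.coe_mk, s, z, y, hFinv, hDinv]
  choose! c hc using hw
  refine ⟨transform n A (∑ a ∈ t, c a * a), ⟨_, rfl⟩, ?_⟩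
  rw [dist_comm, dist_eq_norm]
  refine lt_of_le_of_lt ((ContinuousMap.norm_le _ (by positivity)).mpr fun π => ?_) hεδ
  -- The error is a weighted mean of the differences π(a) - F(π) and of -F(π). Wherever its weight
  -- is nonzero, each of them has norm at most 2ε.
  have h1 : π (∑ a ∈ t, c a * a) - F π = ((s π)⁻¹ : ℂ) •
      (∑ a ∈ t, (z a π : ℂ) • (π a - F π) - (y π : ℂ) • F π) := by
    have h2 : F π = ((s π)⁻¹ : ℂ) • ((s π : ℂ) • F π) := by
      rw [smul_smul, inv_mul_cancel₀ (by exact_mod_cast (hs π).ne'), one_smul]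
    have h3 : π (∑ a ∈ t, c a * a) = ((s π)⁻¹ : ℂ) • ∑ a ∈ t, (z a π : ℂ) • π a := by
      rw [map_sum, Finset.smul_sum]
      refine Finset.sum_congr rfl fun a ha => ?_
      rw [map_mul, hc a ha, smul_mul_assoc, one_mul, smul_smul, div_eq_inv_mul]
      push_cast
      rfl
    rw [h3]
    nth_rw 1 [h2]
    rw [← smul_sub]
    congr 1
    simp only [s, smul_sub, Finset.sum_sub_distrib]
    push_cast
    rw [add_smul, Finset.sum_smul]
    abel
  change ‖π (∑ a ∈ t, c a * a) - F π‖ ≤ _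
  rw [h1, norm_smul, norm_inv, Complex.norm_real, Real.norm_of_nonneg (hs π).le,
    inv_mul_le_iff₀ (hs π)]
  have h4 : ∀ a, ‖(z a π : ℂ) • (π a - F π)‖ ≤ z a π * (2 * ε) := by
    intro a
    rw [norm_smul, Complex.norm_real, Real.norm_of_nonneg (hz a π)]
    rcases le_or_gt (D a π) ε with h | h
    · exact mul_le_mul_of_nonneg_left (h.trans (by linarith)) (hz a π)
    · have : z a π = 0 := by
        simp only [z]
        rw [max_eq_right (by linarith), zero_mul]
      rw [this, zero_mul, zero_mul]
  have h5 : ‖(y π : ℂ) • F π‖ ≤ y π * (2 * ε) := by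
    rw [norm_smul, Complex.norm_real, Real.norm_of_nonneg (hy π)]
    rcases le_or_gt ‖F π‖ (2 * ε) with h | h
    · exact mul_le_mul_of_nonneg_left h (hy π)
    · have : y π = 0 := max_eq_right (by linarith)
      rw [this, zero_mul, zero_mul]
  calc _ ≤ ∑ a ∈ t, z a π * (2 * ε) + y π * (2 * ε) :=
        (norm_sub_le _ _).trans (add_le_add (norm_sum_le_of_le _ fun a _ => h4 a) h5)
    _ = s π * (2 * ε) := by rw [← Finset.sum_mul, ← add_mul]

end Separation

/-! ### Averages over a compact unitary group -/

section Average

variable {B : Type*} [CStarAlgebra B]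

section Haar

variable [CompactSpace (unitary B)] [MeasurableSpace (unitary B)] [BorelSpace (unitary B)]

variable (B) in
/-- The normalized Haar measure of the unitary group. -/
def unitaryHaar : Measure (unitary B) := Measure.haarMeasure ⊤

instance : (unitaryHaar B).IsHaarMeasure := inferInstanceAs (Measure.haarMeasure ⊤).IsHaarMeasure

instance : IsProbabilityMeasure (unitaryHaar B) := ⟨Measure.haarMeasure_self⟩

/-- Compact groups are unimodular: a right translate of Haar measure is again a Haar probability
measure, and this is unique. -/
instance : (unitaryHaar B).IsMulRightInvariant where
  map_mul_right_eq_self g := by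
    have : IsProbabilityMeasure (Measure.map (· * g) (unitaryHaar B)) :=
      Measure.isProbabilityMeasure_map (measurable_mul_const g).aemeasurable
    exact Measure.isHaarMeasure_eq_of_isProbabilityMeasure _ _

end Haar

/-- A contractive linear map between spaces of continuous functions, as a continuous linear map. -/
def contractionCLM {Y : Type*} [TopologicalSpace Y] [CompactSpace Y]
    (L : C(Y, B) →ₗ[ℂ] C(Y, B)) (h : ∀ F, ‖L F‖ ≤ 1 * ‖F‖) :
    C(Y, B) →L[ℂ] C(Y, B) :=
  L.mkContinuous 1 h

variable {Y : Type*} [TopologicalSpace Y] [MulAction (unitary B) Y] [ContinuousSMul (unitary B) Y]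

/-- The action of the unitary group on continuous functions. -/
def translateFun (U : unitary B) (F : C(Y, B)) : C(Y, B) :=
  ⟨fun y => U * F (U⁻¹ • y) * star (U : B), by fun_prop⟩

theorem translateFun_apply (U : unitary B) (F : C(Y, B)) (y : Y) :
    translateFun U F y = U * F (U⁻¹ • y) * star (U : B) := rfl

variable [CompactSpace Y]

/-- The action of the unitary group on continuous functions, as a linear map. -/
def translateLinearMap (U : unitary B) : C(Y, B) →ₗ[ℂ] C(Y, B) where
  toFun := translateFun U
  map_add' F G := by
    ext1 y
    rw [ContinuousMap.add_apply, translateFun_apply, translateFun_apply, translateFun_apply,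
      ContinuousMap.add_apply, mul_add, add_mul]
  map_smul' c F := by
    ext1 y
    rw [RingHom.id_apply, ContinuousMap.smul_apply, translateFun_apply, translateFun_apply,
      ContinuousMap.smul_apply, mul_smul_comm, smul_mul_assoc]

theorem norm_translateLinearMap_le (U : unitary B) (F : C(Y, B)) :
    ‖translateLinearMap U F‖ ≤ 1 * ‖F‖ := by
  rw [one_mul]
  refine (ContinuousMap.norm_le _ (norm_nonneg F)).mpr fun y => ?_
  exact (norm_conj_unitary U _).trans_le (F.norm_coe_le_norm _)

/-- The action of the unitary group on continuous functions, as a continuous linear map. -/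
def translate (U : unitary B) : C(Y, B) →L[ℂ] C(Y, B) :=
  contractionCLM (translateLinearMap U) (norm_translateLinearMap_le U)

theorem translate_apply (U : unitary B) (F : C(Y, B)) (y : Y) :
    translate U F y = U * F (U⁻¹ • y) * star (U : B) := rfl

theorem translate_eq_self_iff {U : unitary B} {F : C(Y, B)} : translate U F = F ↔
      ∀ y, F (U • y) = U * F y * star (U : B) := by
  refine ⟨fun h y => ?_, fun h => ContinuousMap.ext fun y => ?_⟩
  · conv_lhs => rw [← h]
    rw [translate_apply, inv_smul_smul]
  · rw [translate_apply, ← h, smul_inv_smul]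

theorem translate_mul (U V : unitary B) (F : C(Y, B)) :
    translate (U * V) F = translate U (translate V F) := by
  ext1 y
  simp only [translate_apply, mul_inv_rev, mul_smul, Submonoid.coe_mul, star_mul, mul_assoc]

theorem continuous_translate (F : C(Y, B)) : Continuous fun U : unitary B => translate U F :=
  (ContinuousMap.curry ⟨fun p : unitary B × Y => (p.1 * F (p.1⁻¹ • p.2) * star (p.1 : B) : B),
    by fun_prop⟩).continuous

variable [CompactSpace (unitary B)] [MeasurableSpace (unitary B)] [BorelSpace (unitary B)]

theorem integrable_translate (F : C(Y, B)) :
    Integrable (fun U : unitary B => translate U F) (unitaryHaar B) :=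
  (continuous_translate F).integrable_of_hasCompactSupport (HasCompactSupport.of_compactSpace _)

/-- The average of a function over the unitary group, as a linear map. -/
def averageLinearMap : C(Y, B) →ₗ[ℂ] C(Y, B) where
  toFun F := ∫ U, translate U F ∂unitaryHaar B
  map_add' F G := by
    simp only [map_add]
    exact integral_add (integrable_translate F) (integrable_translate G)
  map_smul' c F := by
    simp only [map_smul]
    exact integral_smul c _

theorem norm_averageLinearMap_le (F : C(Y, B)) : ‖averageLinearMap F‖ ≤ 1 * ‖F‖ := by
  refine (norm_integral_le_of_norm_le_const (C := 1 * ‖F‖)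
    (Eventually.of_forall fun U => norm_translateLinearMap_le U F)).trans ?_
  simp

/-- The average of a function over the unitary group. -/
def unitaryAverage : C(Y, B) →L[ℂ] C(Y, B) :=
  contractionCLM averageLinearMap norm_averageLinearMap_le

/-- Bochner integrals commute with bounded linear maps. Real linearity is enough, which allows the
conjugate linear `star` below. -/
theorem map_unitaryAverage {E : Type*} [NormedAddCommGroup E] [NormedSpace ℝ E] [CompleteSpace E]
    (L : C(Y, B) →L[ℝ] E) (F : C(Y, B)) :
    L (unitaryAverage F) = ∫ U, L (translate U F) ∂unitaryHaar B :=
  (L.integral_comp_comm (integrable_translate F)).symm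

theorem map_unitaryAverage_of_forall {E : Type*} [NormedAddCommGroup E] [NormedSpace ℝ E]
    [CompleteSpace E] (L : C(Y, B) →L[ℝ] E) {F : C(Y, B)} {w : E}
    (h : ∀ U : unitary B, L (translate U F) = w) : L (unitaryAverage F) = w := by
  rw [map_unitaryAverage, funext h, integral_const]
  simp

theorem unitaryAverage_of_invariant {F : C(Y, B)} (h : ∀ U : unitary B, translate U F = F) :
    unitaryAverage F = F :=
  map_unitaryAverage_of_forall (E := C(Y, B)) (ContinuousLinearMap.id ℝ C(Y, B)) (F := F) h

theorem unitaryAverage_translate (V : unitary B) (F : C(Y, B)) :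
    unitaryAverage (translate V F) = unitaryAverage F := by
  change ∫ U, translate U (translate V F) ∂unitaryHaar B = ∫ U, translate U F ∂unitaryHaar B
  simp only [← translate_mul]
  exact integral_mul_right_eq_self (fun U => translate U F) V

theorem translate_unitaryAverage (V : unitary B) (F : C(Y, B)) :
    translate V (unitaryAverage F) = unitaryAverage F := by
  refine (map_unitaryAverage ((translate V).restrictScalars ℝ) F).trans ?_
  change ∫ U, translate V (translate U F) ∂unitaryHaar B = ∫ U, translate U F ∂unitaryHaar B
  simp only [← translate_mul]
  exact integral_mul_left_eq_self (fun U => translate U F) V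

theorem map_unitaryAverage_of_comm (L : C(Y, B) →L[ℝ] C(Y, B)) (F : C(Y, B))
    (h : ∀ U : unitary B, L (translate U F) = translate U (L F)) :
    L (unitaryAverage F) = unitaryAverage (L F) := by
  rw [map_unitaryAverage, funext h]
  rfl

theorem unitaryAverage_star (F : C(Y, B)) :
    unitaryAverage (star F) = star (unitaryAverage F) := by
  refine (map_unitaryAverage_of_comm ((starL' ℝ : C(Y, B) ≃L[ℝ] C(Y, B)) :
    C(Y, B) →L[ℝ] C(Y, B)) F fun U => ?_).symm
  ext1 y
  change star (U * F (U⁻¹ • y) * star (U : B)) = U * star (F (U⁻¹ • y)) * star (U : B)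
  rw [star_mul, star_mul, star_star, mul_assoc]

/-- The module property of a conditional expectation: right multiplication by an invariant function
commutes with translations, hence with their average. -/
theorem unitaryAverage_mul_of_invariant {F : C(Y, B)} (hF : ∀ U : unitary B, translate U F = F)
    (G : C(Y, B)) : unitaryAverage (G * F) = unitaryAverage G * F := by
  refine (map_unitaryAverage_of_comm
    ((ContinuousLinearMap.mul ℝ C(Y, B)).flip F) G fun U => ?_).symm
  change translate U G * F = translate U (G * F)
  conv_lhs => rw [← hF U]
  ext1 y
  have h : star (U : B) * U = 1 := U.2.1
  simp only [ContinuousMap.mul_apply, translate_apply, mul_assoc]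
  rw [← mul_assoc (star _) (U : B), h, one_mul]

theorem unitaryAverage_apply_eq_zero {F : C(Y, B)} {y : Y} (hF : F y = 0)
    (hy : ∀ U : unitary B, U • y = y) : unitaryAverage F y = 0 := by
  refine map_unitaryAverage_of_forall (E := B) (ContinuousMap.evalCLM ℝ y : C(Y, B) →L[ℝ] B)
    (F := F) fun U => ?_
  change U * F (U⁻¹ • y) * star (U : B) = 0
  rw [hy, hF, mul_zero, zero_mul]

end Average

open scoped Matrix.Norms.L2Operator

/-! ### The conditional expectation onto the algebra -/

section Expectation

variable {n : ℕ}

instance : CompactSpace (Matrix.unitaryGroup (Fin n) ℂ) := by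
  refine isCompact_iff_compactSpace.mp (Metric.isCompact_of_isClosed_isBounded ?_ ?_)
  · exact isClosed_unitary
  · refine (Metric.isBounded_iff_subset_closedBall 0).mpr ⟨1, fun U hU => ?_⟩
    rw [mem_closedBall_zero_iff]
    rcases subsingleton_or_nontrivial (Matrix (Fin n) (Fin n) ℂ) with h | h
    · simp [Subsingleton.elim U 0]
    · exact (CStarRing.norm_of_mem_unitary hU).le

instance : MeasurableSpace (Matrix.unitaryGroup (Fin n) ℂ) := borel _

instance : BorelSpace (Matrix.unitaryGroup (Fin n) ℂ) := ⟨rfl⟩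

variable {A : Type u} [NonUnitalCStarAlgebra A]

/-- The averaging projection onto the algebra `A`, seen as an algebra of equivariant functions. -/
theorem RepSpace.exists_expectation (hA : IsHomogeneousCStarAlgebra n A)
    (hsep : ∀ a : A, a ≠ 0 → ∃ π : RepSpace n A, π a ≠ 0) :
    ∃ Φ : C(RepSpace n A, Matrix (Fin n) (Fin n) ℂ) →ₗ[ℂ] A,
      ∀ F, F 0 = 0 → transform n A (Φ F) = unitaryAverage F := by
  -- Subtracting F(0) makes Φ linear on all continuous functions; only its values on functions
  -- vanishing at 0 are used later.
  have h0 : ∀ F : C(RepSpace n A, Matrix (Fin n) (Fin n) ℂ),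
      (F - ContinuousMap.const _ (F 0) : C(RepSpace n A, Matrix (Fin n) (Fin n) ℂ)) 0 = 0 :=
    fun F => sub_self _
  have hex : ∀ F : C(RepSpace n A, Matrix (Fin n) (Fin n) ℂ), F 0 = 0 →
      ∃ a, transform n A a = unitaryAverage F := fun F hF =>
    exists_transform_eq hA hsep _ (unitaryAverage_apply_eq_zero hF smul_zero) fun U =>
      translate_eq_self_iff.mp (translate_unitaryAverage U F)
  choose Φ hΦ using fun F => hex _ (h0 F)
  have hinj := (isometry_transform hsep).injective
  refine ⟨{ toFun := Φ, map_add' := fun F G => hinj ?_, map_smul' := fun c F => hinj ?_ },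
    fun F hF => ?_⟩
  · rw [map_add, hΦ, hΦ, hΦ, ← map_add]
    congr 1
    ext1 π
    change F π + G π - (F 0 + G 0) = F π - F 0 + (G π - G 0)
    abel
  · rw [RingHom.id_apply, map_smul, hΦ, hΦ, ← map_smul]
    congr 1
    ext1 π
    change c • F π - c • F 0 = c • (F π - F 0)
    rw [smul_sub]
  · change transform n A (Φ F) = _
    rw [hΦ, hF]
    congr 1
    ext1 π
    exact sub_zero _

/-- The properties of the averaging projection of `RepSpace.exists_expectation`. -/
theorem RepSpace.exists_expectation_properties (hA : IsHomogeneousCStarAlgebra n A)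
    (hsep : ∀ a : A, a ≠ 0 → ∃ π : RepSpace n A, π a ≠ 0) :
    ∃ Φ : C(RepSpace n A, Matrix (Fin n) (Fin n) ℂ) →ₗ[ℂ] A,
      (∀ a, Φ (transform n A a) = a) ∧
      (∀ F C, F 0 = 0 → (∀ π, ‖F π‖ ≤ C) → ‖Φ F‖ ≤ C) ∧
      (∀ F, F 0 = 0 → Φ (star F) = star (Φ F)) ∧
      (∀ F a, F 0 = 0 → Φ (F * transform n A a) = Φ F * a) ∧
      (∀ F V, F 0 = 0 → Φ (translateFun V F) = Φ F) ∧
      ∀ (L : C(RepSpace n A, Matrix (Fin n) (Fin n) ℂ) →ₗ[ℂ] ℂ) (K : ℝ),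
        (∀ F C, (∀ π, ‖F π‖ ≤ C) → ‖L F‖ ≤ K * C) →
        ∀ F, F 0 = 0 → (∀ U, L (translateFun U F) = L F) → L F = L (transform n A (Φ F)) := by
  obtain ⟨Φ, hΦ⟩ := exists_expectation hA hsep
  have hinj := (isometry_transform hsep).injective
  have hinv : ∀ a (U : Matrix.unitaryGroup (Fin n) ℂ),
      translate U (transform n A a) = transform n A a := fun a U =>
    translate_eq_self_iff.mpr fun π => smul_apply U π a
  refine ⟨Φ, fun a => hinj ?_, fun F C hF hC => ?_, fun F hF => hinj ?_, fun F a hF => hinj ?_,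
    fun F V hF => hinj ?_, fun L K hL F hF hLF => ?_⟩
  · rw [hΦ _ (zero_apply a)]
    exact unitaryAverage_of_invariant (hinv a)
  · rw [← (AddMonoidHomClass.isometry_iff_norm _).mp (isometry_transform hsep) (Φ F), hΦ F hF]
    have h1 := norm_averageLinearMap_le F
    rw [one_mul] at h1
    exact h1.trans ((ContinuousMap.norm_le _ ((norm_nonneg _).trans (hC 0))).mpr hC)
  · rw [map_star (transform n A), hΦ F hF, hΦ _ (by rw [ContinuousMap.star_apply, hF, star_zero]),
      unitaryAverage_star]
  · rw [map_mul (transform n A), hΦ F hF, hΦ _ (by rw [ContinuousMap.mul_apply, hF, zero_mul]),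
      unitaryAverage_mul_of_invariant (hinv a)]
  · rw [hΦ F hF, hΦ _ (by rw [translateFun_apply, smul_zero, hF, mul_zero, zero_mul])]
    exact unitaryAverage_translate V F
  · rw [hΦ F hF]
    -- Boundedness lets `L` pass under the integral defining the average, where by invariance the
    -- integrand is constant.
    let L' : C(RepSpace n A, Matrix (Fin n) (Fin n) ℂ) →L[ℂ] ℂ :=
      L.mkContinuous K fun F => hL F ‖F‖ fun π => F.norm_coe_le_norm π
    exact (map_unitaryAverage_of_forall (E := ℂ) (L'.restrictScalars ℝ) hLF).symm

end Expectation

/-! ### The `n`-spectrum as a space of representations -/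

section Spectrum

variable {A : Type u} [NonUnitalCStarAlgebra A] {k : ℕ} {x : Fin k → A}

theorem generatedCStar_induction {P : generatedCStar x → Prop}
    (gen : ∀ j, P ⟨x j, mem_generatedCStar x j⟩) (zero : P 0)
    (add : ∀ a b, P a → P b → P (a + b)) (mul : ∀ a b, P a → P b → P (a * b))
    (smul : ∀ (c : ℂ) a, P a → P (c • a)) (star : ∀ a, P a → P (star a))
    (closed : IsClosed {a | P a}) (a : generatedCStar x) : P a := by
  have hmem : ∀ y (hy : y ∈ NonUnitalStarAlgebra.adjoin ℂ (Set.range x)),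
      P ⟨y, NonUnitalStarSubalgebra.le_topologicalClosure _ hy⟩ := by
    intro y hy
    induction hy using NonUnitalStarAlgebra.adjoin_induction with
    | mem y hy =>
      obtain ⟨j, rfl⟩ := hy
      exact gen j
    | add y z hy hz h1 h2 => exact add _ _ h1 h2
    | zero => exact zero
    | mul y z hy hz h1 h2 => exact mul _ _ h1 h2
    | smul c y hy h => exact smul c _ h
    | star y hy h => exact star _ h
  have h1 : a ∈ closure {b : generatedCStar x |
      (b : A) ∈ NonUnitalStarAlgebra.adjoin ℂ (Set.range x)} := by
    rw [closure_subtype]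
    have h2 : (a : A) ∈ closure (NonUnitalStarAlgebra.adjoin ℂ (Set.range x) : Set A) := a.2
    refine closure_mono (fun y hy => ?_) h2
    exact ⟨⟨y, NonUnitalStarSubalgebra.le_topologicalClosure _ hy⟩, hy, rfl⟩
  have h2 : {b : generatedCStar x | (b : A) ∈ NonUnitalStarAlgebra.adjoin ℂ (Set.range x)} ⊆
      {a | P a} := fun b hb => hmem b.1 hb
  exact closure_minimal h2 closed h1

variable {n : ℕ}

theorem RepSpace.ext_generators {π ρ : RepSpace n (generatedCStar x)}
    (h : ∀ j, π ⟨x j, mem_generatedCStar x j⟩ = ρ ⟨x j, mem_generatedCStar x j⟩) : π = ρ := by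
  refine DFunLike.ext _ _ fun a => ?_
  have hc : ∀ σ : RepSpace n (generatedCStar x), Continuous fun a => σ a := fun σ => by
    open scoped Matrix.Norms.L2Operator in
    exact AddMonoidHomClass.continuous_of_bound σ 1 fun a => by simpa using norm_apply_le σ a
  induction a using generatedCStar_induction with
  | gen j => exact h j
  | zero => rw [map_zero, map_zero]
  | add a b ha hb => rw [map_add, map_add, ha, hb]
  | mul a b ha hb => rw [map_mul, map_mul, ha, hb]
  | smul c a ha => rw [map_smul, map_smul, ha]
  | star a ha => rw [map_star, map_star, ha]
  | closed => exact isClosed_eq (hc π) (hc ρ)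

/-- The values of a representation on the generators. -/
def RepSpace.tuple (π : RepSpace n (generatedCStar x)) : Fin k → Matrix (Fin n) (Fin n) ℂ :=
  fun j => π ⟨x j, mem_generatedCStar x j⟩

/-- A continuous injection from a compact space to a Hausdorff space. It makes the topology of
pointwise convergence agree with the one inherited from matrix tuples. -/
theorem RepSpace.isClosedEmbedding_tuple :
    IsClosedEmbedding (RepSpace.tuple : RepSpace n (generatedCStar x) → _) :=
  (continuous_pi fun _ => continuous_eval _).isClosedEmbedding fun _ _ h =>
    ext_generators fun j => congrFun h j

/-- The representation that corresponds to a point of the `n`-spectrum. -/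
def nSpectrum.rep (t : nSpectrum n x) : RepSpace n (generatedCStar x) := t.2.choose

namespace nSpectrum

theorem rep_ne_zero (t : nSpectrum n x) : rep t ≠ 0 := t.2.choose_spec.1

theorem tuple_rep (t : nSpectrum n x) : (rep t).tuple = t.1 :=
  funext fun j => (t.2.choose_spec.2 j).symm

theorem rep_apply (t : nSpectrum n x) (j : Fin k) :
    rep t ⟨x j, mem_generatedCStar x j⟩ = t.1 j := congrFun (tuple_rep t) j

theorem range_rep :
    Set.range (rep : nSpectrum n x → RepSpace n (generatedCStar x)) = {0}ᶜ := by
  ext π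
  refine ⟨?_, fun h => ⟨⟨RepSpace.tuple π, π, h, fun j => rfl⟩,
    RepSpace.isClosedEmbedding_tuple.injective (tuple_rep _)⟩⟩
  rintro ⟨t, rfl⟩
  exact rep_ne_zero t

theorem isOpenEmbedding_rep :
    IsOpenEmbedding (rep : nSpectrum n x → RepSpace n (generatedCStar x)) := by
  refine ⟨?_, ?_⟩
  · rw [← RepSpace.isClosedEmbedding_tuple.isEmbedding.of_comp_iff]
    convert IsEmbedding.subtypeVal
    exact funext tuple_rep
  · rw [range_rep]
    exact isOpen_compl_singleton

theorem coe_mk_smul (U : Matrix.unitaryGroup (Fin n) ℂ) (t : nSpectrum n x) (j : Fin k) :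
    (ProjUnitary.mk n U • t).1 j = U * t.1 j * star (U : Matrix (Fin n) (Fin n) ℂ) := by
  change ProjUnitary.mk n U • t.1 j = _
  rw [mk_smul, conjMatrix]
  simp

theorem rep_mk_smul (U : Matrix.unitaryGroup (Fin n) ℂ) (t : nSpectrum n x) :
    rep (ProjUnitary.mk n U • t) = U • rep t := by
  refine RepSpace.ext_generators fun j => ?_
  rw [rep_apply, RepSpace.smul_apply, rep_apply, coe_mk_smul]

/-- The quotient homomorphism is open, so its product with the identity is a quotient map and
continuity may be tested on unitaries. -/
theorem continuous_smul : Continuous fun p : ProjUnitary n × nSpectrum n x => p.1 • p.2 := by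
  have hq : IsOpenQuotientMap (Prod.map (ProjUnitary.mk n) (id : nSpectrum n x → _)) :=
    IsOpenQuotientMap.prodMap (QuotientGroup.isOpenQuotientMap_mk (N := scalarUnitary n))
      IsOpenQuotientMap.id
  rw [hq.isQuotientMap.continuous_iff]
  refine Continuous.subtype_mk (continuous_pi fun j => ?_) _
  have h1 : Continuous fun p : Matrix.unitaryGroup (Fin n) ℂ × nSpectrum n x =>
    (p.1 : Matrix (Fin n) (Fin n) ℂ) := continuous_subtype_val.comp continuous_fst
  have h2 : Continuous fun p : Matrix.unitaryGroup (Fin n) ℂ × nSpectrum n x => p.2.1 j :=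
    (continuous_apply j).comp (continuous_subtype_val.comp continuous_snd)
  exact ((h1.mul h2).mul h1.star).congr fun p => (coe_mk_smul p.1 p.2 j).symm

/-- A unitary fixing a point commutes with the range of the corresponding representation, which is
the whole matrix algebra, so it is scalar. -/
theorem free (hx : IsHomogeneousSystem n x) (hn : 1 ≤ n) (u : ProjUnitary n) (t : nSpectrum n x)
    (h : u • t = t) : u = 1 := by
  obtain ⟨U, rfl⟩ := mk_surjective n u
  have h1 : U • rep t = rep t := by rw [← rep_mk_smul, h]
  have h2 : ∀ B : Matrix (Fin n) (Fin n) ℂ, Commute B (U : Matrix (Fin n) (Fin n) ℂ) := by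
    intro B
    obtain ⟨a, rfl⟩ := RepSpace.surjective hx (rep_ne_zero t) B
    have h3 := RepSpace.smul_apply U (rep t) a
    rw [h1] at h3
    have h4 : star (U : Matrix (Fin n) (Fin n) ℂ) * U = 1 := U.2.1
    change rep t a * U = U * rep t a
    conv_lhs => rw [h3]
    rw [mul_assoc, h4, mul_one]
  obtain ⟨c, hc⟩ := Matrix.mem_range_scalar_of_commute_single fun i j _ => h2 (Matrix.single i j 1)
  have hc' : (U : Matrix (Fin n) (Fin n) ℂ) = c • 1 := by
    rw [← hc, Matrix.scalar_apply, Matrix.smul_one_eq_diagonal]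
  have h5 : (U : Matrix (Fin n) (Fin n) ℂ) * star (U : Matrix (Fin n) (Fin n) ℂ) = 1 := U.2.2
  -- A diagonal entry is read off here, which requires `1 ≤ n`.
  have h6 : c * star c = 1 := by
    have := congrFun (congrFun h5 ⟨0, hn⟩) ⟨0, hn⟩
    rw [hc'] at this
    simpa [mul_comm] using this
  have hcirc : ‖c‖ = 1 := by
    have h7 := congrArg norm h6
    rw [norm_mul, norm_star, norm_one] at h7
    nlinarith [norm_nonneg c]
  refine (QuotientGroup.eq_one_iff U).mpr ⟨⟨c, ?_⟩, hc'⟩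
  simpa [Submonoid.unitSphere] using hcirc

/-- The `n`-spectrum of an `n`-homogeneous system is an `n`-space. -/
theorem isNSpace (hx : IsHomogeneousSystem n x) (hn : 1 ≤ n) : IsNSpace n (nSpectrum n x) where
  locallyCompact := isOpenEmbedding_rep.locallyCompactSpace
  t2 := inferInstance
  continuous_smul := continuous_smul
  free := free hx hn

end nSpectrum

end Spectrum

/-! ### Equivariance of integrals -/

section Equivariance

theorem conj_unitary_apply {n : ℕ} (U : Matrix.unitaryGroup (Fin n) ℂ)
    (B : Matrix (Fin n) (Fin n) ℂ) (j k : Fin n) :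
    (U * B * star (U : Matrix (Fin n) (Fin n) ℂ)) j k =
      ∑ p, ∑ q, ((U : Matrix (Fin n) (Fin n) ℂ) j p * star (U : Matrix (Fin n) (Fin n) ℂ) q k) *
        B p q := by
  simp only [Matrix.mul_apply, Finset.sum_mul]
  rw [Finset.sum_comm]
  exact Finset.sum_congr rfl fun p _ => Finset.sum_congr rfl fun q _ => by ring

theorem mk_smul_apply {n : ℕ} {B : Type*} [Ring B] [Algebra ℂ B]
    (U : Matrix.unitaryGroup (Fin n) ℂ) (M : Matrix (Fin n) (Fin n) B) (j k : Fin n) :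
    (ProjUnitary.mk n U • M) j k =
      ∑ p, ∑ q, ((U : Matrix (Fin n) (Fin n) ℂ) j p * star (U : Matrix (Fin n) (Fin n) ℂ) q k) •
        M p q := by
  rw [mk_smul, conjMatrix, Matrix.UnitaryGroup.inv_val]
  simp only [Matrix.mul_apply, Finset.sum_mul, Matrix.map_apply]
  rw [Finset.sum_comm]
  refine Finset.sum_congr rfl fun p _ => Finset.sum_congr rfl fun q _ => ?_
  rw [← Algebra.smul_def, mul_comm, mul_smul, smul_mul_assoc, ← Algebra.commutes, ← Algebra.smul_def]
  rw [smul_comm]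

theorem mk_smul_matrix {n : ℕ} (U : Matrix.unitaryGroup (Fin n) ℂ)
    (M : Matrix (Fin n) (Fin n) ℂ) :
    ProjUnitary.mk n U • M = U * M * star (U : Matrix (Fin n) (Fin n) ℂ) := by
  ext j k
  rw [mk_smul_apply, conj_unitary_apply]
  rfl

variable {n : ℕ} {X : Type*} [MeasurableSpace X] [MulAction (ProjUnitary n) X] {H : Type*}
  [NormedAddCommGroup H] [InnerProductSpace ℂ H]

theorem complexIntegral_indicator_one (μ : ComplexMeasure X) {A : Set X} (hA : MeasurableSet A) :
    complexIntegral μ (A.indicator 1) = μ A :=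
  (complexIntegral_indicator μ hA 1).trans (one_mul _)

theorem indicator_comp_inv_smul {X : Type*} [MulAction (ProjUnitary n) X] (u : ProjUnitary n) (A : Set X) :
    (A.indicator (1 : X → ℂ)) ∘ (fun x => u⁻¹ • x) = (u • A).indicator 1 := by
  ext x
  rw [Function.comp_apply]
  by_cases hx : u⁻¹ • x ∈ A
  · rw [Set.indicator_of_mem hx, Set.indicator_of_mem (Set.mem_smul_set_iff_inv_smul_mem.mpr hx),
      Pi.one_apply, Pi.one_apply]
  · rw [Set.indicator_of_notMem hx,
      Set.indicator_of_notMem fun h => hx (Set.mem_smul_set_iff_inv_smul_mem.mp h)]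

/-- For indicators this is the equivariance of `E` on sets; bounded limits give the rest. -/
theorem complexIntegral_comp_inv_smul (E : OperatorNMeasure n X H)
    (hm : ∀ u : ProjUnitary n, Measurable fun x : X => u • x) (U : Matrix.unitaryGroup (Fin n) ℂ)
    (h w : H) (j k : Fin n) {f : X → ℂ} (hf : IsBoundedMeasurable f) :
    complexIntegral ((E.entry j k).scalar h w) (f ∘ fun x => (ProjUnitary.mk n U)⁻¹ • x) =
      ∑ p, ∑ q, ((U : Matrix (Fin n) (Fin n) ℂ) j p * star (U : Matrix (Fin n) (Fin n) ℂ) q k) *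
        complexIntegral ((E.entry p q).scalar h w) f := by
  have h1 : IsBoundedlyContinuous fun f : X → ℂ =>
      complexIntegral ((E.entry j k).scalar h w) (f ∘ fun x => (ProjUnitary.mk n U)⁻¹ • x) :=
    (isBoundedlyContinuous_complexIntegral _).comp_measurable (hm _)
  have h2 : IsBoundedlyContinuous fun f : X → ℂ =>
      ∑ p, ∑ q, ((U : Matrix (Fin n) (Fin n) ℂ) j p * star (U : Matrix (Fin n) (Fin n) ℂ) q k) *
        complexIntegral ((E.entry p q).scalar h w) f :=
    .sum _ fun p _ => .sum _ fun q _ => (isBoundedlyContinuous_complexIntegral _).const_mul _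
  refine (h1.isBoundedlyClosed h2).of_indicator (fun A hA => ?_) hf
  have hA' : MeasurableSet (ProjUnitary.mk n U • A) := by
    rw [← Set.preimage_smul_inv]
    exact hm _ hA
  simp only [indicator_comp_inv_smul, complexIntegral_indicator_one _ hA,
    complexIntegral_indicator_one _ hA']
  change ⟪w, (E.entry j k).toFun (ProjUnitary.mk n U • A) h⟫_ℂ = _
  have h3 := congrFun (congrFun (E.equivariant (ProjUnitary.mk n U) A hA) j) k
  rw [mk_smul_apply] at h3
  rw [Matrix.of_apply] at h3
  rw [h3]
  simp only [sum_apply, inner_sum, smul_apply, inner_smul_right, Matrix.of_apply]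
  rfl

/-- The pairing of f_{jk} with E_{kj} is a trace, so conjugating the function by `U` cancels against
the conjugation that translation produces in `E`. -/
theorem OperatorNMeasure.integral_conj_comp [CompleteSpace H] (E : OperatorNMeasure n X H)
    (hm : ∀ u : ProjUnitary n, Measurable fun x : X => u • x) (U : Matrix.unitaryGroup (Fin n) ℂ)
    {f : X → Matrix (Fin n) (Fin n) ℂ} (hf : IsBoundedMeasurableMatrix f) :
    E.integral (fun x => U * f ((ProjUnitary.mk n U)⁻¹ • x) *
      star (U : Matrix (Fin n) (Fin n) ℂ)) = E.integral f := by
  have hsum : ∀ j k, (fun x => (U * f ((ProjUnitary.mk n U)⁻¹ • x) *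
      star (U : Matrix (Fin n) (Fin n) ℂ)) j k) = ∑ p, ∑ q,
        ((U : Matrix (Fin n) (Fin n) ℂ) j p * star (U : Matrix (Fin n) (Fin n) ℂ) q k) •
          ((fun x => f x p q) ∘ fun x => (ProjUnitary.mk n U)⁻¹ • x) := by
    intro j k
    ext x
    rw [conj_unitary_apply]
    simp only [Finset.sum_apply, Pi.smul_apply, smul_eq_mul, Function.comp_apply]
  have hb : ∀ p q, IsBoundedMeasurable
      ((fun x => f x p q) ∘ fun x => (ProjUnitary.mk n U)⁻¹ • x) := fun p q =>
    (hf p q).comp (hm _)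
  have hf' : IsBoundedMeasurableMatrix fun x => (U : Matrix (Fin n) (Fin n) ℂ) *
      f ((ProjUnitary.mk n U)⁻¹ • x) * star (U : Matrix (Fin n) (Fin n) ℂ) := by
    intro j k
    rw [hsum]
    exact isBoundedMeasurable_sum _ fun p _ => isBoundedMeasurable_sum _ fun q _ =>
      (hb p q).const_smul _
  refine ContinuousLinearMap.ext fun h => ext_inner_left ℂ fun w => ?_
  rw [E.inner_integral hf', E.inner_integral hf]
  -- Entry (a, b) of `I p q` is the integral of f_{pq} against E_{ab}. For fixed p, q the sum over
  -- j, k reassembles into entry (q, p) of U*(U I U*)U = I.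
  let I : Fin n → Fin n → Matrix (Fin n) (Fin n) ℂ := fun p q =>
    Matrix.of fun a b => complexIntegral ((E.entry a b).scalar h w) fun x => f x p q
  have hterm : ∀ j k, (complexIntegral ((E.entry k j).scalar h w) fun x =>
      ((U : Matrix (Fin n) (Fin n) ℂ) * f ((ProjUnitary.mk n U)⁻¹ • x) *
        star (U : Matrix (Fin n) (Fin n) ℂ)) j k) =
      ∑ p, ∑ q, ((U : Matrix (Fin n) (Fin n) ℂ) j p * star (U : Matrix (Fin n) (Fin n) ℂ) q k) *
        ((U : Matrix (Fin n) (Fin n) ℂ) * I p q * star (U : Matrix (Fin n) (Fin n) ℂ)) k j := by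
    intro j k
    have hc := isBoundedlyContinuous_complexIntegral ((E.entry k j).scalar h w)
    rw [hsum, hc.map_sum _ fun p _ => isBoundedMeasurable_sum _ fun q _ => (hb p q).const_smul _]
    refine Finset.sum_congr rfl fun p _ => ?_
    rw [hc.map_sum _ fun q _ => (hb p q).const_smul _]
    refine Finset.sum_congr rfl fun q _ => ?_
    rw [hc.smul _ _ (hb p q), complexIntegral_comp_inv_smul E hm U h w k j (hf p q),
      conj_unitary_apply]
    rfl
  simp only [hterm]
  have hswap : ∀ g : Fin n → Fin n → Fin n → Fin n → ℂ,
      ∑ j, ∑ k, ∑ p, ∑ q, g j k p q = ∑ p, ∑ q, ∑ j, ∑ k, g j k p q := by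
    intro g
    calc _ = ∑ j, ∑ p, ∑ k, ∑ q, g j k p q := Finset.sum_congr rfl fun j _ => Finset.sum_comm
      _ = ∑ p, ∑ j, ∑ k, ∑ q, g j k p q := Finset.sum_comm
      _ = ∑ p, ∑ j, ∑ q, ∑ k, g j k p q := Finset.sum_congr rfl fun p _ =>
        Finset.sum_congr rfl fun j _ => Finset.sum_comm
      _ = _ := Finset.sum_congr rfl fun p _ => Finset.sum_comm
  rw [hswap]
  refine Finset.sum_congr rfl fun p _ => Finset.sum_congr rfl fun q _ => ?_
  have h1 : star (U : Matrix (Fin n) (Fin n) ℂ) * U = 1 := U.2.1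
  have h2 : star (U : Matrix (Fin n) (Fin n) ℂ) * (U * I p q * star (U : Matrix (Fin n) (Fin n) ℂ))
      * U = I p q := by
    rw [mul_assoc, mul_assoc, mul_assoc, h1, mul_one, ← mul_assoc, h1, one_mul]
  have h3 := congrFun (congrFun h2 q) p
  change _ = I p q q p
  rw [← h3]
  rw [Matrix.mul_apply]
  refine Finset.sum_congr rfl fun j _ => ?_
  rw [Matrix.mul_apply, Finset.sum_mul]
  exact Finset.sum_congr rfl fun k _ => by ring

end Equivariance

open scoped Matrix.Norms.L2Operator

/-! ### Measures and integrals on the `n`-spectrum -/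

section SpectrumIntegral

namespace nSpectrum

variable {A : Type u} [NonUnitalCStarAlgebra A] {k : ℕ} {x : Fin k → A} {n : ℕ}

theorem measurable_smul (u : ProjUnitary n) : Measurable fun t : nSpectrum n x => u • t :=
  (continuous_smul.comp (Continuous.prodMk_right u)).measurable

theorem isBoundedMeasurable_comp_rep (g : C(RepSpace n (generatedCStar x), ℂ)) :
    IsBoundedMeasurable fun t : nSpectrum n x => g (rep t) :=
  ⟨(g.continuous.comp isOpenEmbedding_rep.continuous).measurable, ‖g‖, fun t =>
    g.norm_coe_le_norm (rep t)⟩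

theorem isBoundedMeasurableMatrix_comp_rep
    (F : C(RepSpace n (generatedCStar x), Matrix (Fin n) (Fin n) ℂ)) :
    IsBoundedMeasurableMatrix fun t : nSpectrum n x => F (rep t) := fun j l =>
  isBoundedMeasurable_comp_rep ⟨fun π => F π j l, F.continuous.matrix_elem j l⟩

theorem rep_inv_smul (U : Matrix.unitaryGroup (Fin n) ℂ) (t : nSpectrum n x) :
    rep ((ProjUnitary.mk n U)⁻¹ • t) = U⁻¹ • rep t := by
  rw [← map_inv, rep_mk_smul]

theorem isBoundedBorelEquivariant_rep (a : generatedCStar x) :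
    IsBoundedBorelEquivariant fun t : nSpectrum n x => rep t a := by
  have h := isBoundedMeasurableMatrix_comp_rep (RepSpace.transform n (generatedCStar x) a)
  refine ⟨fun j l => (h j l).1, ?_, fun u t => ?_⟩
  · choose C hC using fun j l => (h j l).2
    refine ⟨∑ j, ∑ l, |C j l|, fun t j l => ?_⟩
    refine ((hC j l t).trans (le_abs_self _)).trans ?_
    refine (Finset.single_le_sum (f := fun l => |C j l|) (fun _ _ => abs_nonneg _)
      (Finset.mem_univ l)).trans ?_
    exact Finset.single_le_sum (f := fun j => ∑ l, |C j l|)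
      (fun _ _ => Finset.sum_nonneg fun _ _ => abs_nonneg _) (Finset.mem_univ j)
  · obtain ⟨U, rfl⟩ := mk_surjective n u
    rw [rep_mk_smul, RepSpace.smul_apply, mk_smul_matrix]

theorem tuple_zero : RepSpace.tuple (0 : RepSpace n (generatedCStar x)) = 0 := rfl

theorem coe_ne_zero (t : nSpectrum n x) : t.1 ≠ 0 := by
  rw [← tuple_rep, ← tuple_zero (x := x)]
  exact fun h => rep_ne_zero t (RepSpace.isClosedEmbedding_tuple.injective h)

/-- The spectrum sits in the metric space of matrix tuples and avoids the zero tuple. Continuous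
functions of tuples vanishing there become continuous functions on `RepSpace` vanishing at the zero
representation. -/
theorem of_continuous {P : (nSpectrum n x → ℂ) → Prop} (hP : IsBoundedlyClosed P)
    (h : ∀ g : C(RepSpace n (generatedCStar x), ℂ), g 0 = 0 → P fun t => g (rep t))
    {f : nSpectrum n x → ℂ} (hf : IsBoundedMeasurable f) : P f := by
  refine hP.of_continuous (E := Fin k → Matrix (Fin n) (Fin n) ℂ) (i := Subtype.val) (z := 0)
    IsInducing.subtypeVal coe_ne_zero (fun g hg => ?_) hf
  convert h ⟨fun π => g π.tuple, g.continuous.comp RepSpace.isClosedEmbedding_tuple.continuous⟩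
    hg using 1
  ext t
  exact congrArg g (tuple_rep t).symm

theorem matrix_ext {L L' : Fin n → Fin n → (nSpectrum n x → ℂ) → ℂ}
    (hL : ∀ j l, IsBoundedlyContinuous (L j l)) (hL' : ∀ j l, IsBoundedlyContinuous (L' j l))
    (h : ∀ F : C(RepSpace n (generatedCStar x), Matrix (Fin n) (Fin n) ℂ), F 0 = 0 →
      ∑ j, ∑ l, L j l (fun t => F (rep t) j l) = ∑ j, ∑ l, L' j l (fun t => F (rep t) j l))
    (j l : Fin n) {f : nSpectrum n x → ℂ} (hf : IsBoundedMeasurable f) : L j l f = L' j l f := by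
  refine IsBoundedlyContinuous.matrix_ext (E := Fin k → Matrix (Fin n) (Fin n) ℂ)
    (i := Subtype.val) (z := 0) IsInducing.subtypeVal coe_ne_zero hL hL' (fun F hF => ?_) j l hf
  have := h ⟨fun π => F π.tuple, F.continuous.comp RepSpace.isClosedEmbedding_tuple.continuous⟩ hF
  simpa only [ContinuousMap.coe_mk, tuple_rep] using this

/-- A locally compact subspace of a finite-dimensional space is σ-compact and metrizable, so finite
Borel measures on it are regular. -/
theorem regular (μ : Measure (nSpectrum n x)) [IsFiniteMeasure μ] : μ.Regular := by
  have : LocallyCompactSpace (nSpectrum n x) := isOpenEmbedding_rep.locallyCompactSpace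
  infer_instance

variable {H : Type*} [NormedAddCommGroup H] [InnerProductSpace ℂ H] [CompleteSpace H]

/-- Integrals of functions on the space of representations are invariant under translation. -/
theorem integral_translateFun (E : OperatorNMeasure n (nSpectrum n x) H)
    (f : nSpectrum n x → Matrix (Fin n) (Fin n) ℂ) (hf : IsBoundedMeasurableMatrix f)
    (hfe : ∀ (U : Matrix.unitaryGroup (Fin n) ℂ) t,
      f (ProjUnitary.mk n U • t) = U * f t * star (U : Matrix (Fin n) (Fin n) ℂ))
    (U : Matrix.unitaryGroup (Fin n) ℂ)
    (F : C(RepSpace n (generatedCStar x), Matrix (Fin n) (Fin n) ℂ)) :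
    E.integral (fun t => f t * translateFun U F (rep t)) =
      E.integral fun t => f t * F (rep t) := by
  rw [← E.integral_conj_comp measurable_smul U (hf.mul (isBoundedMeasurableMatrix_comp_rep F))]
  congr 1
  ext1 t
  have h1 := hfe U ((ProjUnitary.mk n U)⁻¹ • t)
  rw [smul_inv_smul] at h1
  have h2 : star (U : Matrix (Fin n) (Fin n) ℂ) * U = 1 := U.2.1
  rw [h1, translateFun_apply, rep_inv_smul]
  simp only [mul_assoc]
  rw [← mul_assoc (star _) (U : Matrix (Fin n) (Fin n) ℂ), h2, one_mul]

end nSpectrum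

end SpectrumIntegral

open scoped Matrix.Norms.L2Operator

/-! ### Averaging under the integral, and determination of the measure by the algebra -/

section Uniqueness

theorem norm_entry_le_l2_opNorm {n : ℕ} (B : Matrix (Fin n) (Fin n) ℂ) (j l : Fin n) :
    ‖B j l‖ ≤ ‖B‖ := by
  have h1 := Matrix.l2_opNorm_mulVec B (EuclideanSpace.single l 1)
  rw [PiLp.norm_single, norm_one, mul_one] at h1
  refine le_trans ?_ h1
  refine le_trans (le_of_eq ?_) (PiLp.norm_apply_le _ j)
  simp

namespace nSpectrum

variable {H : Type u} [NormedAddCommGroup H] [InnerProductSpace ℂ H] [CompleteSpace H]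

section General

variable {A : Type u} [NonUnitalCStarAlgebra A] {k : ℕ} {x : Fin k → A} {n : ℕ}

/-- The constant combines the bounds on the entries of `f` with the total variations. It supplies
the continuity needed to move such functionals under the average over the unitary group. -/
theorem exists_norm_inner_integral_le (E : OperatorNMeasure n (nSpectrum n x) H)
    {f : nSpectrum n x → Matrix (Fin n) (Fin n) ℂ} (hf : IsBoundedMeasurableMatrix f) (h w : H) :
    ∃ K, ∀ (F : C(RepSpace n (generatedCStar x), Matrix (Fin n) (Fin n) ℂ)) (C : ℝ),
      (∀ π, ‖F π‖ ≤ C) → ‖⟪w, E.integral (fun t => f t * F (rep t)) h⟫_ℂ‖ ≤ K * C := by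
  choose D hD using fun j l => (hf j l).2
  let V : Fin n → Fin n → ℝ := fun j l =>
    ‖ContinuousLinearMap.mul ℝ ℂ‖ * ((E.entry l j).scalar h w).variation.real Set.univ
  refine ⟨∑ j, ∑ l, (∑ p, D j p) * V j l, fun F C hC => ?_⟩
  rw [E.inner_integral (hf.mul (isBoundedMeasurableMatrix_comp_rep F)), Finset.sum_mul]
  refine norm_sum_le_of_le _ fun j _ => ?_
  rw [Finset.sum_mul]
  refine norm_sum_le_of_le _ fun l _ => ?_
  rw [mul_right_comm]
  refine norm_complexIntegral_le _ fun t => ?_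
  rw [Matrix.mul_apply, Finset.sum_mul]
  refine norm_sum_le_of_le _ fun p _ => ?_
  rw [norm_mul]
  exact mul_le_mul (hD j p t) ((norm_entry_le_l2_opNorm _ _ _).trans (hC _)) (norm_nonneg _)
    ((norm_nonneg _).trans (hD j p t))

/-- Integrals of equivariant functions do not change under averaging. -/
theorem integral_mul_expectation
    {Φ : C(RepSpace n (generatedCStar x), Matrix (Fin n) (Fin n) ℂ) →ₗ[ℂ] generatedCStar x}
    (hΦ : ∀ (L : C(RepSpace n (generatedCStar x), Matrix (Fin n) (Fin n) ℂ) →ₗ[ℂ] ℂ) (K : ℝ),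
      (∀ F C, (∀ π, ‖F π‖ ≤ C) → ‖L F‖ ≤ K * C) → ∀ F, F 0 = 0 →
      (∀ U, L (translateFun U F) = L F) →
      L F = L (RepSpace.transform n (generatedCStar x) (Φ F)))
    (E : OperatorNMeasure n (nSpectrum n x) H)
    {f : nSpectrum n x → Matrix (Fin n) (Fin n) ℂ} (hf : IsBoundedMeasurableMatrix f)
    (hfe : ∀ (U : Matrix.unitaryGroup (Fin n) ℂ) t,
      f (ProjUnitary.mk n U • t) = U * f t * star (U : Matrix (Fin n) (Fin n) ℂ))
    {F : C(RepSpace n (generatedCStar x), Matrix (Fin n) (Fin n) ℂ)} (hF : F 0 = 0) :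
    E.integral (fun t => f t * F (rep t)) = E.integral fun t => f t * rep t (Φ F) := by
  refine ContinuousLinearMap.ext fun h => ext_inner_left ℂ fun w => ?_
  obtain ⟨K, hK⟩ := exists_norm_inner_integral_le E hf h w
  have hb := fun F : C(RepSpace n (generatedCStar x), Matrix (Fin n) (Fin n) ℂ) =>
    hf.mul (isBoundedMeasurableMatrix_comp_rep F)
  let L : C(RepSpace n (generatedCStar x), Matrix (Fin n) (Fin n) ℂ) →ₗ[ℂ] ℂ :=
    { toFun := fun F => ⟪w, E.integral (fun t => f t * F (rep t)) h⟫_ℂ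
      map_add' := fun F G => by
        simp only [ContinuousMap.add_apply, mul_add]
        rw [E.integral_add (hb F) (hb G), add_apply, inner_add_right]
      map_smul' := fun c F => by
        simp only [ContinuousMap.smul_apply, mul_smul_comm]
        rw [E.integral_smul c (hb F), smul_apply, inner_smul_right]
        rfl }
  refine hΦ L K hK F hF fun U => ?_
  change ⟪w, E.integral (fun t => f t * translateFun U F (rep t)) h⟫_ℂ = _
  rw [integral_translateFun E f hf hfe]
  rfl

theorem isBoundedMeasurableMatrix_const {X : Type*} [MeasurableSpace X]
    (B : Matrix (Fin n) (Fin n) ℂ) : IsBoundedMeasurableMatrix fun _ : X => B :=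
  fun _ _ => isBoundedMeasurable_const _

/-- Matrix units isolate the entries of `E`, and a bounded complex-measure integral is fixed by its
values on continuous functions vanishing at the removed point. -/
theorem ext_of_integral_eq {E E' : OperatorNMeasure n (nSpectrum n x) H}
    (hE : ∀ F : C(RepSpace n (generatedCStar x), Matrix (Fin n) (Fin n) ℂ), F 0 = 0 →
      E.integral (fun t => F (rep t)) = E'.integral fun t => F (rep t)) : E = E' := by
  refine OperatorNMeasure.ext (funext fun j => funext fun l =>
    OperatorMeasure.ext_of_integral fun f hf =>
      ContinuousLinearMap.ext fun h => ext_inner_left ℂ fun w => ?_)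
  rw [OperatorMeasure.inner_integral _ hf, OperatorMeasure.inner_integral _ hf]
  refine matrix_ext (L := fun l j => complexIntegral ((E.entry j l).scalar h w))
    (L' := fun l j => complexIntegral ((E'.entry j l).scalar h w))
    (fun _ _ => isBoundedlyContinuous_complexIntegral _)
    (fun _ _ => isBoundedlyContinuous_complexIntegral _) (fun F hF => ?_) l j hf
  rw [← E.inner_integral (isBoundedMeasurableMatrix_comp_rep F), hE F hF,
    E'.inner_integral (isBoundedMeasurableMatrix_comp_rep F)]

end General

variable {k n : ℕ} {T : Fin k → H →L[ℂ] H}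

theorem exists_rep_ne_zero (hT : IsHomogeneousSystem n T) (a : generatedCStar T) (ha : a ≠ 0) :
    ∃ π : RepSpace n (generatedCStar T), π a ≠ 0 :=
  exists_matrixRep_ne_zero hT (NonUnitalStarSubalgebraClass.subtype (generatedCStar T))
    fun h => ha (Subtype.ext h)

/-- A spectral measure that represents the generators represents the whole algebra. -/
theorem integral_rep_of_isSpectral {E : OperatorNMeasure n (nSpectrum n T) H} (hE : E.IsSpectral)
    (hT : ∀ j, E.integral (coordProj n T j) = T j) (a : generatedCStar T) :
    E.integral (fun t => rep t a) = (a : H →L[ℂ] H) := by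
  have hb : ∀ a : generatedCStar T, IsBoundedMeasurableMatrix fun t : nSpectrum n T => rep t a :=
    fun a => isBoundedMeasurableMatrix_comp_rep (RepSpace.transform n (generatedCStar T) a)
  induction a using generatedCStar_induction with
  | gen j =>
    refine Eq.trans ?_ (hT j)
    congr 1
    exact funext fun t => rep_apply t j
  | zero =>
    have h := E.integral_smul 0 (hb 0)
    simpa using h
  | add a b ha hb' =>
    simp only [map_add]
    rw [E.integral_add (hb a) (hb b), ha, hb']
    rfl
  | mul a b ha hb' =>
    simp only [map_mul]
    rw [hE.integral_mul _ _ (isBoundedBorelEquivariant_rep a) (isBoundedBorelEquivariant_rep b),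
      ha, hb']
    rfl
  | smul c a ha =>
    simp only [map_smul]
    rw [E.integral_smul c (hb a), ha]
    rfl
  | star a ha =>
    simp only [map_star, Matrix.star_eq_conjTranspose]
    rw [← hE.integral_star _ (isBoundedBorelEquivariant_rep a), ha]
    rfl
  | closed =>
    -- Representations are contractive, so a bound for the convergent sequence dominates all the
    -- integrands, and dominated convergence applies entrywise.
    refine IsSeqClosed.isClosed fun a b ha hab => ?_
    rw [Set.mem_ofPred_eq]
    refine ContinuousLinearMap.ext fun h => ext_inner_left ℂ fun w => ?_
    have h1 : Tendsto (fun m => ⟪w, (a m : H →L[ℂ] H) h⟫_ℂ) atTop (𝓝 ⟪w, (b : H →L[ℂ] H) h⟫_ℂ) := by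
      have : Continuous fun S : H →L[ℂ] H => ⟪w, S h⟫_ℂ := by fun_prop
      exact (this.tendsto _).comp ((continuous_subtype_val.tendsto b).comp hab)
    refine tendsto_nhds_unique ?_ h1
    obtain ⟨C, hC⟩ := (hab.norm).bddAbove_range
    have h2 : ∀ m, ⟪w, (a m : H →L[ℂ] H) h⟫_ℂ =
        ∑ j, ∑ l, complexIntegral ((E.entry l j).scalar h w) fun t => rep t (a m) j l := fun m => by
      rw [← ha m, E.inner_integral (hb (a m))]
    simp only [h2]
    rw [E.inner_integral (hb b)]
    refine tendsto_finsetSum _ fun j _ => tendsto_finsetSum _ fun l _ => ?_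
    refine complexIntegral_tendsto (C := C) _ (fun m => (hb (a m) j l).1) (fun m t => ?_)
      fun t => ?_
    · exact ((norm_entry_le_l2_opNorm _ _ _).trans (RepSpace.norm_apply_le _ _)).trans
        (hC ⟨m, rfl⟩)
    · have hc : Continuous fun a => rep t a :=
        AddMonoidHomClass.continuous_of_bound (rep t) 1 fun a => by
          simpa using RepSpace.norm_apply_le (rep t) a
      exact ((hc.matrix_elem j l).tendsto b).comp hab

end nSpectrum

end Uniqueness

open scoped Matrix.Norms.L2Operator

/-! ### Construction of the operator-valued measure -/

section Existence

namespace nSpectrum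

section Tensor

variable {A : Type*} [NonUnitalCStarAlgebra A] {n : ℕ}

/-- The function `π ↦ (g π - g 0) B` for a scalar function `g` and a matrix `B`. -/
def tensor (B : Matrix (Fin n) (Fin n) ℂ) :
    C(RepSpace n A, ℂ) →ₗ[ℂ] C(RepSpace n A, Matrix (Fin n) (Fin n) ℂ) where
  toFun g := ⟨fun π => (g π - g 0) • B, (g.continuous.sub continuous_const).smul continuous_const⟩
  map_add' f g := by
    ext1 π
    change (f π + g π - (f 0 + g 0)) • B = (f π - f 0) • B + (g π - g 0) • B
    rw [← add_smul]
    congr 1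
    ring
  map_smul' c g := by
    ext1 π
    change (c * g π - c * g 0) • B = c • (g π - g 0) • B
    rw [← mul_sub, mul_smul]

theorem tensor_apply (B : Matrix (Fin n) (Fin n) ℂ) (g : C(RepSpace n A, ℂ)) (π : RepSpace n A) :
    tensor B g π = (g π - g 0) • B := rfl

theorem tensor_apply_zero (B : Matrix (Fin n) (Fin n) ℂ) (g : C(RepSpace n A, ℂ)) :
    tensor B g 0 = 0 := by
  rw [tensor_apply, sub_self, zero_smul]

theorem norm_tensor_apply_le (B : Matrix (Fin n) (Fin n) ℂ) (g : C(RepSpace n A, ℂ))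
    (π : RepSpace n A) : ‖tensor B g π‖ ≤ 2 * ‖B‖ * ‖g‖ := by
  rw [tensor_apply, norm_smul, mul_assoc, mul_left_comm, mul_comm, two_mul]
  refine mul_le_mul_of_nonneg_left ((norm_sub_le _ _).trans ?_) (norm_nonneg _)
  exact add_le_add (g.norm_coe_le_norm _) (g.norm_coe_le_norm _)

theorem eq_sum_tensor (F : C(RepSpace n A, Matrix (Fin n) (Fin n) ℂ)) (hF : F 0 = 0) :
    F = ∑ j, ∑ l, tensor (Matrix.single j l 1)
      ⟨fun π => F π j l, F.continuous.matrix_elem j l⟩ := by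
  ext1 π
  simp only [ContinuousMap.sum_apply, tensor_apply, ContinuousMap.coe_mk, hF, Matrix.zero_apply,
    sub_zero, Matrix.smul_single, smul_eq_mul, mul_one]
  exact Matrix.matrix_eq_sum_single (F π)

/-- The sum over p, q is `g` times the matrix U* e_{lj} U, and translation by `U` conjugates it back
to e_{lj}. Invariance of Φ under translations thereby becomes the equivariance of the entry
measures. -/
theorem tensor_single_comp_inv_smul (U : Matrix.unitaryGroup (Fin n) ℂ) (j l : Fin n)
    (g g' : C(RepSpace n A, ℂ)) (hg : ∀ π, g' π = g (U⁻¹ • π)) :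
    tensor (Matrix.single l j 1) g' = translateFun U (∑ p, ∑ q,
      ((U : Matrix (Fin n) (Fin n) ℂ) j p * star (U : Matrix (Fin n) (Fin n) ℂ) q l) •
        tensor (Matrix.single q p 1) g) := by
  have hN : ∑ p, ∑ q, ((U : Matrix (Fin n) (Fin n) ℂ) j p *
      star (U : Matrix (Fin n) (Fin n) ℂ) q l) • Matrix.single q p (1 : ℂ) =
      star (U : Matrix (Fin n) (Fin n) ℂ) * Matrix.single l j 1 *
        (U : Matrix (Fin n) (Fin n) ℂ) := by
    rw [Finset.sum_comm, Matrix.matrix_eq_sum_single (_ * _ * _)]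
    refine Finset.sum_congr rfl fun q _ => Finset.sum_congr rfl fun p _ => ?_
    rw [Matrix.smul_single, smul_eq_mul, mul_one]
    congr 1
    rw [Matrix.mul_apply, Finset.sum_eq_single j, Matrix.mul_single_apply_same, mul_one, mul_comm]
    · intro b _ hb
      rw [Matrix.mul_single_apply_of_ne _ _ _ _ _ hb, zero_mul]
    · exact fun h => (h (Finset.mem_univ j)).elim
  have h : (U : Matrix (Fin n) (Fin n) ℂ) * star (U : Matrix (Fin n) (Fin n) ℂ) = 1 := U.2.2
  ext1 π
  rw [translateFun_apply]
  simp only [ContinuousMap.sum_apply, ContinuousMap.smul_apply, tensor_apply]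
  simp only [smul_comm _ (g (U⁻¹ • π) - g 0), ← Finset.smul_sum]
  rw [hN, hg, hg, RepSpace.smul_zero, mul_smul_comm, smul_mul_assoc]
  congr 1
  rw [← mul_assoc, ← mul_assoc, h, one_mul, mul_assoc, h, mul_one]

end Tensor

variable {H : Type u} [NormedAddCommGroup H] [InnerProductSpace ℂ H] [CompleteSpace H]
  {k n : ℕ} {T : Fin k → H →L[ℂ] H}

/-- Φ is contractive on functions vanishing at 0, so the right-hand side is a bounded functional of
`g` and the Riesz theorem applies. -/
theorem exists_complexMeasure
    (Φ : C(RepSpace n (generatedCStar T), Matrix (Fin n) (Fin n) ℂ) →ₗ[ℂ] generatedCStar T)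
    (hΦ : ∀ F C, F 0 = 0 → (∀ π, ‖F π‖ ≤ C) → ‖Φ F‖ ≤ C) (B : Matrix (Fin n) (Fin n) ℂ)
    (h w : H) : ∃ μ : ComplexMeasure (nSpectrum n T), ∀ g : C(RepSpace n (generatedCStar T), ℂ),
      g 0 = 0 → complexIntegral μ (fun t => g (rep t)) =
        ⟪w, (Φ (tensor B g) : H →L[ℂ] H) h⟫_ℂ := by
  let L : C(RepSpace n (generatedCStar T), ℂ) →ₗ[ℂ] ℂ :=
    { toFun := fun g => ⟪w, (Φ (tensor B g) : H →L[ℂ] H) h⟫_ℂ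
      map_add' := fun f g => by
        rw [map_add, map_add, NonUnitalStarSubalgebra.coe_add, add_apply, inner_add_right]
      map_smul' := fun c g => by
        rw [(tensor B).map_smul c g, Φ.map_smul c (tensor B g), RingHom.id_apply, smul_eq_mul,
          ← inner_smul_right]
        rfl }
  refine exists_complexMeasure_of_functional isOpenEmbedding_rep range_rep
    (L.mkContinuous (‖w‖ * (2 * ‖B‖) * ‖h‖) fun g => ?_)
  calc ‖⟪w, (Φ (tensor B g) : H →L[ℂ] H) h⟫_ℂ‖
      ≤ ‖w‖ * ‖(Φ (tensor B g) : H →L[ℂ] H) h‖ := norm_inner_le_norm _ _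
    _ ≤ ‖w‖ * (2 * ‖B‖ * ‖g‖ * ‖h‖) := by
      refine mul_le_mul_of_nonneg_left ?_ (norm_nonneg _)
      refine ((Φ (tensor B g) : H →L[ℂ] H).le_opNorm h).trans
        (mul_le_mul_of_nonneg_right ?_ (norm_nonneg _))
      exact hΦ _ _ (tensor_apply_zero B g) (norm_tensor_apply_le B g)
    _ = _ := by ring

/-- Riesz measures are assembled entrywise: operators and equivariance are known for continuous
functions from Φ, and both extend to indicators of Borel sets. -/
theorem exists_operatorNMeasure
    (Φ : C(RepSpace n (generatedCStar T), Matrix (Fin n) (Fin n) ℂ) →ₗ[ℂ] generatedCStar T)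
    (hΦ : ∀ F C, F 0 = 0 → (∀ π, ‖F π‖ ≤ C) → ‖Φ F‖ ≤ C)
    (hΦt : ∀ F V, F 0 = 0 → Φ (translateFun V F) = Φ F) :
    ∃ E : OperatorNMeasure n (nSpectrum n T) H,
      ∀ F, F 0 = 0 → E.integral (fun t => F (rep t)) = (Φ F : H →L[ℂ] H) := by
  -- The indices are swapped because the integral pairs the entry f_{lj} with E_{jl}.
  choose μ hμ using fun j l => exists_complexMeasure Φ hΦ (Matrix.single l j 1)
  have hop : ∀ j l (f : nSpectrum n T → ℂ), IsBoundedMeasurable f →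
      ∃ S : H →L[ℂ] H, ∀ h w, ⟪w, S h⟫_ℂ = complexIntegral (μ j l h w) f := fun j l f hf =>
    of_continuous (isBoundedlyClosed_exists_hasIntegral (μ j l))
      (fun g hg => ⟨_, fun h w => (hμ j l h w g hg).symm⟩) hf
  choose E hE using fun j l => exists_operatorMeasure (μ j l) fun B hB => by
    obtain ⟨S, hS⟩ := hop j l _ (isBoundedMeasurable_indicator hB)
    exact ⟨S, fun h w => (hS h w).trans (complexIntegral_indicator_one _ hB)⟩
  have hequiv : ∀ (U : Matrix.unitaryGroup (Fin n) ℂ) (h w : H) (j l : Fin n)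
      {f : nSpectrum n T → ℂ}, IsBoundedMeasurable f →
      complexIntegral (μ j l h w) (f ∘ fun x => (ProjUnitary.mk n U)⁻¹ • x) = ∑ p, ∑ q,
        ((U : Matrix (Fin n) (Fin n) ℂ) j p * star (U : Matrix (Fin n) (Fin n) ℂ) q l) *
          complexIntegral (μ p q h w) f := by
    intro U h w j l f hf
    have h1 : IsBoundedlyContinuous fun f : nSpectrum n T → ℂ =>
        complexIntegral (μ j l h w) (f ∘ fun x => (ProjUnitary.mk n U)⁻¹ • x) :=
      (isBoundedlyContinuous_complexIntegral _).comp_measurable (measurable_smul _)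
    have h2 : IsBoundedlyContinuous fun f : nSpectrum n T → ℂ => ∑ p, ∑ q,
        ((U : Matrix (Fin n) (Fin n) ℂ) j p * star (U : Matrix (Fin n) (Fin n) ℂ) q l) *
          complexIntegral (μ p q h w) f :=
      .sum _ fun p _ => .sum _ fun q _ => (isBoundedlyContinuous_complexIntegral _).const_mul _
    refine of_continuous (h1.isBoundedlyClosed h2) (fun g hg => ?_) hf
    let g' : C(RepSpace n (generatedCStar T), ℂ) :=
      ⟨fun π => g (U⁻¹ • π), g.continuous.comp (continuous_const_smul _)⟩
    have h3 : (fun t : nSpectrum n T => g (rep t)) ∘ (fun x => (ProjUnitary.mk n U)⁻¹ • x) =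
        fun t => g' (rep t) := funext fun t => congrArg g (rep_inv_smul U t)
    have hg' : g' 0 = 0 := by
      change g (U⁻¹ • 0) = 0
      rw [RepSpace.smul_zero, hg]
    simp only [h3]
    rw [hμ j l h w g' hg', tensor_single_comp_inv_smul U j l g g' fun _ => rfl, hΦt, map_sum]
    · simp only [hμ _ _ h w g hg, map_sum, map_smul]
      simp only [AddSubmonoidClass.coe_finsetSum, NonUnitalStarSubalgebra.coe_smul, sum_apply,
        smul_apply, inner_sum, inner_smul_right]
    · simp only [ContinuousMap.sum_apply, ContinuousMap.smul_apply, tensor_apply_zero, _root_.smul_zero,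
        Finset.sum_const_zero]
  refine ⟨⟨E, fun u B hB => ?_⟩, fun F hF => ?_⟩
  · obtain ⟨U, rfl⟩ := mk_surjective n u
    ext1 j l
    rw [mk_smul_apply]
    refine ContinuousLinearMap.ext fun h => ext_inner_left ℂ fun w => ?_
    have hB' : MeasurableSet (ProjUnitary.mk n U • B) := by
      rw [← Set.preimage_smul_inv]
      exact measurable_smul _ hB
    have hval : ∀ j l, ∀ B, ⟪w, (E j l).toFun B h⟫_ℂ = μ j l h w B := fun j l B => by
      rw [← hE]
      rfl
    have h1 := hequiv U h w j l (isBoundedMeasurable_indicator hB)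
    rw [indicator_comp_inv_smul, complexIntegral_indicator_one _ hB'] at h1
    simp only [sum_apply, inner_sum, smul_apply, inner_smul_right, Matrix.of_apply, hval]
    rw [h1]
    simp only [complexIntegral_indicator_one _ hB]
  · refine ContinuousLinearMap.ext fun h => ext_inner_left ℂ fun w => ?_
    rw [OperatorNMeasure.inner_integral _ (isBoundedMeasurableMatrix_comp_rep F)]
    conv_rhs => rw [eq_sum_tensor F hF]
    simp only [map_sum, AddSubmonoidClass.coe_finsetSum, sum_apply, inner_sum]
    refine Finset.sum_congr rfl fun j _ => Finset.sum_congr rfl fun l _ => ?_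
    rw [hE]
    exact hμ l j h w ⟨fun π => F π j l, F.continuous.matrix_elem j l⟩ (by
      rw [ContinuousMap.coe_mk, hF]
      rfl)

end nSpectrum

end Existence

open scoped Matrix.Norms.L2Operator

/-! ### Adjoints, products and the spectral theorem -/

section Spectral

namespace nSpectrum

section

variable {n : ℕ} {X : Type*} [MeasurableSpace X] [MulAction (ProjUnitary n) X] {H : Type*}
  [NormedAddCommGroup H] [InnerProductSpace ℂ H] [CompleteSpace H]

theorem inner_integral_mul (E : OperatorNMeasure n X H) {f g : X → Matrix (Fin n) (Fin n) ℂ}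
    (hf : IsBoundedMeasurableMatrix f) (hg : IsBoundedMeasurableMatrix g) (h w : H) :
    ⟪w, E.integral (fun t => f t * g t) h⟫_ℂ = ∑ j, ∑ l, ∑ m,
      complexIntegral ((E.entry m j).scalar h w) ((fun t => f t j l) * fun t => g t l m) := by
  rw [E.inner_integral (hf.mul hg)]
  refine Finset.sum_congr rfl fun j _ => ?_
  rw [Finset.sum_comm]
  refine Finset.sum_congr rfl fun m _ => ?_
  rw [← (isBoundedlyContinuous_complexIntegral _).map_sum _ fun l _ => (hf j l).mul (hg l m)]
  congr 1
  ext t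
  rw [Matrix.mul_apply, Finset.sum_apply]
  rfl

end

variable {H : Type u} [NormedAddCommGroup H] [InnerProductSpace ℂ H] [CompleteSpace H]
  {k n : ℕ} {T : Fin k → H →L[ℂ] H} {E : OperatorNMeasure n (nSpectrum n T) H}
  {Φ : C(RepSpace n (generatedCStar T), Matrix (Fin n) (Fin n) ℂ) →ₗ[ℂ] generatedCStar T}

/-- Compatibility of Φ with `star` gives the identity for continuous functions, and it extends one
matrix entry at a time. Equivariance plays no role here. -/
theorem adjoint_integral
    (hE : ∀ F, F 0 = 0 → E.integral (fun t => F (rep t)) = (Φ F : H →L[ℂ] H))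
    (hΦ : ∀ F, F 0 = 0 → Φ (star F) = star (Φ F))
    {f : nSpectrum n T → Matrix (Fin n) (Fin n) ℂ} (hf : IsBoundedMeasurableMatrix f) :
    ContinuousLinearMap.adjoint (E.integral f) = E.integral fun t => (f t)ᴴ := by
  refine ContinuousLinearMap.ext fun h => ext_inner_left ℂ fun w => ?_
  have key : ∀ (j l : Fin n) {φ : nSpectrum n T → ℂ}, IsBoundedMeasurable φ →
      complexIntegral ((E.entry l j).scalar w h) φ =
        star (complexIntegral ((E.entry j l).scalar h w) fun t => star (φ t)) := by
    refine fun j l φ hφ => matrix_ext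
      (L := fun j l φ => complexIntegral ((E.entry l j).scalar w h) φ)
      (L' := fun j l φ => star (complexIntegral ((E.entry j l).scalar h w) fun t => star (φ t)))
      (fun _ _ => isBoundedlyContinuous_complexIntegral _)
      (fun _ _ => (isBoundedlyContinuous_complexIntegral _).star) (fun F hF => ?_) j l hφ
    have hF' : (star F) 0 = 0 := by
      rw [ContinuousMap.star_apply, hF, star_zero]
    rw [← E.inner_integral (isBoundedMeasurableMatrix_comp_rep F), hE F hF]
    have h1 := E.inner_integral (isBoundedMeasurableMatrix_comp_rep (star F)) h w
    rw [hE _ hF', hΦ F hF, Finset.sum_comm] at h1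
    change ⟪w, ContinuousLinearMap.adjoint (Φ F : H →L[ℂ] H) h⟫_ℂ = ∑ j, ∑ l,
      complexIntegral ((E.entry j l).scalar h w) fun t => star (F (rep t) j l) at h1
    simp only [← star_sum]
    rw [← h1, ContinuousLinearMap.adjoint_inner_right]
    exact (inner_conj_symm _ _).symm
  rw [ContinuousLinearMap.adjoint_inner_right, ← inner_conj_symm, E.inner_integral hf,
    E.inner_integral hf.conjTranspose, Finset.sum_comm, map_sum]
  refine Finset.sum_congr rfl fun l _ => ?_
  rw [map_sum]
  refine Finset.sum_congr rfl fun j _ => ?_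
  rw [key j l (hf j l), starRingEnd_apply, star_star]
  rfl

/-- The module property of Φ gives this for continuous `f`. For fixed `a` both sides are boundedly
continuous in each entry of `f`, so it extends to bounded measurable functions. -/
theorem integral_mul_rep
    (hE : ∀ F, F 0 = 0 → E.integral (fun t => F (rep t)) = (Φ F : H →L[ℂ] H))
    (hΦ : ∀ F a, F 0 = 0 → Φ (F * RepSpace.transform n (generatedCStar T) a) = Φ F * a)
    {f : nSpectrum n T → Matrix (Fin n) (Fin n) ℂ} (hf : IsBoundedMeasurableMatrix f)
    (a : generatedCStar T) :
    E.integral (fun t => f t * rep t a) = E.integral f * (a : H →L[ℂ] H) := by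
  refine ContinuousLinearMap.ext fun h => ext_inner_left ℂ fun w => ?_
  let G := RepSpace.transform n (generatedCStar T) a
  have hG : IsBoundedMeasurableMatrix fun t : nSpectrum n T => rep t a :=
    isBoundedMeasurableMatrix_comp_rep G
  have key : ∀ (j l : Fin n) {φ : nSpectrum n T → ℂ}, IsBoundedMeasurable φ →
      ∑ m, complexIntegral ((E.entry m j).scalar h w) (φ * fun t => rep t a l m) =
        complexIntegral ((E.entry l j).scalar ((a : H →L[ℂ] H) h) w) φ := by
    refine fun j l φ hφ => matrix_ext
      (L := fun j l φ =>
        ∑ m, complexIntegral ((E.entry m j).scalar h w) (φ * fun t => rep t a l m))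
      (L' := fun j l φ => complexIntegral ((E.entry l j).scalar ((a : H →L[ℂ] H) h) w) φ)
      (fun _ l => .sum _ fun m _ =>
        (isBoundedlyContinuous_complexIntegral _).comp_mul (hG l m))
      (fun _ _ => isBoundedlyContinuous_complexIntegral _) (fun F hF => ?_) j l hφ
    rw [← inner_integral_mul E (isBoundedMeasurableMatrix_comp_rep F) hG,
      ← E.inner_integral (isBoundedMeasurableMatrix_comp_rep F), hE F hF]
    have hF' : (F * G) 0 = 0 := by
      rw [ContinuousMap.mul_apply, hF, zero_mul]
    have h1 := hE _ hF'
    rw [hΦ F a hF] at h1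
    exact congrArg (fun S : H →L[ℂ] H => ⟪w, S h⟫_ℂ) h1
  rw [inner_integral_mul E hf hG]
  change _ = ⟪w, E.integral f ((a : H →L[ℂ] H) h)⟫_ℂ
  rw [E.inner_integral hf]
  exact Finset.sum_congr rfl fun j _ => Finset.sum_congr rfl fun l _ => key j l (hf j l)

/-- Equivariance of `f` enters only through `hfF`, the product rule with continuous functions; the
right factor is then extended entrywise to bounded measurable `g`. -/
theorem integral_mul_of_equivariant
    (hE : ∀ F, F 0 = 0 → E.integral (fun t => F (rep t)) = (Φ F : H →L[ℂ] H))
    {f g : nSpectrum n T → Matrix (Fin n) (Fin n) ℂ} (hf : IsBoundedMeasurableMatrix f)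
    (hfF : ∀ F, F 0 = 0 →
      E.integral (fun t => f t * F (rep t)) = E.integral f * (Φ F : H →L[ℂ] H))
    (hg : IsBoundedMeasurableMatrix g) :
    E.integral (fun t => f t * g t) = E.integral f * E.integral g := by
  refine ContinuousLinearMap.ext fun h => ext_inner_left ℂ fun w => ?_
  -- Moving ∫ f dE to the other side of the inner product makes the right-hand side a scalar
  -- integral of `g`, hence boundedly continuous in its entries.
  let w' := ContinuousLinearMap.adjoint (E.integral f) w
  have hsum : ∀ {g : nSpectrum n T → Matrix (Fin n) (Fin n) ℂ}, IsBoundedMeasurableMatrix g →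
      ⟪w, E.integral (fun t => f t * g t) h⟫_ℂ = ∑ l, ∑ m, ∑ j,
        complexIntegral ((E.entry m j).scalar h w) ((fun t => g t l m) * fun t => f t j l) := by
    intro g hg
    rw [inner_integral_mul E hf hg, Finset.sum_comm]
    refine Finset.sum_congr rfl fun l _ => ?_
    rw [Finset.sum_comm]
    exact Finset.sum_congr rfl fun m _ => Finset.sum_congr rfl fun j _ => by rw [mul_comm]
  have key : ∀ (l m : Fin n) {φ : nSpectrum n T → ℂ}, IsBoundedMeasurable φ →
      ∑ j, complexIntegral ((E.entry m j).scalar h w) (φ * fun t => f t j l) =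
        complexIntegral ((E.entry m l).scalar h w') φ := by
    refine fun l m φ hφ => matrix_ext
      (L := fun l m φ =>
        ∑ j, complexIntegral ((E.entry m j).scalar h w) (φ * fun t => f t j l))
      (L' := fun l m φ => complexIntegral ((E.entry m l).scalar h w') φ)
      (fun l _ => .sum _ fun j _ =>
        (isBoundedlyContinuous_complexIntegral _).comp_mul (hf j l))
      (fun _ _ => isBoundedlyContinuous_complexIntegral _) (fun F hF => ?_) l m hφ
    rw [← hsum (isBoundedMeasurableMatrix_comp_rep F),
      ← E.inner_integral (isBoundedMeasurableMatrix_comp_rep F), hfF F hF, hE F hF,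
      ContinuousLinearMap.adjoint_inner_left]
    rfl
  rw [hsum hg]
  change _ = ⟪w, E.integral f (E.integral g h)⟫_ℂ
  rw [← ContinuousLinearMap.adjoint_inner_left, E.inner_integral hg]
  exact Finset.sum_congr rfl fun l _ => Finset.sum_congr rfl fun m _ => key l m (hg l m)

/-- Spectral theorem for `n`-homogeneous systems of operators. -/
theorem existsUnique_spectralMeasure (hT : IsHomogeneousSystem n T) :
    ∃! E : OperatorNMeasure n (nSpectrum n T) H,
      E.IsSpectral ∧ ∀ j, E.integral (coordProj n T j) = T j := by
  obtain ⟨Φ, hΦa, hΦb, hΦs, hΦm, hΦt, hΦL⟩ :=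
    RepSpace.exists_expectation_properties hT (exists_rep_ne_zero hT)
  have huniq : ∀ E : OperatorNMeasure n (nSpectrum n T) H,
      E.IsSpectral → (∀ j, E.integral (coordProj n T j) = T j) →
      ∀ F, F 0 = 0 → E.integral (fun t => F (rep t)) = (Φ F : H →L[ℂ] H) := by
    intro E hE hET F hF
    -- The constant function 1 is equivariant, so ∫ F dE depends only on the average of F, whose
    -- integral is already known.
    have h1 := integral_mul_expectation hΦL E (isBoundedMeasurableMatrix_const 1)
      (fun U _ => by rw [mul_one]; exact U.2.2.symm) hF
    simp only [one_mul] at h1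
    rw [h1, integral_rep_of_isSpectral hE hET]
  obtain ⟨E, hE⟩ := exists_operatorNMeasure Φ hΦb hΦt
  refine ⟨E, ⟨⟨fun j l h w => ?_, fun f hf => ?_, fun f g hf hg => ?_⟩, fun j => ?_⟩, ?_⟩
  · have := isFiniteMeasure_variation ((E.entry j l).scalar h w)
    exact regular _
  · exact adjoint_integral hE hΦs hf.isBoundedMeasurableMatrix
  · have hfe : ∀ (U : Matrix.unitaryGroup (Fin n) ℂ) t,
        f (ProjUnitary.mk n U • t) = U * f t * star (U : Matrix (Fin n) (Fin n) ℂ) :=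
      fun U t => (hf.equivariant _ t).trans (mk_smul_matrix U (f t))
    refine integral_mul_of_equivariant hE hf.isBoundedMeasurableMatrix (fun F hF => ?_)
      hg.isBoundedMeasurableMatrix
    -- Equivariance of `f` replaces F by the transform of Φ(F), an element of the algebra, to which
    -- the product rule with algebra elements applies.
    rw [integral_mul_expectation hΦL E hf.isBoundedMeasurableMatrix hfe hF,
      integral_mul_rep hE hΦm hf.isBoundedMeasurableMatrix]
  · have h1 := hE (RepSpace.transform n (generatedCStar T) ⟨T j, mem_generatedCStar T j⟩)
      rfl
    rw [hΦa] at h1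
    refine Eq.trans ?_ h1
    congr 1
    exact funext fun t => (rep_apply t j).symm
  · rintro E' ⟨hE', hET'⟩
    exact ext_of_integral_eq fun F hF => (huniq E' hE' hET' F hF).trans (hE F hF).symm

end nSpectrum

end Spectral

end HomogeneousSystem

end

theorem mainTheorem4 {H : Type*} [NormedAddCommGroup H] [InnerProductSpace ℂ H] [CompleteSpace H]
    (n : ℕ) (hn : 1 ≤ n) (k : ℕ) (T : Fin k → H →L[ℂ] H) (hT : IsHomogeneousSystem n T) :
    IsNSpace n (nSpectrum n T) ∧
      ∃! E : OperatorNMeasure n (nSpectrum n T) H,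
        E.IsSpectral ∧ ∀ j, E.integral (coordProj n T j) = T j :=
  ⟨nSpectrum.isNSpace hT hn, nSpectrum.existsUnique_spectralMeasure hT⟩
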